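/- Let $m\ge 1$ be an integer and let $\alpha$ be a real number with $\alpha-2m+1>0$. Put $2^*=\frac{2(\alpha+1)}{\alpha-2m+1}$. For $q\ge 1$ let $L^q_\alpha$ be the Lebesgue space on $(0,\infty)$ with norm $\|u\|_{L^q_\alpha}=\big(\int_0^\infty |u(r)|^q r^\alpha\,dr\big)^{1/q}$. Let $\Delta_\alpha u=u''+\frac{\alpha}{r}u'$, and let $\nabla^m_\alpha u=\Delta_\alpha^k u$ if $m=2k$ and $\nabla^m_\alpha u=(\Delta_\alpha^k u)'$ if $m=2k+1$. Let $\mathcal D^{m,2}_\infty(\alpha)$ be the completion, under the norm $\|u^{(m)}\|_{L^2_\alpha}$, of the space of functions $u\in C^{m-1}(0,\infty)$ such that $u^{(m-1)}$ is locally absolutely continuous on $(0,\infty)$, $\lim_{r\to\infty}u^{(j)}(r)=0$ for $j=0,\dots,m-1$, and $u^{(m)}\in L^2_\alpha$; it is regarded as a space of functions on $(0,\infty)$. Let $$\mathcal S=\inf\left\{\frac{\|\nabla^m_\alpha u\|^2_{L^2_\alpha}}{\|u\|^2_{L^{2^*}_\alpha}}:\ u\in\mathcal D^{m,2}_\infty(\alpha)\setminus\{0\}\right\}.$$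 Assume that this infimum is attained at some $z\in\mathcal D^{m,2}_\infty(\alpha)\setminus\{0\}$ with $z\in C^{2m}(0,\infty)$ such that the finite limit $z^{(i)}(0):=\lim_{r\to0^+}z^{(i)}(r)$ exists for every $0\le i\le 2m-1$, and $z^{(i)}(0)=0$ for $i=1,3,\dots,2m-1$. Then $$\mathcal S^{-\frac12}=\mathcal P^{-\frac12}\left[\frac{2\,\Gamma(\alpha+1)}{\Gamma\left(\frac{\alpha+1}{2}\right)\Gamma\left(\frac{\alpha+1}{2}\right)}\right]^{\frac{m}{\alpha+1}},\qquad \mathcal P=\prod_{h=-m}^{m-1}(\alpha+1+2h),$$ where $\Gamma$ is Euler's gamma function, and this number is the best constant of the embedding $\mathcal D^{m,2}_\infty(\alpha)\hookrightarrow L^{2^*}_\alpha$, i.e. the smallest $C\ge 0$ such that $\|u\|_{L^{2^*}_\alpha}\le C\,\|\nabla^m_\alpha u\|_{L^2_\alpha}$ for all $u\in\mathcal D^{m,2}_\infty(\alpha)$. -/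

import Mathlib

open Set Filter Topology MeasureTheory
open scoped ENNReal

noncomputable section

/-- The measure `r ^ α dr` on `(0, ∞)`. The weighted Lebesgue space `L^p_α(0, ∞)` consists of the
`f` with `MemLp f p (radialMeasure α)`, and `eLpNorm f p (radialMeasure α)` is its norm. -/
def radialMeasure (α : ℝ) : Measure ℝ :=
  (volume.restrict (Ioi (0 : ℝ))).withDensity fun r => ENNReal.ofReal (r ^ α)

/-- Locally absolutely continuous functions on `(0, ∞)`. -/
def LocallyAC (f : ℝ → ℝ) : Prop :=
  ∀ a b : ℝ, 0 < a → a ≤ b → AbsolutelyContinuousOnInterval f a b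

/-- The space `D_{0,∞}(α)` of order `m ≥ 1`: functions of class `C^{m-1}` on `(0, ∞)` whose
derivative of order `m - 1` is locally absolutely continuous, with `u^{(j)}(r) → 0` as `r → ∞` for
`j = 0, …, m - 1` and with `u^{(m)} ∈ L^2_α`. Functions on `(0, ∞)` are represented by functions on
`ℝ`, whose values on `(-∞, 0]` play no role. -/
def preD (m : ℕ) (α : ℝ) : Set (ℝ → ℝ) :=
  {u | ContDiffOn ℝ ((m - 1 : ℕ) : WithTop ℕ∞) u (Ioi 0) ∧
    LocallyAC (iteratedDeriv (m - 1) u) ∧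
    (∀ j ≤ m - 1, Tendsto (iteratedDeriv j u) atTop (𝓝 0)) ∧
    MemLp (iteratedDeriv m u) 2 (radialMeasure α)}

/-- The norm `‖u^{(m)}‖_{L^2_α}`. -/
def preDNorm (m : ℕ) (α : ℝ) (u : ℝ → ℝ) : ℝ≥0∞ :=
  eLpNorm (iteratedDeriv m u) 2 (radialMeasure α)

/-- The completion `𝒟^{m,2}_∞(α)` of `preD m α` under `preDNorm m α`, as a space of functions on
`(0, ∞)`: all the limits of the Cauchy sequences of `preD m α`. For `α - 2m + 1 > 0`, Cauchy
sequences converge pointwise on `(0, ∞)` and a Cauchy sequence is null exactly if its pointwise limit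
vanishes, so this is the completion. The limit then has the derivatives `u', …, u^{(m-1)}` on
`(0, ∞)` and `u^{(m)}` almost everywhere. -/
def spaceD (m : ℕ) (α : ℝ) : Set (ℝ → ℝ) :=
  {u | ∃ φ : ℕ → ℝ → ℝ, (∀ n, φ n ∈ preD m α) ∧
    (∀ ε : ℝ≥0∞, 0 < ε → ∃ N, ∀ i ≥ N, ∀ j ≥ N, preDNorm m α (fun r => φ i r - φ j r) < ε) ∧
    ∀ r : ℝ, 0 < r → Tendsto (fun n => φ n r) atTop (𝓝 (u r))}

/-- The `α`-generalized radial Laplacian `Δ_α u = u'' + (α / r) u'`. -/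
def radialLaplacian (α : ℝ) (u : ℝ → ℝ) : ℝ → ℝ :=
  fun r => deriv (deriv u) r + α / r * deriv u r

/-- `∇_α^m u`, equal to `Δ_α^k u` if `m = 2k` and to `(Δ_α^k u)'` if `m = 2k + 1`. -/
def radialGrad (m : ℕ) (α : ℝ) (u : ℝ → ℝ) : ℝ → ℝ :=
  if Even m then (radialLaplacian α)^[m / 2] u else deriv ((radialLaplacian α)^[m / 2] u)

/-- The critical exponent `2^* = 2(α + 1) / (α - 2m + 1)`. -/
def critExp (m : ℕ) (α : ℝ) : ℝ≥0∞ :=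
  ENNReal.ofReal (2 * (α + 1) / (α - 2 * m + 1))

/-- The quotient `‖∇_α^m u‖²_{L^2_α} / ‖u‖²_{L^{2^*}_α}`. -/
def sobolevQuotient (m : ℕ) (α : ℝ) (u : ℝ → ℝ) : ℝ≥0∞ :=
  eLpNorm (radialGrad m α u) 2 (radialMeasure α) ^ 2 /
    eLpNorm u (critExp m α) (radialMeasure α) ^ 2

/-- The nonzero elements of `𝒟^{m,2}_∞(α)`. -/
def spaceDNonzero (m : ℕ) (α : ℝ) : Set (ℝ → ℝ) :=
  {u | u ∈ spaceD m α ∧ ∃ r : ℝ, 0 < r ∧ u r ≠ 0}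

/-- `𝒮(m, 2, α, α, ∞)`, the infimum of the quotient over the nonzero elements of the space. -/
def sobolevInf (m : ℕ) (α : ℝ) : ℝ≥0∞ :=
  ⨅ u ∈ spaceDNonzero m α, sobolevQuotient m α u

/-- `z` is a minimizer for `𝒮(m, 2, α, α, ∞)`. -/
def IsSobolevMinimizer (m : ℕ) (α : ℝ) (z : ℝ → ℝ) : Prop :=
  z ∈ spaceDNonzero m α ∧ sobolevQuotient m α z = sobolevInf m α

/-- A function `u` of class `C^{2m}` on `(0, ∞)` is `ℓ`-th nonsingular at `r = 0` if the (finite)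
limits `u^{(i)}(0) := lim_{r → 0+} u^{(i)}(r)` exist for `0 ≤ i ≤ ℓ`. -/
def IsNonsingularAtZero (m ℓ : ℕ) (u : ℝ → ℝ) : Prop :=
  ContDiffOn ℝ ((2 * m : ℕ) : WithTop ℕ∞) u (Ioi 0) ∧
    ∀ i ≤ ℓ, ∃ L : ℝ, Tendsto (iteratedDeriv i u) (𝓝[>] 0) (𝓝 L)

/-- `C` is an admissible constant in the embedding `𝒟^{m,2}_∞(α) ↪ L^{2^*}_α`. -/
def IsEmbeddingConst (m : ℕ) (α : ℝ) (C : ℝ) : Prop :=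
  0 ≤ C ∧ ∀ u ∈ spaceD m α,
    eLpNorm u (critExp m α) (radialMeasure α) ≤
      ENNReal.ofReal C * eLpNorm (radialGrad m α u) 2 (radialMeasure α)

/-- `P(α, m) = ∏_{h = -m}^{m - 1} (α + 1 + 2h)`. -/
def prodP (m : ℕ) (α : ℝ) : ℝ :=
  ∏ h ∈ Finset.Ico (-(m : ℤ)) (m : ℤ), (α + 1 + 2 * (h : ℝ))

/-- The value `P^{-1/2} [2 Γ(α+1) / (Γ((α+1)/2) Γ((α+1)/2))]^{m/(α+1)}`. -/
def bestConstValue (m : ℕ) (α : ℝ) : ℝ :=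
  prodP m α ^ (-(1 / 2) : ℝ) *
    (2 * Real.Gamma (α + 1) / (Real.Gamma ((α + 1) / 2) * Real.Gamma ((α + 1) / 2)))
      ^ ((m : ℝ) / (α + 1))

end

/-!
The infimum is computed by classifying the minimizers.

Write `J* f (r) = ∫_r^∞ f` and `J f (r) = r^{-α} ∫_0^r t^α f`, the operators inverting the two
factors of `-Δ_α`. They are adjoint to each other in `L^2_α`, and they preserve positivity.

*Reduction to nonnegative functions.* Every `u` in `𝒟^{m,2}_∞(α)` satisfies `|u| ≤ A |∇_α^m u|` for
the alternating product `A = J* J J* ⋯` with `m` factors, and conversely `A F` lies in the space with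
`|∇_α^m (A F)| = F`, for every nonnegative `F ∈ L^2_α`. Hence `𝒮` is the infimum of
`∫ F² / ‖A F‖²_{2^*}` over nonnegative `F` (`sobolevInf_mul_le`, `exists_wordInv_majorant`), and the
minimizer may be replaced by `ψ = A F`. Duality and the equality case of the Cauchy–Schwarz
inequality give the Euler–Lagrange equation in integral form, `ψ = c (J* J)^m ψ^{2^* - 1}` with
`𝒮 = c ‖ψ‖^{2^* - 2}` (`exists_euler_lagrange`). Since `ψ` is the image of a nonnegative function
under `(J* J)^m`, it is decreasing, and all `f_j = (-Δ_α)^j ψ`, `j ≤ m`, are positive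
(`exists_isRadialChain`).

*Classification.* In "dimension" `n = α + 1`, the equation is conformally invariant. The derivative
`-ψ'` and the function `h = -(r² ψ' + (n - 2m) r ψ)`, which comes from translating the Kelvin
transform, both solve the linearized equation `(-Δ_1)^m φ = w φ` in the first angular sector, where
`Δ_1 = Δ_α - α / r²` and `w = (2^* - 1) c ψ^{2^* - 2}`. The operator `T = (J J*)^m` inverts
`(-Δ_1)^m`. As `-ψ'` is positive and `T` improves positivity, `1` is a simple eigenvalue of `T (w ·)`:
testing the positive part of `± h - l (-ψ')` against `-ψ'` shows that this combination cannot change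
sign (`IsRadialChain.nonneg_of_pos`). So `h` is a multiple of `ψ'`, a first order differential
equation whose solutions are the bubbles `C (r² + L)^{-(n - 2m) / 2}`
(`IsRadialChain.exists_eq_bubble`).

*The constant.* The identity `h = L ψ'` is preserved by the operator in the first angular sector and
gives a recursion for the values of the `f_j` at the origin, hence the multiplier `c`
(`IsRadialChain.c_mul_rpow_eq`). The energy of a bubble is a quotient of Gamma functions
(`lintegral_bubble`).
-/

/-! ### The operators inverting the two factors of the radial Laplacian -/

lemma ae_radialMeasure_iff (α : ℝ) {p : ℝ → Prop} :
    (∀ᵐ r ∂radialMeasure α, p r) ↔ ∀ᵐ r ∂volume.restrict (Ioi (0 : ℝ)), p r := by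
  have hm : Measurable fun r : ℝ => ENNReal.ofReal (r ^ α) := by fun_prop
  rw [radialMeasure, ae_withDensity_iff hm]
  refine eventually_congr ?_
  filter_upwards [self_mem_ae_restrict measurableSet_Ioi] with r hr
  simp [Real.rpow_pos_of_pos hr]

lemma lintegral_radialMeasure (α : ℝ) (f : ℝ → ℝ≥0∞) :
    ∫⁻ r, f r ∂radialMeasure α = ∫⁻ r in Ioi (0 : ℝ), ENNReal.ofReal (r ^ α) * f r := by
  have hm : Measurable fun r : ℝ => ENNReal.ofReal (r ^ α) := by fun_prop
  rw [radialMeasure, lintegral_withDensity_eq_lintegral_mul_non_measurable _ hm (by simp)]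
  rfl

/-- The right inverse `f ↦ ∫_r^∞ f` of `-d/dr`. -/
noncomputable def tailInt (f : ℝ → ℝ≥0∞) (r : ℝ) : ℝ≥0∞ := ∫⁻ s in Ioi r, f s

/-- The right inverse `f ↦ r^{-α} ∫_0^r s^α f` of `r^{-α} (d/dr) r^α`. -/
noncomputable def avgInt (α : ℝ) (f : ℝ → ℝ≥0∞) (r : ℝ) : ℝ≥0∞ :=
  ENNReal.ofReal (r ^ (-α)) * ∫⁻ s in Ioo 0 r, ENNReal.ofReal (s ^ α) * f s

/-- The operator `tailInt` for `true` and `avgInt` for `false`. -/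
noncomputable def halfInv (α : ℝ) : Bool → (ℝ → ℝ≥0∞) → ℝ → ℝ≥0∞
  | true => tailInt
  | false => avgInt α

/-- The composition of the operators `halfInv` along a word, the head of the word acting last. -/
noncomputable def wordInv (α : ℝ) : List Bool → (ℝ → ℝ≥0∞) → ℝ → ℝ≥0∞
  | [], f => f
  | b :: w, f => halfInv α b (wordInv α w f)

/-- The alternating word of length `k` with first letter `b`. -/
def altWord : Bool → ℕ → List Bool
  | _, 0 => []
  | b, k + 1 => b :: altWord (!b) k

lemma length_altWord (b : Bool) (k : ℕ) : (altWord b k).length = k := by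
  induction k generalizing b with
  | zero => rfl
  | succ k ih => simp [altWord, ih]

lemma altWord_add (b : Bool) (k l : ℕ) :
    altWord b (k + l) = altWord b k ++ altWord (Bool.not^[k] b) l := by
  induction k generalizing b with
  | zero => simp [altWord]
  | succ k ih => rw [show k + 1 + l = (k + l) + 1 by ring]; simp [altWord, ih]

lemma not_iterate_not_iterate (b : Bool) (k : ℕ) : Bool.not^[k] (Bool.not^[k] b) = b := by
  rw [← Function.iterate_add_apply, ← two_mul, Function.iterate_mul]
  have : (Bool.not^[2]) = id := by funext b; simp
  simp [this]

/-- The word of the adjoint operator in `L^2_α`: reversing an alternating word and exchanging the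
letters gives an alternating word. -/
lemma map_not_reverse_altWord (b : Bool) (k : ℕ) :
    (altWord b k).reverse.map Bool.not = altWord (Bool.not^[k] b) k := by
  induction k generalizing b with
  | zero => rfl
  | succ k ih =>
    rw [altWord, List.reverse_cons, List.map_append, ih, altWord_add _ k 1]
    have : Bool.not^[k + 1] b = Bool.not^[k] (!b) := rfl
    rw [this, not_iterate_not_iterate]
    rfl

lemma wordInv_append (α : ℝ) (w w' : List Bool) (f : ℝ → ℝ≥0∞) :
    wordInv α (w ++ w') f = wordInv α w (wordInv α w' f) := by
  induction w with
  | nil => rfl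
  | cons b w ih => simp [wordInv, ih]

lemma antitone_tailInt (f : ℝ → ℝ≥0∞) : Antitone (tailInt f) := fun _ _ h =>
  lintegral_mono_set (Ioi_subset_Ioi h)

lemma measurable_tailInt (f : ℝ → ℝ≥0∞) : Measurable (tailInt f) :=
  (antitone_tailInt f).measurable

lemma measurable_avgInt (α : ℝ) (f : ℝ → ℝ≥0∞) : Measurable (avgInt α f) := by
  have h : Monotone fun r : ℝ => ∫⁻ s in Ioo 0 r, ENNReal.ofReal (s ^ α) * f s := fun _ _ h =>
    lintegral_mono_set (Ioo_subset_Ioo_right h)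
  exact Measurable.mul (by fun_prop) h.measurable

lemma measurable_halfInv (α : ℝ) (b : Bool) (f : ℝ → ℝ≥0∞) : Measurable (halfInv α b f) := by
  cases b
  · exact measurable_avgInt α f
  · exact measurable_tailInt f

lemma measurable_wordInv (α : ℝ) (w : List Bool) {f : ℝ → ℝ≥0∞} (hf : Measurable f) :
    Measurable (wordInv α w f) := by
  cases w with
  | nil => exact hf
  | cons b w => exact measurable_halfInv α b _

lemma halfInv_mono_ae (α : ℝ) (b : Bool) {f g : ℝ → ℝ≥0∞}
    (h : f ≤ᵐ[volume.restrict (Ioi 0)] g) {r : ℝ} (hr : 0 ≤ r) :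
    halfInv α b f r ≤ halfInv α b g r := by
  cases b
  · refine mul_le_mul_right (lintegral_mono_ae ?_) _
    filter_upwards [ae_restrict_of_ae_restrict_of_subset Ioo_subset_Ioi_self h] with s hs
    gcongr
  · exact lintegral_mono_ae (ae_restrict_of_ae_restrict_of_subset (Ioi_subset_Ioi hr) h)

lemma halfInv_mono (α : ℝ) (b : Bool) {f g : ℝ → ℝ≥0∞}
    (h : ∀ r, 0 < r → f r ≤ g r) {r : ℝ} (hr : 0 ≤ r) :
    halfInv α b f r ≤ halfInv α b g r :=
  halfInv_mono_ae α b ((ae_restrict_iff' measurableSet_Ioi).2 (Eventually.of_forall h)) hr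

lemma wordInv_mono (α : ℝ) (w : List Bool) {f g : ℝ → ℝ≥0∞}
    (h : ∀ r, 0 < r → f r ≤ g r) {r : ℝ} (hr : 0 < r) :
    wordInv α w f r ≤ wordInv α w g r := by
  induction w generalizing r with
  | nil => exact h r hr
  | cons b w ih => exact halfInv_mono α b (fun s hs => ih hs) hr.le

lemma wordInv_mono_ae (α : ℝ) (b : Bool) (w : List Bool) {f g : ℝ → ℝ≥0∞}
    (h : f ≤ᵐ[radialMeasure α] g) {r : ℝ} (hr : 0 < r) :
    wordInv α (b :: w) f r ≤ wordInv α (b :: w) g r := by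
  induction w generalizing b r with
  | nil => exact halfInv_mono_ae α b ((ae_radialMeasure_iff α).1 h) hr.le
  | cons c w ih => exact halfInv_mono α b (fun s hs => ih c hs) hr.le

lemma wordInv_congr_ae (α : ℝ) (b : Bool) (w : List Bool) {f g : ℝ → ℝ≥0∞}
    (h : f =ᵐ[radialMeasure α] g) {r : ℝ} (hr : 0 < r) :
    wordInv α (b :: w) f r = wordInv α (b :: w) g r :=
  le_antisymm (wordInv_mono_ae α b w h.le hr) (wordInv_mono_ae α b w h.symm.le hr)

lemma halfInv_const_mul (α : ℝ) (b : Bool) (f : ℝ → ℝ≥0∞) {c : ℝ≥0∞} (hc : c ≠ ∞) :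
    halfInv α b (fun s => c * f s) = fun r => c * halfInv α b f r := by
  funext r
  cases b
  · simp only [halfInv, avgInt]
    rw [mul_left_comm, ← lintegral_const_mul' _ _ hc]
    simp only [mul_left_comm]
  · exact lintegral_const_mul' _ _ hc

lemma wordInv_const_mul (α : ℝ) (w : List Bool) (f : ℝ → ℝ≥0∞) {c : ℝ≥0∞} (hc : c ≠ ∞) :
    wordInv α w (fun s => c * f s) = fun r => c * wordInv α w f r := by
  induction w with
  | nil => rfl
  | cons b w ih => simp only [wordInv, ih, halfInv_const_mul α b _ hc]

/-- `avgInt` and `tailInt` are adjoint to each other in `L^2_α`. -/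
lemma lintegral_avgInt_mul (α : ℝ) {f g : ℝ → ℝ≥0∞} (hf : Measurable f) (hg : Measurable g) :
    ∫⁻ r, avgInt α f r * g r ∂radialMeasure α = ∫⁻ r, f r * tailInt g r ∂radialMeasure α := by
  rw [lintegral_radialMeasure, lintegral_radialMeasure]
  have hpow : Measurable fun r : ℝ => ENNReal.ofReal (r ^ α) := by fun_prop
  -- both sides are the integral of `s^α f(s) g(r)` over `0 < s < r`
  set k : ℝ → ℝ → ℝ≥0∞ := fun r s => (Ioi (0 : ℝ)).indicator (fun s =>
    (Ioi s).indicator (fun r => ENNReal.ofReal (s ^ α) * f s * g r) r) s with hk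
  have hkm : Measurable (Function.uncurry k) := by
    have hset : MeasurableSet {p : ℝ × ℝ | 0 < p.2 ∧ p.2 < p.1} :=
      (measurableSet_lt measurable_const measurable_snd).inter
        (measurableSet_lt measurable_snd measurable_fst)
    have : Function.uncurry k = {p : ℝ × ℝ | 0 < p.2 ∧ p.2 < p.1}.indicator
        (fun p => ENNReal.ofReal (p.2 ^ α) * f p.2 * g p.1) := by
      funext p
      by_cases h1 : 0 < p.2 <;> by_cases h2 : p.2 < p.1 <;>
        simp [hk, Function.uncurry, h1, h2, indicator]
    rw [this]
    exact Measurable.indicator (((hpow.comp measurable_snd).mul (hf.comp measurable_snd)).mul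
      (hg.comp measurable_fst)) hset
  have h1 : ∫⁻ r in Ioi (0 : ℝ), ENNReal.ofReal (r ^ α) * (avgInt α f r * g r) =
      ∫⁻ r, ∫⁻ s, k r s := by
    rw [← lintegral_indicator measurableSet_Ioi]
    refine lintegral_congr fun r => ?_
    have : ∀ s, k r s = (Ioo 0 r).indicator (fun s => g r * (ENNReal.ofReal (s ^ α) * f s)) s := by
      intro s
      by_cases h1 : 0 < s <;> by_cases h2 : s < r <;>
        simp [hk, h1, h2, indicator, mul_comm, mul_left_comm]
    simp_rw [this]
    rw [lintegral_indicator measurableSet_Ioo,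
      lintegral_const_mul (g r) (f := fun s => ENNReal.ofReal (s ^ α) * f s) (hpow.mul hf)]
    by_cases hr : 0 < r
    · have : ENNReal.ofReal (r ^ α) * ENNReal.ofReal (r ^ (-α)) = 1 := by
        rw [← ENNReal.ofReal_mul (by positivity), ← Real.rpow_add hr]; simp
      simp only [indicator, mem_Ioi, hr, if_true, avgInt]
      rw [← mul_assoc, ← mul_assoc, this, one_mul, mul_comm]
    · simp [hr, indicator]
  have h2 : ∫⁻ s in Ioi (0 : ℝ), ENNReal.ofReal (s ^ α) * (f s * tailInt g s) =
      ∫⁻ s, ∫⁻ r, k r s := by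
    rw [← lintegral_indicator measurableSet_Ioi]
    refine lintegral_congr fun s => ?_
    by_cases hs : 0 < s
    · simp only [hk, indicator, mem_Ioi, hs, if_true]
      have := lintegral_indicator (μ := volume) (measurableSet_Ioi (a := s))
        (fun r => ENNReal.ofReal (s ^ α) * f s * g r)
      simp only [indicator, mem_Ioi] at this
      rw [this, lintegral_const_mul _ hg, mul_assoc, tailInt]
    · simp [hk, hs, indicator]
  rw [h1, h2, lintegral_lintegral_swap hkm.aemeasurable]

lemma lintegral_halfInv_mul (α : ℝ) (b : Bool) {f g : ℝ → ℝ≥0∞} (hf : Measurable f)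
    (hg : Measurable g) :
    ∫⁻ r, halfInv α b f r * g r ∂radialMeasure α =
      ∫⁻ r, f r * halfInv α (!b) g r ∂radialMeasure α := by
  cases b
  · exact lintegral_avgInt_mul α hf hg
  · have := lintegral_avgInt_mul α hg hf
    simp only [mul_comm (avgInt α g _), mul_comm (g _)] at this
    exact this.symm

lemma lintegral_wordInv_mul (α : ℝ) (w : List Bool) {f g : ℝ → ℝ≥0∞} (hf : Measurable f)
    (hg : Measurable g) :
    ∫⁻ r, wordInv α w f r * g r ∂radialMeasure α =
      ∫⁻ r, f r * wordInv α (w.reverse.map Bool.not) g r ∂radialMeasure α := by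
  induction w generalizing g with
  | nil => rfl
  | cons b w ih =>
    rw [List.reverse_cons, List.map_append, wordInv_append]
    simp only [wordInv]
    rw [lintegral_halfInv_mul α b (measurable_wordInv α w hf) hg,
      ih (measurable_halfInv α _ g)]
    rfl

lemma lintegral_altWord_mul (α : ℝ) (b : Bool) (k : ℕ) {f g : ℝ → ℝ≥0∞} (hf : Measurable f)
    (hg : Measurable g) :
    ∫⁻ r, wordInv α (altWord b k) f r * g r ∂radialMeasure α =
      ∫⁻ r, f r * wordInv α (altWord (Bool.not^[k] b) k) g r ∂radialMeasure α := by
  rw [lintegral_wordInv_mul α _ hf hg, map_not_reverse_altWord]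

/-! ### Hardy inequalities -/

lemma lintegral_Ioi_rpow {p r : ℝ} (hp : p < -1) (hr : 0 < r) :
    ∫⁻ s in Ioi r, ENNReal.ofReal (s ^ p) = ENNReal.ofReal (r ^ (p + 1) / (-(p + 1))) := by
  rw [← ofReal_integral_eq_lintegral_ofReal (integrableOn_Ioi_rpow_of_lt hp hr),
    integral_Ioi_rpow_of_lt hp hr]
  · rw [div_neg, neg_div]
  · filter_upwards [self_mem_ae_restrict measurableSet_Ioi] with s hs
    exact Real.rpow_nonneg (hr.trans hs).le _

lemma lintegral_Ioo_rpow {p r : ℝ} (hp : -1 < p) (hr : 0 < r) :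
    ∫⁻ s in Ioo 0 r, ENNReal.ofReal (s ^ p) = ENNReal.ofReal (r ^ (p + 1) / (p + 1)) := by
  have hi : IntervalIntegrable (fun s : ℝ => s ^ p) volume 0 r :=
    intervalIntegral.intervalIntegrable_rpow' hp
  have hi' : IntegrableOn (fun s : ℝ => s ^ p) (Ioo 0 r) :=
    ((intervalIntegrable_iff_integrableOn_Ioc_of_le hr.le).1 hi).mono_set Ioo_subset_Ioc_self
  rw [← ofReal_integral_eq_lintegral_ofReal hi', ← integral_Ioc_eq_integral_Ioo,
    ← intervalIntegral.integral_of_le hr.le, integral_rpow (Or.inl hp),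
    Real.zero_rpow (by linarith), sub_zero]
  filter_upwards [self_mem_ae_restrict measurableSet_Ioo] with s hs
  exact Real.rpow_nonneg hs.1.le _

/-- The Cauchy–Schwarz inequality. -/
lemma sq_lintegral_mul_le {μ : Measure ℝ} {f g : ℝ → ℝ≥0∞} (hf : AEMeasurable f μ)
    (hg : AEMeasurable g μ) :
    (∫⁻ r, f r * g r ∂μ) ^ 2 ≤ (∫⁻ r, f r ^ 2 ∂μ) * ∫⁻ r, g r ^ 2 ∂μ := by
  have h := ENNReal.lintegral_mul_le_Lp_mul_Lq μ Real.HolderConjugate.two_two hf hg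
  simp only [Pi.mul_apply, ENNReal.rpow_two] at h
  calc _ ≤ ((∫⁻ r, f r ^ 2 ∂μ) ^ (1 / 2 : ℝ) * (∫⁻ r, g r ^ 2 ∂μ) ^ (1 / 2 : ℝ)) ^ 2 := by gcongr
    _ = _ := by
      rw [mul_pow, ← ENNReal.rpow_two, ← ENNReal.rpow_two, ← ENNReal.rpow_mul, ← ENNReal.rpow_mul]
      norm_num

/-- Fubini's theorem on the triangle `0 < r < s`. -/
lemma lintegral_Ioi_mul_lintegral_Ioi {a b : ℝ → ℝ≥0∞} (ha : Measurable a) (hb : Measurable b) :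
    ∫⁻ r in Ioi (0 : ℝ), a r * ∫⁻ s in Ioi r, b s =
      ∫⁻ s in Ioi (0 : ℝ), (∫⁻ r in Ioo 0 s, a r) * b s := by
  have := lintegral_avgInt_mul 0 ha hb
  rw [lintegral_radialMeasure, lintegral_radialMeasure] at this
  simpa [avgInt, tailInt] using this.symm

lemma ofReal_rpow_mul_ofReal_rpow {r : ℝ} (hr : 0 < r) (p p' : ℝ) :
    ENNReal.ofReal (r ^ p) * ENNReal.ofReal (r ^ p') = ENNReal.ofReal (r ^ (p + p')) := by
  rw [← ENNReal.ofReal_mul (by positivity), Real.rpow_add hr]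

/-- Hardy's inequality for `tailInt`. -/
lemma exists_hardy_tailInt {β : ℝ} (hβ : 1 < β) : ∃ C : ℝ≥0∞, C ≠ ∞ ∧ ∀ f : ℝ → ℝ≥0∞,
    Measurable f → ∫⁻ r in Ioi (0 : ℝ), ENNReal.ofReal (r ^ (β - 2)) * tailInt f r ^ 2 ≤
      C * ∫⁻ r in Ioi (0 : ℝ), ENNReal.ofReal (r ^ β) * f r ^ 2 := by
  -- Cauchy–Schwarz with the weight `s ^ p`, for `p` strictly between `1` and `β`
  set p := (1 + β) / 2 with hp
  refine ⟨ENNReal.ofReal (1 / (p - 1)) * ENNReal.ofReal (1 / (β - p)),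
    ENNReal.mul_ne_top (by simp) (by simp), fun f hf => ?_⟩
  have key : ∀ r ∈ Ioi (0 : ℝ), ENNReal.ofReal (r ^ (β - 2)) * tailInt f r ^ 2 ≤
      ENNReal.ofReal (1 / (p - 1)) * (ENNReal.ofReal (r ^ (β - 1 - p)) *
        ∫⁻ s in Ioi r, ENNReal.ofReal (s ^ p) * f s ^ 2) := by
    intro r hr
    have hr : 0 < r := hr
    have h1 : tailInt f r ^ 2 ≤ (∫⁻ s in Ioi r, ENNReal.ofReal (s ^ (-p))) *
        ∫⁻ s in Ioi r, ENNReal.ofReal (s ^ p) * f s ^ 2 := by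
      have := sq_lintegral_mul_le (μ := volume.restrict (Ioi r))
        (f := fun s => ENNReal.ofReal (s ^ (-p / 2)))
        (g := fun s => ENNReal.ofReal (s ^ (p / 2)) * f s) (by fun_prop) (by fun_prop)
      refine le_trans (le_of_eq ?_) (this.trans (le_of_eq ?_))
      · congr 1
        refine setLIntegral_congr_fun measurableSet_Ioi fun s hs => ?_
        have hs : 0 < s := hr.trans hs
        rw [← mul_assoc, ofReal_rpow_mul_ofReal_rpow hs, show -p / 2 + p / 2 = 0 by ring]
        simp
      · congr 1 <;> refine setLIntegral_congr_fun measurableSet_Ioi fun s hs => ?_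
        · have hs : 0 < s := hr.trans hs
          rw [sq, ofReal_rpow_mul_ofReal_rpow hs]
          ring_nf
        · have hs : 0 < s := hr.trans hs
          rw [mul_pow, sq (ENNReal.ofReal _), ofReal_rpow_mul_ofReal_rpow hs]
          ring_nf
    rw [lintegral_Ioi_rpow (by linarith) hr] at h1
    calc _ ≤ ENNReal.ofReal (r ^ (β - 2)) * (ENNReal.ofReal (r ^ (-p + 1) / -(-p + 1)) *
          ∫⁻ s in Ioi r, ENNReal.ofReal (s ^ p) * f s ^ 2) := by gcongr
      _ = _ := by
        rw [← mul_assoc, ← mul_assoc, ← ENNReal.ofReal_mul (by positivity),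
          ← ENNReal.ofReal_mul (by rw [one_div_nonneg]; linarith)]
        congr 2
        rw [show β - 1 - p = (β - 2) + (-p + 1) by ring, Real.rpow_add hr _ (-p + 1),
          show -(-p + 1) = p - 1 by ring]
        ring
  refine (setLIntegral_mono' measurableSet_Ioi key).trans ?_
  rw [lintegral_const_mul' _ _ (by simp), mul_assoc,
    lintegral_Ioi_mul_lintegral_Ioi (by fun_prop) (by fun_prop),
    ← lintegral_const_mul' _ _ (by simp : ENNReal.ofReal (1 / (β - p)) ≠ ∞)]
  gcongr _ * ?_
  refine le_of_eq (setLIntegral_congr_fun measurableSet_Ioi fun s hs => ?_)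
  have hs : 0 < s := hs
  rw [lintegral_Ioo_rpow (by linarith) hs, ← mul_assoc, ← mul_assoc,
    ← ENNReal.ofReal_mul (by apply div_nonneg (by positivity); linarith),
    ← ENNReal.ofReal_mul (by rw [one_div_nonneg]; linarith)]
  congr 2
  rw [show s ^ β = s ^ (β - 1 - p + 1) * s ^ p by rw [← Real.rpow_add hs]; ring_nf,
    show β - 1 - p + 1 = β - p by ring]
  ring

/-- Hardy's inequality for `avgInt`. -/
lemma exists_hardy_avgInt {α β : ℝ} (hβ : β < 2 * α + 1) : ∃ C : ℝ≥0∞, C ≠ ∞ ∧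
    ∀ f : ℝ → ℝ≥0∞, Measurable f →
    ∫⁻ r in Ioi (0 : ℝ), ENNReal.ofReal (r ^ (β - 2)) * avgInt α f r ^ 2 ≤
      C * ∫⁻ r in Ioi (0 : ℝ), ENNReal.ofReal (r ^ β) * f r ^ 2 := by
  -- Cauchy–Schwarz with the weight `s ^ p`, for `p` strictly between `β` and `2 * α + 1`
  set p := (2 * α + 1 + β) / 2 with hp
  set C₁ := 2 * α - p + 1 with hC₁
  have hC₁0 : 0 < C₁ := by linarith
  have hC₂0 : 0 < p - β := by linarith
  refine ⟨ENNReal.ofReal (1 / C₁) * ENNReal.ofReal (1 / (p - β)),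
    ENNReal.mul_ne_top (by simp) (by simp), fun f hf => ?_⟩
  have key : ∀ r ∈ Ioi (0 : ℝ), ENNReal.ofReal (r ^ (β - 2)) * avgInt α f r ^ 2 ≤
      ENNReal.ofReal (1 / C₁) * ((∫⁻ s in Ioo 0 r, ENNReal.ofReal (s ^ p) * f s ^ 2) *
        ENNReal.ofReal (r ^ (β - 1 - p))) := by
    intro r hr
    have hr : 0 < r := hr
    have h1 : (∫⁻ s in Ioo 0 r, ENNReal.ofReal (s ^ α) * f s) ^ 2 ≤
        (∫⁻ s in Ioo 0 r, ENNReal.ofReal (s ^ (2 * α - p))) *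
        ∫⁻ s in Ioo 0 r, ENNReal.ofReal (s ^ p) * f s ^ 2 := by
      have := sq_lintegral_mul_le (μ := volume.restrict (Ioo 0 r))
        (f := fun s => ENNReal.ofReal (s ^ (α - p / 2)))
        (g := fun s => ENNReal.ofReal (s ^ (p / 2)) * f s) (by fun_prop) (by fun_prop)
      refine le_trans (le_of_eq ?_) (this.trans (le_of_eq ?_))
      · congr 1
        refine setLIntegral_congr_fun measurableSet_Ioo fun s hs => ?_
        rw [← mul_assoc, ofReal_rpow_mul_ofReal_rpow hs.1, show α - p / 2 + p / 2 = α by ring]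
      · congr 1 <;> refine setLIntegral_congr_fun measurableSet_Ioo fun s hs => ?_
        · rw [sq, ofReal_rpow_mul_ofReal_rpow hs.1]
          ring_nf
        · rw [mul_pow, sq (ENNReal.ofReal _), ofReal_rpow_mul_ofReal_rpow hs.1]
          ring_nf
    rw [lintegral_Ioo_rpow (by linarith) hr, ← hC₁] at h1
    calc _ ≤ ENNReal.ofReal (r ^ (β - 2)) * (ENNReal.ofReal (r ^ (-α)) ^ 2 *
          (ENNReal.ofReal (r ^ C₁ / C₁) *
          ∫⁻ s in Ioo 0 r, ENNReal.ofReal (s ^ p) * f s ^ 2)) := by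
            rw [avgInt, mul_pow]; gcongr
      _ = _ := by
        rw [sq, ofReal_rpow_mul_ofReal_rpow hr, mul_comm (∫⁻ s in Ioo 0 r, _) (ENNReal.ofReal _),
          ← mul_assoc, ← mul_assoc, ← mul_assoc, ofReal_rpow_mul_ofReal_rpow hr,
          ← ENNReal.ofReal_mul (by positivity), ← ENNReal.ofReal_mul (by positivity)]
        congr 2
        rw [show β - 1 - p = (β - 2 + (-α + -α)) + C₁ by ring, Real.rpow_add hr _ C₁]
        ring
  refine (setLIntegral_mono' measurableSet_Ioi key).trans ?_
  rw [lintegral_const_mul' _ _ (by simp), mul_assoc,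
    ← lintegral_Ioi_mul_lintegral_Ioi (by fun_prop) (by fun_prop),
    ← lintegral_const_mul' _ _ (by simp : ENNReal.ofReal (1 / (p - β)) ≠ ∞)]
  gcongr _ * ?_
  refine le_of_eq (setLIntegral_congr_fun measurableSet_Ioi fun s hs => ?_)
  have hs : 0 < s := hs
  rw [lintegral_Ioi_rpow (by linarith) hs, mul_comm, ← mul_assoc, ← mul_assoc,
    ← ENNReal.ofReal_mul (by apply div_nonneg (by positivity); linarith),
    ← ENNReal.ofReal_mul (by positivity)]
  congr 2
  rw [show s ^ β = s ^ (β - 1 - p + 1) * s ^ p by rw [← Real.rpow_add hs]; ring_nf,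
    show -(β - 1 - p + 1) = p - β by ring]
  ring

/-- Hardy's inequality along a word: a word of length `k` maps `L^2_α` to `r^k L^2_α`. -/
lemma exists_hardy_wordInv {α : ℝ} (w : List Bool) (hw : 2 * (w.length : ℝ) < α + 1) :
    ∃ C : ℝ≥0∞, C ≠ ∞ ∧ ∀ f : ℝ → ℝ≥0∞, Measurable f →
    ∫⁻ r in Ioi (0 : ℝ), ENNReal.ofReal (r ^ (α - 2 * w.length)) * wordInv α w f r ^ 2 ≤
      C * ∫⁻ r, f r ^ 2 ∂radialMeasure α := by
  induction w with
  | nil => exact ⟨1, by simp, fun f _ => by simp [lintegral_radialMeasure, wordInv]⟩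
  | cons b w ih =>
    rw [List.length_cons] at hw ⊢
    push_cast at hw ⊢
    obtain ⟨C, hC, h⟩ := ih (by linarith)
    obtain ⟨C', hC', h'⟩ : ∃ C : ℝ≥0∞, C ≠ ∞ ∧ ∀ f : ℝ → ℝ≥0∞, Measurable f →
        ∫⁻ r in Ioi (0 : ℝ), ENNReal.ofReal (r ^ (α - 2 * w.length - 2)) * halfInv α b f r ^ 2 ≤
        C * ∫⁻ r in Ioi (0 : ℝ), ENNReal.ofReal (r ^ (α - 2 * w.length)) * f r ^ 2 := by
      have : (0 : ℝ) ≤ w.length := by positivity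
      cases b
      · exact exists_hardy_avgInt (by linarith)
      · exact exists_hardy_tailInt (by linarith)
    refine ⟨C' * C, ENNReal.mul_ne_top hC' hC, fun f hf => ?_⟩
    rw [mul_assoc]
    refine le_trans ?_ (mul_le_mul_right (h f hf) C')
    rw [show α - 2 * ((w.length : ℝ) + 1) = α - 2 * w.length - 2 by ring]
    exact h' _ (measurable_wordInv α w hf)

lemma rpow_mul_avgInt_mono (α : ℝ) (f : ℝ → ℝ≥0∞) {r s : ℝ} (hr : 0 < r) (hs : r ≤ s) :
    ENNReal.ofReal (r ^ α) * avgInt α f r ≤ ENNReal.ofReal (s ^ α) * avgInt α f s := by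
  have hs0 : 0 < s := hr.trans_le hs
  simp only [avgInt]
  rw [← mul_assoc, ← mul_assoc, ofReal_rpow_mul_ofReal_rpow hr, ofReal_rpow_mul_ofReal_rpow hs0]
  simp only [add_neg_cancel, Real.rpow_zero, ENNReal.ofReal_one, one_mul]
  exact lintegral_mono_set (Ioo_subset_Ioo_right hs)

/-- The pointwise bound that goes with Hardy's inequality. -/
lemma exists_pointwise_wordInv {α : ℝ} (b : Bool) (w : List Bool)
    (hw : 2 * ((b :: w).length : ℝ) < α + 1) :
    ∃ C : ℝ≥0∞, C ≠ ∞ ∧ ∀ f : ℝ → ℝ≥0∞, Measurable f → ∀ r : ℝ, 0 < r →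
    wordInv α (b :: w) f r ^ 2 ≤
      C * ENNReal.ofReal (r ^ (-(α + 1 - 2 * ((b :: w).length : ℝ)))) *
        ∫⁻ r, f r ^ 2 ∂radialMeasure α := by
  obtain ⟨C, hC, h⟩ := exists_hardy_wordInv (b :: w) hw
  set p := α - 2 * ((b :: w).length : ℝ) with hp
  have hp1 : -1 < p := by linarith
  have hl : (0 : ℝ) ≤ ((b :: w).length : ℝ) := by positivity
  have key : ∀ D : ℝ, 0 < D → ∀ r : ℝ, 0 < r → ∀ X E : ℝ≥0∞,
      ENNReal.ofReal (r ^ (p + 1) / D) * X ≤ C * E →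
      X ≤ ENNReal.ofReal D * C * ENNReal.ofReal (r ^ (-(p + 1))) * E := by
    intro D hD r hr X E hX
    calc X = ENNReal.ofReal (D * r ^ (-(p + 1))) * (ENNReal.ofReal (r ^ (p + 1) / D) * X) := by
          rw [← mul_assoc, ← ENNReal.ofReal_mul (by positivity),
            show D * r ^ (-(p + 1)) * (r ^ (p + 1) / D) = r ^ (-(p + 1)) * r ^ (p + 1) by field_simp,
            ← Real.rpow_add hr]
          simp
      _ ≤ ENNReal.ofReal (D * r ^ (-(p + 1))) * (C * E) := by gcongr
      _ = _ := by rw [ENNReal.ofReal_mul hD.le]; ring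
  rw [show α + 1 - 2 * ((b :: w).length : ℝ) = p + 1 by rw [hp]; ring]
  cases b
  · refine ⟨ENNReal.ofReal (2 * α - p - 1) * C, ENNReal.mul_ne_top (by simp) hC,
      fun f hf r hr => ?_⟩
    have hD : 0 < 2 * α - p - 1 := by
      have : (1 : ℝ) ≤ ((false :: w).length : ℝ) := by simp
      linarith
    refine key _ hD r hr _ _ (le_trans ?_ (h f hf))
    set g := wordInv α w f
    calc ENNReal.ofReal (r ^ (p + 1) / (2 * α - p - 1)) * avgInt α g r ^ 2
        = ∫⁻ s in Ioi r, ENNReal.ofReal (s ^ (p - 2 * α)) *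
            (ENNReal.ofReal (r ^ α) * avgInt α g r) ^ 2 := by
          rw [lintegral_mul_const _ (by fun_prop), lintegral_Ioi_rpow (by linarith) hr, mul_pow,
            ← mul_assoc, sq (ENNReal.ofReal _), ofReal_rpow_mul_ofReal_rpow hr,
            ← ENNReal.ofReal_mul (div_nonneg (by positivity) (by linarith))]
          congr 2
          rw [show p + 1 = (p - 2 * α + 1) + (α + α) by ring, Real.rpow_add hr _ (α + α),
            show -(p - 2 * α + 1) = 2 * α - p - 1 by ring]
          ring
      _ ≤ ∫⁻ s in Ioi r, ENNReal.ofReal (s ^ p) * avgInt α g s ^ 2 := by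
          refine setLIntegral_mono' measurableSet_Ioi fun s hs => ?_
          have hs0 : 0 < s := hr.trans hs
          calc _ ≤ ENNReal.ofReal (s ^ (p - 2 * α)) *
                (ENNReal.ofReal (s ^ α) * avgInt α g s) ^ 2 := by
                gcongr _ * ?_ ^ 2
                exact rpow_mul_avgInt_mono α g hr (le_of_lt hs)
            _ = _ := by
              rw [mul_pow, ← mul_assoc, sq (ENNReal.ofReal _), ofReal_rpow_mul_ofReal_rpow hs0,
                ofReal_rpow_mul_ofReal_rpow hs0]
              ring_nf
      _ ≤ _ := lintegral_mono_set (Ioi_subset_Ioi hr.le)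
  · refine ⟨ENNReal.ofReal (p + 1) * C, ENNReal.mul_ne_top (by simp) hC, fun f hf r hr => ?_⟩
    refine key _ (by linarith) r hr _ _ (le_trans ?_ (h f hf))
    rw [← lintegral_Ioo_rpow hp1 hr, ← lintegral_mul_const _ (by fun_prop)]
    refine le_trans (setLIntegral_mono' measurableSet_Ioo fun s hs => ?_)
      (lintegral_mono_set (Ioo_subset_Ioi_self : Ioo 0 r ⊆ Ioi (0 : ℝ)))
    gcongr
    exact antitone_tailInt _ hs.2.le

/-- A Sobolev inequality with a non-sharp constant. -/
lemma exists_sobolev_wordInv {α : ℝ} (b : Bool) (w : List Bool)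
    (hw : 2 * ((b :: w).length : ℝ) < α + 1) :
    ∃ C : ℝ≥0∞, C ≠ ∞ ∧ ∀ f : ℝ → ℝ≥0∞, Measurable f →
    ∫⁻ r, wordInv α (b :: w) f r ^ (2 * (α + 1) / (α + 1 - 2 * ((b :: w).length : ℝ)))
        ∂radialMeasure α ≤
      C * (∫⁻ r, f r ^ 2 ∂radialMeasure α) ^
        ((α + 1) / (α + 1 - 2 * ((b :: w).length : ℝ))) := by
  obtain ⟨C, hC, h⟩ := exists_hardy_wordInv (b :: w) hw
  obtain ⟨C', hC', h'⟩ := exists_pointwise_wordInv b w hw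
  set k : ℝ := ((b :: w).length : ℝ) with hk
  have hk1 : 1 ≤ k := by rw [hk]; simp
  have hd : 0 < α + 1 - 2 * k := by linarith
  -- the exponent is `2 * e + 2`: the power `2 * e` is bounded pointwise, the square by Hardy
  set e := 2 * k / (α + 1 - 2 * k) with he
  have he0 : 0 ≤ e := by positivity
  have hq : 2 * (α + 1) / (α + 1 - 2 * k) = 2 * e + 2 := by rw [he]; field_simp; ring
  have hq' : (α + 1) / (α + 1 - 2 * k) = e + 1 := by rw [he]; field_simp; ring
  refine ⟨C' ^ e * C, ENNReal.mul_ne_top (ENNReal.rpow_ne_top_of_nonneg he0 hC') hC,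
    fun f hf => ?_⟩
  set E := ∫⁻ r, f r ^ 2 ∂radialMeasure α
  rw [hq, hq', lintegral_radialMeasure]
  have hm : Measurable (wordInv α (b :: w) f) := measurable_wordInv α _ hf
  calc _ ≤ ∫⁻ r in Ioi (0 : ℝ), (C' ^ e * E ^ e) *
        (ENNReal.ofReal (r ^ (α - 2 * k)) * wordInv α (b :: w) f r ^ 2) := by
        refine setLIntegral_mono' measurableSet_Ioi fun r hr => ?_
        have hr : 0 < r := hr
        have h1 := ENNReal.rpow_le_rpow (h' f hf r hr) he0
        rw [ENNReal.mul_rpow_of_nonneg _ _ he0, ENNReal.mul_rpow_of_nonneg _ _ he0,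
          ENNReal.ofReal_rpow_of_pos (by positivity), ← Real.rpow_mul hr.le,
          show -(α + 1 - 2 * k) * e = -(2 * k) by rw [he]; field_simp] at h1
        have h2 : wordInv α (b :: w) f r ^ (2 * e + 2) =
            (wordInv α (b :: w) f r ^ 2) ^ e * wordInv α (b :: w) f r ^ 2 := by
          rw [ENNReal.rpow_add_of_nonneg _ _ (by positivity) (by norm_num), ENNReal.rpow_mul,
            ENNReal.rpow_two]
        rw [h2]
        calc _ ≤ ENNReal.ofReal (r ^ α) * ((C' ^ e * ENNReal.ofReal (r ^ (-(2 * k))) * E ^ e) *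
              wordInv α (b :: w) f r ^ 2) := by gcongr
          _ = (C' ^ e * E ^ e) * ((ENNReal.ofReal (r ^ α) * ENNReal.ofReal (r ^ (-(2 * k)))) *
              wordInv α (b :: w) f r ^ 2) := by ring
          _ = _ := by rw [ofReal_rpow_mul_ofReal_rpow hr, ← sub_eq_add_neg]
    _ = (C' ^ e * E ^ e) * ∫⁻ r in Ioi (0 : ℝ),
        ENNReal.ofReal (r ^ (α - 2 * k)) * wordInv α (b :: w) f r ^ 2 := by
        rw [lintegral_const_mul _ (by fun_prop)]
    _ ≤ (C' ^ e * E ^ e) * (C * E) := by gcongr; exact h f hf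
    _ = _ := by
      rw [ENNReal.rpow_add_of_nonneg _ _ he0 zero_le_one, ENNReal.rpow_one]; ring

/-! ### Absolute continuity and the fundamental theorem of calculus -/

lemma LocallyAC.continuousOn {f : ℝ → ℝ} (hf : LocallyAC f) : ContinuousOn f (Ioi 0) := by
  intro r hr
  have hr : 0 < r := hr
  have h := (hf (r / 2) (2 * r) (by linarith) (by linarith)).continuousOn
  rw [uIcc_of_le (by linarith)] at h
  exact (h.continuousAt (Icc_mem_nhds (by linarith) (by linarith))).continuousWithinAt

lemma ContDiffOn.locallyAC {f : ℝ → ℝ} (hf : ContDiffOn ℝ 1 f (Ioi 0)) : LocallyAC f := by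
  intro a b ha hab
  refine (hf.mono ?_).absolutelyContinuousOnInterval
  rw [uIcc_of_le hab]
  exact fun x hx => ha.trans_le hx.1

lemma locallyAC_rpow (p : ℝ) : LocallyAC fun r => r ^ p :=
  ContDiffOn.locallyAC fun r (hr : 0 < r) =>
    (Real.contDiffAt_rpow_const_of_ne hr.ne').contDiffWithinAt

lemma AbsolutelyContinuousOnInterval.congr_Icc {f g : ℝ → ℝ} {a b : ℝ}
    (hf : AbsolutelyContinuousOnInterval f a b) (h : ∀ x ∈ uIcc a b, f x = g x) :
    AbsolutelyContinuousOnInterval g a b := by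
  rw [absolutelyContinuousOnInterval_iff] at hf ⊢
  intro ε hε
  obtain ⟨δ, hδ, H⟩ := hf ε hε
  refine ⟨δ, hδ, fun E hE hE' => ?_⟩
  refine lt_of_eq_of_lt (Finset.sum_congr rfl fun i hi => ?_) (H E hE hE')
  rw [h _ (hE.1 i hi).1, h _ (hE.1 i hi).2]

lemma LocallyAC.congr {f g : ℝ → ℝ} (hf : LocallyAC f) (h : ∀ r, 0 < r → f r = g r) :
    LocallyAC g := fun a b ha hab => (hf a b ha hab).congr_Icc fun x hx => by
  rw [uIcc_of_le hab] at hx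
  exact h x (ha.trans_le hx.1)

lemma LocallyAC.mul {f g : ℝ → ℝ} (hf : LocallyAC f) (hg : LocallyAC g) :
    LocallyAC fun r => f r * g r := fun a b ha hab => (hf a b ha hab).fun_mul (hg a b ha hab)

lemma LocallyAC.add {f g : ℝ → ℝ} (hf : LocallyAC f) (hg : LocallyAC g) :
    LocallyAC fun r => f r + g r := fun a b ha hab => (hf a b ha hab).fun_add (hg a b ha hab)

lemma LocallyAC.const_mul {f : ℝ → ℝ} (hf : LocallyAC f) (c : ℝ) :
    LocallyAC fun r => c * f r := fun a b ha hab => (hf a b ha hab).const_mul c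

/-- A property that holds a.e. on every compact subinterval holds a.e. on `(0, ∞)`. -/
lemma ae_Ioi_of_forall_Icc {p : ℝ → Prop}
    (h : ∀ a b : ℝ, 0 < a → a ≤ b → ∀ᵐ r, r ∈ Icc a b → p r) :
    ∀ᵐ r ∂volume.restrict (Ioi (0 : ℝ)), p r := by
  rw [ae_restrict_iff' measurableSet_Ioi]
  have : ∀ᵐ r : ℝ, ∀ k : ℕ, r ∈ Icc (1 / ((k : ℝ) + 1)) ((k : ℝ) + 1) → p r := by
    refine ae_all_iff.2 fun k => h _ _ (by positivity) ?_
    rw [div_le_iff₀ (by positivity)]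
    nlinarith [(by positivity : (0 : ℝ) ≤ k)]
  filter_upwards [this] with r hr hr0
  have hr0 : 0 < r := hr0
  obtain ⟨k, hk⟩ := exists_nat_ge (max r (1 / r))
  refine hr k ⟨?_, by linarith [le_max_left r (1 / r)]⟩
  rw [div_le_comm₀ (by positivity) hr0]
  linarith [le_max_right r (1 / r)]

lemma LocallyAC.ae_hasDerivAt {f : ℝ → ℝ} (hf : LocallyAC f) :
    ∀ᵐ r ∂volume.restrict (Ioi (0 : ℝ)), HasDerivAt f (deriv f r) r := by
  refine ae_Ioi_of_forall_Icc fun a b ha hab => ?_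
  filter_upwards [(hf a b ha hab).ae_differentiableAt] with r hr hr'
  rw [uIcc_of_le hab] at hr
  exact (hr hr').hasDerivAt

/-- If the almost everywhere derivative of a locally absolutely continuous function is continuous
on `(0, ∞)`, then it is a derivative everywhere there. -/
lemma LocallyAC.hasDerivAt_of_continuousOn {f g : ℝ → ℝ} (hf : LocallyAC f)
    (hg : ContinuousOn g (Ioi 0))
    (h : ∀ᵐ r ∂volume.restrict (Ioi (0 : ℝ)), HasDerivAt f (g r) r) {r : ℝ} (hr : 0 < r) :
    HasDerivAt f (g r) r := by
  have hint : ∀ x, 0 < x → f x = f r + ∫ s in r..x, g s := by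
    intro x hx
    have hac : AbsolutelyContinuousOnInterval f r x := by
      rcases le_total r x with h | h
      · exact hf r x hr h
      · exact (hf x r hx h).symm
    have := hac.integral_deriv_eq_sub
    rw [← sub_eq_iff_eq_add', ← this]
    refine intervalIntegral.integral_congr_ae ?_
    rw [ae_restrict_iff' measurableSet_Ioi] at h
    filter_upwards [h] with s hs hs'
    have hs0 : 0 < s := lt_of_lt_of_le (lt_min hr hx) (uIoc_subset_uIcc hs').1
    exact (hs hs0).deriv
  have hd : HasDerivAt (fun x => f r + ∫ s in r..x, g s) (g r) r := by
    refine HasDerivAt.const_add _ ?_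
    refine intervalIntegral.integral_hasDerivAt_right (by simp) ?_
      (hg.continuousAt (Ioi_mem_nhds hr))
    exact hg.stronglyMeasurableAtFilter isOpen_Ioi r hr
  refine hd.congr_of_eventuallyEq ?_
  filter_upwards [Ioi_mem_nhds hr] with x hx using hint x hx

lemma LocallyAC.hasDerivAt {f : ℝ → ℝ} (hf : LocallyAC f) (hg : ContinuousOn (deriv f) (Ioi 0))
    {r : ℝ} (hr : 0 < r) : HasDerivAt f (deriv f r) r :=
  hf.hasDerivAt_of_continuousOn hg hf.ae_hasDerivAt hr

lemma LocallyAC.enorm_sub_le {f : ℝ → ℝ} (hf : LocallyAC f) {a b : ℝ} (ha : 0 < a) (hab : a ≤ b) :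
    ‖f b - f a‖ₑ ≤ ∫⁻ s in Ioo a b, ‖deriv f s‖ₑ := by
  rw [← (hf a b ha hab).integral_deriv_eq_sub, intervalIntegral.integral_of_le hab,
    integral_Ioc_eq_integral_Ioo]
  exact enorm_integral_le_lintegral_enorm _

lemma LocallyAC.enorm_le_tailInt {f : ℝ → ℝ} (hf : LocallyAC f) (h : Tendsto f atTop (𝓝 0))
    {r : ℝ} (hr : 0 < r) : ‖f r‖ₑ ≤ tailInt (fun s => ‖deriv f s‖ₑ) r := by
  have ht : Tendsto (fun R => ‖f R - f r‖ₑ) atTop (𝓝 ‖0 - f r‖ₑ) :=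
    (continuous_enorm.tendsto _).comp (h.sub_const _)
  rw [zero_sub, enorm_neg] at ht
  refine le_of_tendsto ht ?_
  filter_upwards [eventually_ge_atTop r] with R hR
  exact (hf.enorm_sub_le hr hR).trans (lintegral_mono_set Ioo_subset_Ioi_self)

lemma LocallyAC.enorm_le_avgInt {α : ℝ} {f : ℝ → ℝ} (hf : LocallyAC f)
    (h : Tendsto (fun r => r ^ α * f r) (𝓝[>] 0) (𝓝 0)) {r : ℝ} (hr : 0 < r) :
    ‖f r‖ₑ ≤ avgInt α (fun s => ‖deriv f s + α / s * f s‖ₑ) r := by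
  set g : ℝ → ℝ := fun r => r ^ α * f r with hg
  have hgac : LocallyAC g := (locallyAC_rpow α).mul hf
  have hderiv : ∀ᵐ s ∂volume.restrict (Ioi (0 : ℝ)),
      deriv g s = s ^ α * (deriv f s + α / s * f s) := by
    filter_upwards [hf.ae_hasDerivAt, self_mem_ae_restrict measurableSet_Ioi] with s hs hs0
    have hs0 : 0 < s := hs0
    have hd := (Real.hasDerivAt_rpow_const (p := α) (Or.inl hs0.ne')).fun_mul hs
    rw [show deriv g s = _ from hd.deriv, Real.rpow_sub_one hs0.ne']
    field_simp
    ring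
  have hgr : ‖g r‖ₑ ≤ ∫⁻ s in Ioo 0 r, ENNReal.ofReal (s ^ α) * ‖deriv f s + α / s * f s‖ₑ := by
    have ht : Tendsto (fun ε => ‖g r - g ε‖ₑ) (𝓝[>] 0) (𝓝 ‖g r - 0‖ₑ) :=
      (continuous_enorm.tendsto _).comp (h.const_sub _)
    rw [sub_zero] at ht
    refine le_of_tendsto ht ?_
    filter_upwards [Ioo_mem_nhdsGT hr] with ε hε
    calc _ ≤ ∫⁻ s in Ioo ε r, ‖deriv g s‖ₑ := hgac.enorm_sub_le hε.1 hε.2.le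
      _ ≤ ∫⁻ s in Ioo 0 r, ‖deriv g s‖ₑ := lintegral_mono_set (Ioo_subset_Ioo_left hε.1.le)
      _ = _ := by
        refine lintegral_congr_ae ?_
        filter_upwards [ae_restrict_of_ae_restrict_of_subset Ioo_subset_Ioi_self hderiv,
          self_mem_ae_restrict measurableSet_Ioo] with s hs hs0
        rw [hs, enorm_mul, Real.enorm_of_nonneg (Real.rpow_nonneg hs0.1.le _)]
  have : f r = r ^ (-α) * g r := by
    rw [hg, ← mul_assoc, ← Real.rpow_add hr]; simp
  rw [this, enorm_mul, Real.enorm_of_nonneg (Real.rpow_nonneg hr.le _), avgInt]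
  gcongr

/-- Regularity of `tailInt`. -/
lemma hasDerivAt_tailInt {f : ℝ → ℝ≥0∞} (hf : Measurable f)
    (hfin : ∀ r, 0 < r → tailInt f r ≠ ∞) :
    LocallyAC (fun r => (tailInt f r).toReal) ∧
      ∀ᵐ r ∂volume.restrict (Ioi (0 : ℝ)),
        HasDerivAt (fun r => (tailInt f r).toReal) (-(f r).toReal) r := by
  have hI : ∀ a, 0 < a → IntegrableOn (fun s => (f s).toReal) (Ioi a) := fun a ha =>
    integrable_toReal_of_lintegral_ne_top hf.aemeasurable (hfin a ha)
  have hII : ∀ a b, 0 < a → a ≤ b → IntervalIntegrable (fun s => (f s).toReal) volume a b :=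
    fun a b ha hab => (intervalIntegrable_iff_integrableOn_Ioc_of_le hab).2
      ((hI a ha).mono_set Ioc_subset_Ioi_self)
  have heq : ∀ a, 0 < a → ∀ r, 0 < r → a ≤ r → (tailInt f r).toReal =
      (tailInt f a).toReal + -∫ s in a..r, (f s).toReal := by
    intro a ha r hr har
    have h1 : tailInt f a = (∫⁻ s in Ioc a r, f s) + tailInt f r := by
      rw [tailInt, tailInt, ← Ioc_union_Ioi_eq_Ioi har,
        lintegral_union measurableSet_Ioi (Ioc_disjoint_Ioi le_rfl)]
    have h2 : (∫⁻ s in Ioc a r, f s) ≠ ∞ :=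
      ne_top_of_le_ne_top (hfin a ha) (lintegral_mono_set Ioc_subset_Ioi_self)
    rw [intervalIntegral.integral_of_le har, integral_toReal hf.aemeasurable
      (ae_lt_top hf h2), h1, ENNReal.toReal_add h2 (hfin r hr)]
    ring
  have hac : LocallyAC (fun r => (tailInt f r).toReal) := by
    intro a b ha hab
    have h1 := ((hII a b ha hab).absolutelyContinuousOnInterval_intervalIntegral
      (c := a) (by simp)).fun_neg
    have h2 : AbsolutelyContinuousOnInterval (fun _ => (tailInt f a).toReal) a b :=
      (contDiff_const.contDiffOn).absolutelyContinuousOnInterval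
    refine (h2.fun_add h1).congr_Icc fun x hx => ?_
    rw [uIcc_of_le hab] at hx
    exact (heq a ha x (ha.trans_le hx.1) hx.1).symm
  refine ⟨hac, ae_Ioi_of_forall_Icc fun a b ha hab => ?_⟩
  have h1 := (hII (a / 2) (b + 1) (by linarith) (by linarith)).ae_hasDerivAt_integral
  rw [uIcc_of_le (by linarith)] at h1
  filter_upwards [h1] with r hr hr'
  have h2 := hr ⟨by linarith [hr'.1], by linarith [hr'.2]⟩ (a / 2) ⟨le_rfl, by linarith⟩
  refine (h2.neg.const_add (tailInt f (a / 2)).toReal).congr_of_eventuallyEq ?_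
  filter_upwards [Ioi_mem_nhds (show a / 2 < r by linarith [hr'.1])] with x hx
  have hx : a / 2 < x := hx
  exact heq (a / 2) (by linarith) x (by linarith) hx.le

/-- Regularity of `avgInt`. -/
lemma hasDerivAt_avgInt {α : ℝ} {f : ℝ → ℝ≥0∞} (hf : Measurable f)
    (hfin : ∀ r, 0 < r → avgInt α f r ≠ ∞) :
    LocallyAC (fun r => (avgInt α f r).toReal) ∧
      ∀ᵐ r ∂volume.restrict (Ioi (0 : ℝ)), HasDerivAt (fun r => (avgInt α f r).toReal)
        ((f r).toReal - α / r * (avgInt α f r).toReal) r := by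
  set g : ℝ → ℝ≥0∞ := fun s => ENNReal.ofReal (s ^ α) * f s with hg
  have hgm : Measurable g := by fun_prop
  have hgfin : ∀ r, 0 < r → ∫⁻ s in Ioo 0 r, g s ≠ ∞ := by
    intro r hr h
    apply hfin r hr
    rw [avgInt, h, ENNReal.mul_top]
    simp [Real.rpow_pos_of_pos hr]
  have hgr : ∀ s, 0 < s → (g s).toReal = s ^ α * (f s).toReal := by
    intro s hs
    rw [hg, ENNReal.toReal_mul, ENNReal.toReal_ofReal (Real.rpow_nonneg hs.le _)]
  have hII : ∀ a b, 0 ≤ a → a ≤ b → IntervalIntegrable (fun s => (g s).toReal) volume a b := by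
    intro a b ha hab
    refine (intervalIntegrable_iff_integrableOn_Ioo_of_le hab).2 ?_
    rcases hab.eq_or_lt with rfl | hab
    · simp
    exact integrable_toReal_of_lintegral_ne_top hgm.aemeasurable (ne_top_of_le_ne_top
      (hgfin b (ha.trans_lt hab)) (lintegral_mono_set (Ioo_subset_Ioo_left ha)))
  have heq : ∀ r, 0 < r → (avgInt α f r).toReal = r ^ (-α) * ∫ s in (0 : ℝ)..r, (g s).toReal := by
    intro r hr
    rw [intervalIntegral.integral_of_le hr.le, integral_Ioc_eq_integral_Ioo,
      integral_toReal hgm.aemeasurable (ae_lt_top hgm (hgfin r hr)), avgInt, ENNReal.toReal_mul,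
      ENNReal.toReal_ofReal (Real.rpow_nonneg hr.le _)]
  constructor
  · have h1 : LocallyAC fun r => ∫ s in (0 : ℝ)..r, (g s).toReal := by
      intro a b ha hab
      refine ((hII 0 b le_rfl (ha.le.trans hab)).absolutelyContinuousOnInterval_intervalIntegral
        (c := 0) (by simp)).mono ?_
      rw [uIcc_of_le hab, uIcc_of_le (ha.le.trans hab)]
      exact Icc_subset_Icc_left ha.le
    exact ((locallyAC_rpow (-α)).mul h1).congr fun r hr => (heq r hr).symm
  · refine ae_Ioi_of_forall_Icc fun a b ha hab => ?_
    have h1 := (hII 0 (b + 1) le_rfl (by linarith)).ae_hasDerivAt_integral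
    rw [uIcc_of_le (by linarith)] at h1
    filter_upwards [h1] with r hr hr'
    have hr0 : 0 < r := ha.trans_le hr'.1
    have h2 := hr ⟨hr0.le, by linarith [hr'.2]⟩ 0 ⟨le_rfl, by linarith⟩
    have h3 := (Real.hasDerivAt_rpow_const (p := -α) (Or.inl hr0.ne')).mul h2
    have h4 := h3.congr_of_eventuallyEq
      (f₁ := fun r => (avgInt α f r).toReal)
      (by filter_upwards [Ioi_mem_nhds hr0] with x hx using heq x hx)
    refine h4.congr_deriv ?_
    rw [heq r hr0, hgr r hr0, Real.rpow_sub_one hr0.ne', ← mul_assoc, ← Real.rpow_add hr0]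
    simp only [neg_add_cancel, Real.rpow_zero]
    field_simp
    ring

/-! ### Weighted Sobolev classes -/

lemma eLpNorm_two_sq {μ : Measure ℝ} (u : ℝ → ℝ) :
    eLpNorm u 2 μ ^ 2 = ∫⁻ r, ‖u r‖ₑ ^ 2 ∂μ := by
  rw [eLpNorm_eq_lintegral_rpow_enorm_toReal (by norm_num) (by norm_num), ← ENNReal.rpow_two,
    ← ENNReal.rpow_mul]
  simp

lemma memLp_two_iff {μ : Measure ℝ} {u : ℝ → ℝ} (hu : AEStronglyMeasurable u μ) :
    MemLp u 2 μ ↔ ∫⁻ r, ‖u r‖ₑ ^ 2 ∂μ ≠ ∞ := by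
  rw [← eLpNorm_two_sq, ← lt_top_iff_ne_top, ENNReal.pow_lt_top_iff]
  simp [MemLp, hu]

/-- The functions of order `k` on `(0, ∞)`: `u, …, u^{(k-1)}` are locally absolutely continuous,
`r^{-(k-j)} u^{(j)} ∈ L^2_α` for `j ≤ k`, and `u^{(j)}` for `j < k` has the corresponding power
bound. For `2k < α + 1` this is the space `𝒟^{k,2}_∞(α)`; the definition by recursion is convenient
as it is visibly compatible with the derivative and the multiplication by powers of `r`. -/
def SobClass (α : ℝ) : ℕ → (ℝ → ℝ) → Prop
  | 0, u => MemLp u 2 (radialMeasure α)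
  | k + 1, u => LocallyAC u ∧
      MemLp (fun r => r ^ (-((k + 1 : ℕ) : ℝ)) * u r) 2 (radialMeasure α) ∧
      (∃ C : ℝ, ∀ r, 0 < r → |u r| ≤ C * r ^ (-((α + 1) / 2 - ((k + 1 : ℕ) : ℝ)))) ∧
      SobClass α k (deriv u)

lemma ae_radialMeasure_of_forall (α : ℝ) {p : ℝ → Prop} (h : ∀ r, 0 < r → p r) :
    ∀ᵐ r ∂radialMeasure α, p r :=
  (ae_radialMeasure_iff α).2 ((ae_restrict_iff' measurableSet_Ioi).2 (Eventually.of_forall h))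

lemma deriv_eq_of_eq_Ioi {u v : ℝ → ℝ} (h : ∀ r, 0 < r → u r = v r) {r : ℝ} (hr : 0 < r) :
    deriv u r = deriv v r := by
  refine Filter.EventuallyEq.deriv_eq ?_
  filter_upwards [Ioi_mem_nhds hr] with x hx using h x hx

lemma SobClass.congr {α : ℝ} {k : ℕ} {u v : ℝ → ℝ} (hu : SobClass α k u)
    (h : ∀ r, 0 < r → u r = v r) : SobClass α k v := by
  induction k generalizing u v with
  | zero => exact MemLp.ae_eq (ae_radialMeasure_of_forall α h) hu
  | succ k ih =>
    obtain ⟨h1, h2, ⟨C, hC⟩, h4⟩ := hu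
    refine ⟨h1.congr h, MemLp.ae_eq (ae_radialMeasure_of_forall α fun r hr => ?_) h2,
      ⟨C, fun r hr => ?_⟩, ih h4 fun r hr => deriv_eq_of_eq_Ioi h hr⟩
    · rw [h r hr]
    · rw [← h r hr]; exact hC r hr

lemma SobClass.memLp {α : ℝ} {k : ℕ} {u : ℝ → ℝ} (hu : SobClass α k u) :
    MemLp (fun r => r ^ (-(k : ℝ)) * u r) 2 (radialMeasure α) := by
  cases k with
  | zero =>
    have : MemLp u 2 (radialMeasure α) := hu
    simpa using this
  | succ k => exact hu.2.1

/-- An almost everywhere derivative of class `k` is the derivative, up to null sets if `k = 0`. -/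
lemma SobClass.deriv_of_ae {α : ℝ} {k : ℕ} {u g : ℝ → ℝ} (hu : LocallyAC u) (hg : SobClass α k g)
    (h : ∀ᵐ r ∂volume.restrict (Ioi (0 : ℝ)), HasDerivAt u (g r) r) :
    SobClass α k (deriv u) := by
  cases k with
  | zero =>
    refine MemLp.ae_eq ((ae_radialMeasure_iff α).2 ?_) hg
    filter_upwards [h] with r hr using hr.deriv.symm
  | succ k =>
    exact hg.congr fun r hr => (hu.hasDerivAt_of_continuousOn hg.1.continuousOn h hr).deriv.symm

lemma SobClass.add {α : ℝ} {k : ℕ} {u v : ℝ → ℝ} (hu : SobClass α k u) (hv : SobClass α k v) :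
    SobClass α k fun r => u r + v r := by
  induction k generalizing u v with
  | zero => exact MemLp.add hu hv
  | succ k ih =>
    obtain ⟨h1, h2, ⟨C, hC⟩, h4⟩ := hu
    obtain ⟨h1', h2', ⟨C', hC'⟩, h4'⟩ := hv
    refine ⟨h1.add h1', ?_, ⟨C + C', fun r hr => ?_⟩,
      SobClass.deriv_of_ae (h1.add h1') (ih h4 h4') ?_⟩
    · convert h2.add h2' using 2 with r
      simp only [Pi.add_apply, mul_add]
    · rw [add_mul]
      exact (abs_add_le _ _).trans (add_le_add (hC r hr) (hC' r hr))
    · filter_upwards [h1.ae_hasDerivAt, h1'.ae_hasDerivAt] with r hr hr' using hr.fun_add hr'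

lemma SobClass.const_mul {α : ℝ} {k : ℕ} {u : ℝ → ℝ} (hu : SobClass α k u) (c : ℝ) :
    SobClass α k fun r => c * u r := by
  induction k generalizing u with
  | zero => exact MemLp.const_mul hu c
  | succ k ih =>
    obtain ⟨h1, h2, ⟨C, hC⟩, h4⟩ := hu
    refine ⟨h1.const_mul c, ?_, ⟨|c| * C, fun r hr => ?_⟩,
      SobClass.deriv_of_ae (h1.const_mul c) (ih h4) ?_⟩
    · convert h2.const_mul c using 2 with r
      ring
    · rw [abs_mul, mul_assoc]
      exact mul_le_mul_of_nonneg_left (hC r hr) (abs_nonneg c)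
    · filter_upwards [h1.ae_hasDerivAt] with r hr using hr.const_mul c

lemma SobClass.sub {α : ℝ} {k : ℕ} {u v : ℝ → ℝ} (hu : SobClass α k u) (hv : SobClass α k v) :
    SobClass α k fun r => u r - v r :=
  (hu.add (hv.const_mul (-1))).congr fun r _ => by ring

lemma SobClass.rpow_mul {α : ℝ} {k i : ℕ} {u : ℝ → ℝ} (hu : SobClass α (k + i) u) :
    SobClass α k fun r => r ^ (-(i : ℝ)) * u r := by
  induction k generalizing i u with
  | zero =>
    rw [zero_add] at hu
    exact hu.memLp
  | succ k ih =>
    have hu' := hu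
    rw [show k + 1 + i = (k + i) + 1 by ring] at hu
    obtain ⟨h1, h2, ⟨C, hC⟩, h4⟩ := hu
    have hac := (locallyAC_rpow (-(i : ℝ))).mul h1
    refine ⟨hac, MemLp.ae_eq (ae_radialMeasure_of_forall α fun r hr => ?_) h2,
      ⟨C, fun r hr => ?_⟩, ?_⟩
    · simp only
      rw [← mul_assoc, ← Real.rpow_add hr]
      push_cast
      ring_nf
    · rw [abs_mul, abs_of_pos (Real.rpow_pos_of_pos hr _)]
      calc _ ≤ r ^ (-(i : ℝ)) * (C * r ^ (-((α + 1) / 2 - ((k + i + 1 : ℕ) : ℝ)))) := by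
            gcongr; exact hC r hr
        _ = _ := by
          rw [mul_left_comm, ← Real.rpow_add hr]
          push_cast
          ring_nf
    · have h5 : SobClass α k fun r => r ^ (-((i + 1 : ℕ) : ℝ)) * u r :=
        ih (by rwa [show k + (i + 1) = k + 1 + i by ring])
      refine SobClass.deriv_of_ae hac ((ih h4).sub (h5.const_mul i)) ?_
      filter_upwards [h1.ae_hasDerivAt, self_mem_ae_restrict measurableSet_Ioi] with r hr hr0
      have hr0 : 0 < r := hr0
      refine ((Real.hasDerivAt_rpow_const (p := -(i : ℝ)) (Or.inl hr0.ne')).fun_mul hr).congr_deriv ?_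
      rw [show -((i + 1 : ℕ) : ℝ) = -(i : ℝ) - 1 by push_cast; ring]
      ring

lemma lintegral_weight_eq (α : ℝ) (k : ℕ) (u : ℝ → ℝ) :
    ∫⁻ r in Ioi (0 : ℝ), ENNReal.ofReal (r ^ (α - 2 * k)) * ‖u r‖ₑ ^ 2 =
      ∫⁻ r, ‖r ^ (-(k : ℝ)) * u r‖ₑ ^ 2 ∂radialMeasure α := by
  rw [lintegral_radialMeasure]
  refine setLIntegral_congr_fun measurableSet_Ioi fun r hr => ?_
  have hr : 0 < r := hr
  rw [enorm_mul, Real.enorm_of_nonneg (Real.rpow_nonneg hr.le (-(k : ℝ))), mul_pow,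
    sq (ENNReal.ofReal (r ^ (-(k : ℝ)))),
    ofReal_rpow_mul_ofReal_rpow hr, ← mul_assoc, ofReal_rpow_mul_ofReal_rpow hr]
  ring_nf

lemma tailInt_sq_le {β : ℝ} (hβ : 1 < β) {f : ℝ → ℝ≥0∞} (hf : Measurable f) {r : ℝ} (hr : 0 < r) :
    tailInt f r ^ 2 ≤ ENNReal.ofReal (r ^ (1 - β) / (β - 1)) *
      ∫⁻ s in Ioi (0 : ℝ), ENNReal.ofReal (s ^ β) * f s ^ 2 := by
  have := sq_lintegral_mul_le (μ := volume.restrict (Ioi r))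
    (f := fun s => ENNReal.ofReal (s ^ (-β / 2)))
    (g := fun s => ENNReal.ofReal (s ^ (β / 2)) * f s) (by fun_prop) (by fun_prop)
  refine le_trans (le_of_eq ?_) (this.trans (mul_le_mul' (le_of_eq ?_) ?_))
  · congr 1
    refine setLIntegral_congr_fun measurableSet_Ioi fun s hs => ?_
    have hs : 0 < s := hr.trans hs
    rw [← mul_assoc, ofReal_rpow_mul_ofReal_rpow hs, show -β / 2 + β / 2 = 0 by ring]
    simp
  · rw [show ENNReal.ofReal (r ^ (1 - β) / (β - 1)) =
      ENNReal.ofReal (r ^ (-β + 1) / (-(-β + 1))) by ring_nf, ← lintegral_Ioi_rpow (by linarith) hr]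
    refine setLIntegral_congr_fun measurableSet_Ioi fun s hs => ?_
    have hs : 0 < s := hr.trans hs
    rw [sq, ofReal_rpow_mul_ofReal_rpow hs]
    ring_nf
  · refine le_trans (le_of_eq ?_) (lintegral_mono_set (Ioi_subset_Ioi hr.le))
    refine setLIntegral_congr_fun measurableSet_Ioi fun s hs => ?_
    have hs : 0 < s := hr.trans hs
    rw [mul_pow, sq (ENNReal.ofReal _), ofReal_rpow_mul_ofReal_rpow hs]
    ring_nf

/-- Integration raises the order: this is Hardy's inequality. -/
lemma SobClass.of_deriv {α : ℝ} {k : ℕ} (hk : 2 * ((k + 1 : ℕ) : ℝ) < α + 1) {u : ℝ → ℝ}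
    (hu : LocallyAC u) (h0 : Tendsto u atTop (𝓝 0)) (h : SobClass α k (deriv u)) :
    SobClass α (k + 1) u := by
  have hβ : 1 < α - 2 * k := by push_cast at hk; linarith
  have hm : Measurable fun s => ‖deriv u s‖ₑ := (measurable_deriv u).enorm
  set E := ∫⁻ r in Ioi (0 : ℝ), ENNReal.ofReal (r ^ (α - 2 * k)) * ‖deriv u r‖ₑ ^ 2 with hE
  have hEfin : E ≠ ∞ := by
    rw [hE, lintegral_weight_eq]
    exact (memLp_two_iff h.memLp.1).1 h.memLp
  refine ⟨hu, ?_, ?_, h⟩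
  · obtain ⟨C, hC, hC'⟩ := exists_hardy_tailInt hβ
    have hmeas : AEStronglyMeasurable (fun r => r ^ (-((k + 1 : ℕ) : ℝ)) * u r)
        (radialMeasure α) := by
      have h1 : ContinuousOn (fun r => r ^ (-((k + 1 : ℕ) : ℝ)) * u r) (Ioi 0) :=
        ((locallyAC_rpow _).mul hu).continuousOn
      exact (h1.aestronglyMeasurable (μ := volume) measurableSet_Ioi).mono_ac
        (withDensity_absolutelyContinuous _ _)
    rw [memLp_two_iff hmeas, ← lintegral_weight_eq]
    refine ne_top_of_le_ne_top (ENNReal.mul_ne_top hC hEfin) (le_trans ?_ (hC' _ hm))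
    refine setLIntegral_mono' measurableSet_Ioi fun r hr => ?_
    rw [show α - 2 * ((k + 1 : ℕ) : ℝ) = α - 2 * k - 2 by push_cast; ring]
    gcongr
    exact hu.enorm_le_tailInt h0 hr
  · refine ⟨Real.sqrt (E.toReal / (α - 2 * k - 1)), fun r hr => ?_⟩
    have h1 := (pow_le_pow_left' (hu.enorm_le_tailInt h0 hr) 2).trans (tailInt_sq_le hβ hm hr)
    rw [← hE, ← ENNReal.ofReal_toReal hEfin, ← ENNReal.ofReal_mul
      (div_nonneg (by positivity) (by linarith)), ← ofReal_norm, ← ENNReal.ofReal_pow (by simp),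
      ENNReal.ofReal_le_ofReal_iff (mul_nonneg (div_nonneg (by positivity) (by linarith))
      ENNReal.toReal_nonneg)] at h1
    have h2 : Real.sqrt (E.toReal / (α - 2 * k - 1)) *
        r ^ (-((α + 1) / 2 - ((k + 1 : ℕ) : ℝ))) =
        Real.sqrt (r ^ (1 - (α - 2 * k)) / (α - 2 * k - 1) * E.toReal) := by
      rw [show r ^ (1 - (α - 2 * k)) / (α - 2 * k - 1) * E.toReal =
        E.toReal / (α - 2 * k - 1) * (r ^ (-((α + 1) / 2 - ((k + 1 : ℕ) : ℝ)))) ^ 2 by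
          rw [← Real.rpow_natCast (r ^ _), ← Real.rpow_mul hr.le]; push_cast; ring_nf,
        Real.sqrt_mul (div_nonneg ENNReal.toReal_nonneg (by linarith)),
        Real.sqrt_sq (by positivity)]
    rw [h2]
    exact Real.abs_le_sqrt (by simpa using h1)

lemma SobClass.hasDerivAt {α : ℝ} {k : ℕ} {u : ℝ → ℝ} (hu : SobClass α (k + 2) u) {r : ℝ}
    (hr : 0 < r) : HasDerivAt u (deriv u r) r :=
  hu.1.hasDerivAt hu.2.2.2.1.continuousOn hr

lemma SobClass.contDiffOn {α : ℝ} {k : ℕ} {u : ℝ → ℝ} (hu : SobClass α (k + 1) u) :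
    ContDiffOn ℝ (k : WithTop ℕ∞) u (Ioi 0) := by
  induction k generalizing u with
  | zero => simpa using hu.1.continuousOn
  | succ k ih =>
    push_cast
    rw [contDiffOn_succ_iff_deriv_of_isOpen isOpen_Ioi]
    exact ⟨fun r hr => (hu.hasDerivAt hr).differentiableAt.differentiableWithinAt, by simp,
      ih hu.2.2.2⟩

lemma SobClass.iteratedDeriv {α : ℝ} {k j : ℕ} {u : ℝ → ℝ} (hu : SobClass α (k + j) u) :
    SobClass α k (iteratedDeriv j u) := by
  induction j generalizing u with
  | zero => simpa using hu
  | succ j ih =>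
    rw [iteratedDeriv_succ']
    exact ih hu.2.2.2

lemma SobClass.tendsto {α : ℝ} {k : ℕ} (hk : 2 * ((k + 1 : ℕ) : ℝ) < α + 1) {u : ℝ → ℝ}
    (hu : SobClass α (k + 1) u) : Tendsto u atTop (𝓝 0) := by
  obtain ⟨C, hC⟩ := hu.2.2.1
  refine squeeze_zero_norm' (a := fun r => C * r ^ (-((α + 1) / 2 - ((k + 1 : ℕ) : ℝ)))) ?_ ?_
  · filter_upwards [eventually_gt_atTop 0] with r hr using hC r hr
  · simpa using (tendsto_rpow_neg_atTop (y := (α + 1) / 2 - ((k + 1 : ℕ) : ℝ))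
      (by linarith)).const_mul C

lemma SobClass.mem_preD {α : ℝ} {m : ℕ} (hm : 1 ≤ m) (hα : 0 < α - 2 * m + 1) {u : ℝ → ℝ}
    (hu : SobClass α m u) : u ∈ preD m α := by
  obtain ⟨k, rfl⟩ : ∃ k, m = k + 1 := ⟨m - 1, by omega⟩
  refine ⟨hu.contDiffOn, (SobClass.iteratedDeriv (k := 1) (by rwa [add_comm])).1,
    fun j hj => ?_, SobClass.iteratedDeriv (k := 0) (by rwa [zero_add])⟩
  simp only [Nat.add_sub_cancel] at hj
  have h := SobClass.iteratedDeriv (k := k - j + 1) (j := j) (u := u) (α := α)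
    (by rwa [show k - j + 1 + j = k + 1 by omega])
  refine h.tendsto ?_
  have : ((k - j + 1 : ℕ) : ℝ) ≤ ((k + 1 : ℕ) : ℝ) := by exact_mod_cast by omega
  linarith

lemma sobClass_of_mem_preD {α : ℝ} {m : ℕ} (hm : 1 ≤ m) (hα : 0 < α - 2 * m + 1) {u : ℝ → ℝ}
    (hu : u ∈ preD m α) : SobClass α m u := by
  obtain ⟨h1, h2, h3, h4⟩ := hu
  have key : ∀ k ≤ m, SobClass α k (iteratedDeriv (m - k) u) := by
    intro k
    induction k with
    | zero => exact fun _ => h4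
    | succ k ih =>
      intro hk
      have hlt : 2 * ((k + 1 : ℕ) : ℝ) < α + 1 := by
        have : ((k + 1 : ℕ) : ℝ) ≤ m := by exact_mod_cast hk
        linarith
      refine SobClass.of_deriv hlt ?_ (h3 _ (by omega)) ?_
      · rcases Nat.eq_zero_or_pos k with rfl | hk0
        · exact h2
        · refine ContDiffOn.locallyAC ?_
          have h5 : ContDiffOn ℝ 1 (iteratedDerivWithin (m - (k + 1)) u (Ioi 0)) (Ioi 0) :=
            ((contDiffOn_nat_succ_iff_contDiffOn_one_iteratedDerivWithin
              (uniqueDiffOn_Ioi (0 : ℝ)) (n := m - (k + 1))).1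
              (h1.of_le (by exact_mod_cast (by omega : m - (k + 1) + 1 ≤ m - 1)))).2
          exact h5.congr fun r hr => (iteratedDerivWithin_of_isOpen isOpen_Ioi hr).symm
      · rw [← iteratedDeriv_succ, show m - (k + 1) + 1 = m - k by omega]
        exact ih (by omega)
  simpa using key m le_rfl

lemma mem_spaceD_of_mem_preD {α : ℝ} {m : ℕ} {u : ℝ → ℝ} (hu : u ∈ preD m α) :
    u ∈ spaceD m α := by
  refine ⟨fun _ => u, fun _ => hu, fun ε hε => ⟨0, fun i _ j _ => ?_⟩,
    fun r _ => tendsto_const_nhds⟩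
  have : preDNorm m α (fun r => u r - u r) = 0 := by
    have h0 : iteratedDeriv m (fun _ : ℝ => (0 : ℝ)) = 0 := by
      funext x; simp
    simp only [sub_self, preDNorm, h0, eLpNorm_zero]
  rw [this]
  exact hε

/-! ### Regularity of iterated integrals and iterated radial gradients -/

section
variable {α : ℝ} {F : ℝ → ℝ≥0∞}

lemma wordInv_ne_top (b : Bool) (w : List Bool) (hw : 2 * ((b :: w).length : ℝ) < α + 1)
    (hF : Measurable F) (hE : ∫⁻ r, F r ^ 2 ∂radialMeasure α ≠ ∞) {r : ℝ} (hr : 0 < r) :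
    wordInv α (b :: w) F r ≠ ∞ := by
  obtain ⟨C, hC, h⟩ := exists_pointwise_wordInv b w hw
  have := ne_top_of_le_ne_top (ENNReal.mul_ne_top (ENNReal.mul_ne_top hC (by simp)) hE)
    (h F hF r hr)
  exact fun h' => this (by simp [h'])

lemma memLp_rpow_mul_wordInv (w : List Bool) (hw : 2 * (w.length : ℝ) < α + 1)
    (hF : Measurable F) (hE : ∫⁻ r, F r ^ 2 ∂radialMeasure α ≠ ∞) :
    MemLp (fun r => r ^ (-(w.length : ℝ)) * (wordInv α w F r).toReal) 2 (radialMeasure α) := by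
  obtain ⟨C, hC, h⟩ := exists_hardy_wordInv w hw
  have hm := measurable_wordInv α w hF
  rw [memLp_two_iff (by fun_prop), ← lintegral_weight_eq]
  refine ne_top_of_le_ne_top (ENNReal.mul_ne_top hC hE) (le_trans ?_ (h F hF))
  refine lintegral_mono fun r => ?_
  gcongr
  rw [Real.enorm_of_nonneg ENNReal.toReal_nonneg]
  exact ENNReal.ofReal_toReal_le

lemma abs_wordInv_le (b : Bool) (w : List Bool) (hw : 2 * ((b :: w).length : ℝ) < α + 1)
    (hF : Measurable F) (hE : ∫⁻ r, F r ^ 2 ∂radialMeasure α ≠ ∞) :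
    ∃ C : ℝ, ∀ r, 0 < r → (wordInv α (b :: w) F r).toReal ≤
      C * r ^ (-((α + 1) / 2 - ((b :: w).length : ℝ))) := by
  obtain ⟨C, hC, h⟩ := exists_pointwise_wordInv b w hw
  refine ⟨Real.sqrt (C.toReal * (∫⁻ r, F r ^ 2 ∂radialMeasure α).toReal), fun r hr => ?_⟩
  have h1 := ENNReal.toReal_mono
    (ENNReal.mul_ne_top (ENNReal.mul_ne_top hC (by simp)) hE) (h F hF r hr)
  rw [ENNReal.toReal_mul, ENNReal.toReal_mul, ENNReal.toReal_pow, ENNReal.toReal_ofReal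
    (by positivity)] at h1
  have h2 := Real.abs_le_sqrt h1
  rw [abs_of_nonneg ENNReal.toReal_nonneg] at h2
  refine h2.trans (le_of_eq ?_)
  set l := ((b :: w).length : ℝ)
  have h3 : r ^ (-(α + 1 - 2 * l)) = (r ^ (-((α + 1) / 2 - l))) ^ 2 := by
    rw [← Real.rpow_natCast, ← Real.rpow_mul hr.le]; push_cast; ring_nf
  rw [h3, mul_right_comm, Real.sqrt_mul (by positivity), Real.sqrt_sq (by positivity)]

lemma locallyAC_wordInv (b : Bool) (w : List Bool) (hw : 2 * ((b :: w).length : ℝ) < α + 1)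
    (hF : Measurable F) (hE : ∫⁻ r, F r ^ 2 ∂radialMeasure α ≠ ∞) :
    LocallyAC (fun r => (wordInv α (b :: w) F r).toReal) := by
  have hfin := fun r (hr : 0 < r) => wordInv_ne_top b w hw hF hE hr
  cases b
  · exact (hasDerivAt_avgInt (measurable_wordInv α w hF) hfin).1
  · exact (hasDerivAt_tailInt (measurable_wordInv α w hF) hfin).1

lemma sobClass_rpow_mul_wordInv (hF : Measurable F)
    (hE : ∫⁻ r, F r ^ 2 ∂radialMeasure α ≠ ∞) (k i : ℕ) (w : List Bool) (hlen : w.length = k + i)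
    (hw : 2 * (w.length : ℝ) < α + 1) :
    SobClass α k fun r => r ^ (-(i : ℝ)) * (wordInv α w F r).toReal := by
  induction k generalizing i w with
  | zero =>
    have := memLp_rpow_mul_wordInv w hw hF hE
    rwa [hlen, zero_add] at this
  | succ k ih =>
    obtain ⟨b, v, rfl⟩ : ∃ b v, w = b :: v := by
      cases w with
      | nil => simp at hlen; omega
      | cons b v => exact ⟨b, v, rfl⟩
    have hv : v.length = k + i := by simp only [List.length_cons] at hlen; omega
    have hv' : 2 * (v.length : ℝ) < α + 1 := by
      simp only [List.length_cons] at hw; push_cast at hw; linarith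
    have hac := locallyAC_wordInv b v hw hF hE
    have hac' := (locallyAC_rpow (-(i : ℝ))).mul hac
    have hl : ((b :: v).length : ℝ) = k + 1 + i := by rw [hlen]; push_cast; ring
    refine ⟨hac', ?_, ?_, ?_⟩
    · refine MemLp.ae_eq (ae_radialMeasure_of_forall α fun r hr => ?_)
        (memLp_rpow_mul_wordInv (b :: v) hw hF hE)
      simp only
      rw [← mul_assoc, ← Real.rpow_add hr, hl]
      push_cast
      ring_nf
    · obtain ⟨C, hC⟩ := abs_wordInv_le b v hw hF hE
      refine ⟨C, fun r hr => ?_⟩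
      rw [abs_of_nonneg (mul_nonneg (Real.rpow_nonneg hr.le _) ENNReal.toReal_nonneg)]
      calc _ ≤ r ^ (-(i : ℝ)) * (C * r ^ (-((α + 1) / 2 - ((b :: v).length : ℝ)))) := by
            gcongr; exact hC r hr
        _ = _ := by
          rw [mul_left_comm, ← Real.rpow_add hr, hl]
          push_cast
          ring_nf
    · have h1 := ih (i + 1) (b :: v) (by omega) hw
      have h2 := ih i v hv hv'
      have hfin := fun r (hr : 0 < r) => wordInv_ne_top b v hw hF hE hr
      have hpow : ∀ r : ℝ, 0 < r → r ^ (-((i + 1 : ℕ) : ℝ)) = r ^ (-(i : ℝ)) / r := fun r hr => by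
        rw [show -((i + 1 : ℕ) : ℝ) = -(i : ℝ) - 1 by push_cast; ring, Real.rpow_sub_one hr.ne']
      cases b
      · refine SobClass.deriv_of_ae hac' (h2.sub (h1.const_mul (i + α))) ?_
        filter_upwards [(hasDerivAt_avgInt (measurable_wordInv α v hF) hfin).2,
          self_mem_ae_restrict measurableSet_Ioi] with r hr hr0
        have hr0 : 0 < r := hr0
        refine ((Real.hasDerivAt_rpow_const (p := -(i : ℝ))
          (Or.inl hr0.ne')).fun_mul hr).congr_deriv ?_
        rw [hpow r hr0, Real.rpow_sub_one hr0.ne']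
        simp only [wordInv, halfInv]
        ring
      · refine SobClass.deriv_of_ae hac' ((h2.add (h1.const_mul i)).const_mul (-1)) ?_
        filter_upwards [(hasDerivAt_tailInt (measurable_wordInv α v hF) hfin).2,
          self_mem_ae_restrict measurableSet_Ioi] with r hr hr0
        have hr0 : 0 < r := hr0
        refine ((Real.hasDerivAt_rpow_const (p := -(i : ℝ))
          (Or.inl hr0.ne')).fun_mul hr).congr_deriv ?_
        rw [hpow r hr0, Real.rpow_sub_one hr0.ne']
        simp only [wordInv, halfInv]
        ring

lemma sobClass_wordInv (hF : Measurable F) (hE : ∫⁻ r, F r ^ 2 ∂radialMeasure α ≠ ∞)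
    (w : List Bool) (hw : 2 * (w.length : ℝ) < α + 1) :
    SobClass α w.length fun r => (wordInv α w F r).toReal :=
  (sobClass_rpow_mul_wordInv hF hE w.length 0 w rfl hw).congr fun r _ => by simp

end

lemma radialLaplacian_congr (α : ℝ) {u v : ℝ → ℝ} (h : ∀ r, 0 < r → u r = v r) {r : ℝ}
    (hr : 0 < r) : radialLaplacian α u r = radialLaplacian α v r := by
  have h1 := fun r (hr : 0 < r) => deriv_eq_of_eq_Ioi h hr
  rw [radialLaplacian, radialLaplacian, h1 r hr, deriv_eq_of_eq_Ioi h1 hr]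

lemma radialGrad_zero (α : ℝ) (u : ℝ → ℝ) : radialGrad 0 α u = u := by simp [radialGrad]

lemma radialGrad_one (α : ℝ) (u : ℝ → ℝ) : radialGrad 1 α u = deriv u := by simp [radialGrad]

lemma radialGrad_add_two (m : ℕ) (α : ℝ) (u : ℝ → ℝ) :
    radialGrad (m + 2) α u = radialGrad m α (radialLaplacian α u) := by
  have h1 : (m + 2) / 2 = m / 2 + 1 := by omega
  have h2 : Even (m + 2) ↔ Even m := by simp [Nat.even_add]
  simp only [radialGrad, h1, h2, Function.iterate_succ_apply]

lemma radialGrad_congr (m : ℕ) (α : ℝ) {u v : ℝ → ℝ} (h : ∀ r, 0 < r → u r = v r) {r : ℝ}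
    (hr : 0 < r) : radialGrad m α u r = radialGrad m α v r := by
  induction m using Nat.twoStepInduction generalizing u v with
  | zero => rw [radialGrad_zero, radialGrad_zero]; exact h r hr
  | one => rw [radialGrad_one, radialGrad_one]; exact deriv_eq_of_eq_Ioi h hr
  | more m ih _ =>
    rw [radialGrad_add_two, radialGrad_add_two]
    exact ih fun s hs => radialLaplacian_congr α h hs

lemma radialGrad_neg (m : ℕ) (α : ℝ) (u : ℝ → ℝ) :
    radialGrad m α (fun r => -u r) = fun r => -radialGrad m α u r := by
  induction m using Nat.twoStepInduction generalizing u with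
  | zero => simp [radialGrad_zero]
  | one => simp [radialGrad_one]
  | more m ih _ =>
    have : radialLaplacian α (fun r => -u r) = fun r => -radialLaplacian α u r := by
      funext r
      simp [radialLaplacian]
      ring
    rw [radialGrad_add_two, radialGrad_add_two, this, ih]

lemma SobClass.radialLaplacian {α : ℝ} {k : ℕ} {u : ℝ → ℝ} (hu : SobClass α (k + 2) u) :
    SobClass α k (radialLaplacian α u) := by
  have h1 : SobClass α (k + 1) (deriv u) := hu.2.2.2
  refine (SobClass.add h1.2.2.2 ((h1.rpow_mul (i := 1)).const_mul α)).congr fun r hr => ?_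
  rw [_root_.radialLaplacian]
  simp only [Nat.cast_one, Real.rpow_neg_one]
  ring

lemma SobClass.memLp_radialGrad {α : ℝ} {m : ℕ} {u : ℝ → ℝ} (hu : SobClass α m u) :
    MemLp (radialGrad m α u) 2 (radialMeasure α) := by
  induction m using Nat.twoStepInduction generalizing u with
  | zero => rw [radialGrad_zero]; exact hu
  | one => rw [radialGrad_one]; exact hu.2.2.2
  | more m ih _ => rw [radialGrad_add_two]; exact ih hu.radialLaplacian

lemma tendsto_rpow_mul_nhdsGT_zero {p p' C : ℝ} (hp : 0 < p + p') {f : ℝ → ℝ}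
    (hf : ∀ r, 0 < r → |f r| ≤ C * r ^ p') :
    Tendsto (fun r => r ^ p * f r) (𝓝[>] 0) (𝓝 0) := by
  refine squeeze_zero_norm' (a := fun r => C * r ^ (p + p')) ?_ ?_
  · filter_upwards [self_mem_nhdsWithin] with r hr
    have hr : 0 < r := hr
    rw [Real.norm_eq_abs, abs_mul, abs_of_pos (Real.rpow_pos_of_pos hr _), Real.rpow_add hr]
    calc _ ≤ r ^ p * (C * r ^ p') := by gcongr; exact hf r hr
      _ = _ := by ring
  · have h := ((Real.continuousAt_rpow_const 0 (p + p') (Or.inr hp.le)).tendsto.mono_left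
      (nhdsWithin_le_nhds (s := Ioi 0))).const_mul C
    rwa [Real.zero_rpow hp.ne', mul_zero] at h

/-- A function of order `m` is dominated by the positive solution with the same absolute value of
`∇_α^m`. -/
lemma SobClass.enorm_le_wordInv {α : ℝ} {m : ℕ} (hm : 2 * (m : ℝ) < α + 1) {u : ℝ → ℝ}
    (hu : SobClass α m u) {r : ℝ} (hr : 0 < r) :
    ‖u r‖ₑ ≤ wordInv α (altWord true m) (fun s => ‖radialGrad m α u s‖ₑ) r := by
  induction m using Nat.twoStepInduction generalizing u r with
  | zero => simp [radialGrad_zero, altWord, wordInv]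
  | one =>
    rw [radialGrad_one]
    exact hu.1.enorm_le_tailInt (hu.tendsto hm) hr
  | more m ih _ =>
    push_cast at hm
    have h1 : SobClass α (m + 1) (deriv u) := hu.2.2.2
    refine (hu.1.enorm_le_tailInt (hu.tendsto (by push_cast; linarith)) hr).trans ?_
    refine halfInv_mono α true (fun s hs => ?_) hr.le
    obtain ⟨C, hC⟩ := h1.2.2.1
    refine (h1.1.enorm_le_avgInt (α := α) (tendsto_rpow_mul_nhdsGT_zero ?_ hC) hs).trans ?_
    · push_cast
      have : (0 : ℝ) ≤ m := by positivity
      linarith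
    · refine halfInv_mono α false (fun t ht => ?_) hs.le
      rw [radialGrad_add_two]
      exact ih (by linarith) hu.radialLaplacian ht

/-- The alternating word is a right inverse of `∇_α^m`, up to sign. -/
lemma abs_radialGrad_wordInv {α : ℝ} {m : ℕ} (hm : 2 * (m : ℝ) < α + 1) {F : ℝ → ℝ≥0∞}
    (hF : Measurable F) (hE : ∫⁻ r, F r ^ 2 ∂radialMeasure α ≠ ∞) :
    ∀ᵐ r ∂radialMeasure α,
      |radialGrad m α (fun r => (wordInv α (altWord true m) F r).toReal) r| = (F r).toReal := by
  induction m using Nat.twoStepInduction with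
  | zero =>
    refine Eventually.of_forall fun r => ?_
    rw [radialGrad_zero]
    simp [altWord, wordInv]
  | one =>
    rw [radialGrad_one, ae_radialMeasure_iff]
    have := (hasDerivAt_tailInt hF fun r hr => wordInv_ne_top true [] (by simpa using hm) hF hE hr).2
    filter_upwards [this] with r hr
    have hd : deriv (fun r => (wordInv α (altWord true 1) F r).toReal) r = -(F r).toReal := hr.deriv
    rw [hd, abs_neg, abs_of_nonneg ENNReal.toReal_nonneg]
  | more m ih _ =>
    push_cast at hm
    rw [radialGrad_add_two]
    set v := altWord true m with hv
    have hlen : v.length = m := length_altWord _ _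
    have hword : altWord true (m + 2) = true :: false :: v := rfl
    rw [hword]
    have hl1 : 2 * ((false :: v).length : ℝ) < α + 1 := by simp [hlen]; linarith
    have hl2 : 2 * ((true :: false :: v).length : ℝ) < α + 1 := by
      simp [hlen]; linarith
    have d1 := (hasDerivAt_avgInt (measurable_wordInv α v hF)
      fun r hr => wordInv_ne_top false v hl1 hF hE hr)
    have d2 := (hasDerivAt_tailInt (measurable_wordInv α (false :: v) hF)
      fun r hr => wordInv_ne_top true (false :: v) hl2 hF hE hr)
    have e2 : ∀ r, 0 < r → deriv (fun r => (wordInv α (true :: false :: v) F r).toReal) r =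
        -(wordInv α (false :: v) F r).toReal := fun r hr =>
      (d2.1.hasDerivAt_of_continuousOn d1.1.continuousOn.neg d2.2 hr).deriv
    have e3 : ∀ r, 0 < r → ∀ c, HasDerivAt (fun r => (wordInv α (false :: v) F r).toReal) c r →
        radialLaplacian α (fun r => (wordInv α (true :: false :: v) F r).toReal) r =
        -c - α / r * (wordInv α (false :: v) F r).toReal := by
      intro r hr c hc
      rw [radialLaplacian, e2 r hr, deriv_eq_of_eq_Ioi e2 hr, show deriv _ r = _ from hc.fun_neg.deriv]
      ring
    rcases Nat.eq_zero_or_pos m with rfl | hm0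
    · rw [ae_radialMeasure_iff]
      filter_upwards [d1.2, self_mem_ae_restrict measurableSet_Ioi] with r hr hr0
      rw [radialGrad_zero, e3 r hr0 _ hr]
      simp only [wordInv, halfInv, hv, altWord]
      rw [show ∀ a b : ℝ, -(a - b) - b = -a by intros; ring, abs_neg,
        abs_of_nonneg ENNReal.toReal_nonneg]
    · obtain ⟨c, v', hcv⟩ : ∃ c v', v = c :: v' := by
        cases hvv : v with
        | nil => rw [hvv] at hlen; simp at hlen; omega
        | cons c v' => exact ⟨c, v', rfl⟩
      have hcont : ContinuousOn (fun r => (wordInv α v F r).toReal) (Ioi 0) := by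
        rw [hcv]
        refine (locallyAC_wordInv c v' ?_ hF hE).continuousOn
        rw [← hcv, hlen]; linarith
      have e4 : ∀ r, 0 < r →
          radialLaplacian α (fun r => (wordInv α (true :: false :: v) F r).toReal) r =
          -(wordInv α v F r).toReal := by
        intro r hr
        have hc : ContinuousOn (fun r => (wordInv α v F r).toReal -
            α / r * (avgInt α (wordInv α v F) r).toReal) (Ioi 0) :=
          hcont.sub ((continuousOn_const.div continuousOn_id fun r hr => ne_of_gt hr).mul
            d1.1.continuousOn)
        rw [e3 r hr _ (d1.1.hasDerivAt_of_continuousOn hc d1.2 hr)]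
        simp only [wordInv, halfInv]
        ring
      filter_upwards [ih (by linarith), (ae_radialMeasure_iff α).2
        (self_mem_ae_restrict measurableSet_Ioi)] with r hr hr0
      rw [radialGrad_congr m α e4 hr0, radialGrad_neg, abs_neg, hr]

/-! ### The completion consists of Sobolev functions -/

lemma iteratedDeriv_congr_Ioi (m : ℕ) {u v : ℝ → ℝ} (h : ∀ r, 0 < r → u r = v r) {r : ℝ}
    (hr : 0 < r) : iteratedDeriv m u r = iteratedDeriv m v r := by
  induction m generalizing u v with
  | zero => simpa using h r hr
  | succ m ih =>
    rw [iteratedDeriv_succ', iteratedDeriv_succ']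
    exact ih fun s hs => deriv_eq_of_eq_Ioi h hs

lemma iteratedDeriv_fun_sub_ae {α : ℝ} {m : ℕ} {u v : ℝ → ℝ} (hu : SobClass α m u)
    (hv : SobClass α m v) : ∀ᵐ r ∂radialMeasure α,
      iteratedDeriv m (fun r => u r - v r) r = iteratedDeriv m u r - iteratedDeriv m v r := by
  induction m generalizing u v with
  | zero => simp
  | succ m ih =>
    simp only [iteratedDeriv_succ']
    cases m with
    | zero =>
      simp only [iteratedDeriv_zero, ae_radialMeasure_iff]
      filter_upwards [hu.1.ae_hasDerivAt, hv.1.ae_hasDerivAt] with r hr hr'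
      exact (hr.fun_sub hr').deriv
    | succ m =>
      have h1 : ∀ r, 0 < r → deriv (fun r => u r - v r) r = deriv u r - deriv v r := fun r hr =>
        ((hu.hasDerivAt hr).fun_sub (hv.hasDerivAt hr)).deriv
      filter_upwards [ih hu.2.2.2 hv.2.2.2, (ae_radialMeasure_iff α).2
        (self_mem_ae_restrict measurableSet_Ioi)] with r hr hr0
      rw [iteratedDeriv_congr_Ioi _ h1 hr0, hr]

lemma iteratedDeriv_wordInv_replicate {α : ℝ} {m : ℕ} (hm : 2 * (m : ℝ) < α + 1) {F : ℝ → ℝ≥0∞}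
    (hF : Measurable F) (hE : ∫⁻ r, F r ^ 2 ∂radialMeasure α ≠ ∞) :
    ∀ᵐ r ∂radialMeasure α,
      iteratedDeriv m (fun r => (wordInv α (List.replicate m true) F r).toReal) r =
        (-1) ^ m * (F r).toReal := by
  induction m with
  | zero => simp [wordInv]
  | succ m ih =>
    push_cast at hm
    rw [iteratedDeriv_succ', List.replicate_succ]
    set v := List.replicate m true with hv
    have hl : 2 * ((true :: v).length : ℝ) < α + 1 := by simp [hv]; linarith
    have d := hasDerivAt_tailInt (measurable_wordInv α v hF)
      fun r hr => wordInv_ne_top true v hl hF hE hr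
    rcases Nat.eq_zero_or_pos m with rfl | hm0
    · rw [ae_radialMeasure_iff]
      filter_upwards [d.2] with r hr
      rw [iteratedDeriv_zero]
      refine Eq.trans (b := -(F r).toReal) hr.deriv (by simp)
    · have hcont : ContinuousOn (fun r => (wordInv α v F r).toReal) (Ioi 0) := by
        obtain ⟨k, rfl⟩ : ∃ k, m = k + 1 := ⟨m - 1, by omega⟩
        rw [hv, List.replicate_succ]
        refine (locallyAC_wordInv true _ ?_ hF hE).continuousOn
        simp; push_cast at hm; linarith
      have e : ∀ r, 0 < r → deriv (fun r => (wordInv α (true :: v) F r).toReal) r =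
          (-1) * (wordInv α v F r).toReal := fun r hr =>
        (d.1.hasDerivAt_of_continuousOn hcont.neg d.2 hr).deriv.trans (by simp)
      filter_upwards [ih (by linarith), (ae_radialMeasure_iff α).2
        (self_mem_ae_restrict measurableSet_Ioi)] with r hr hr0
      rw [iteratedDeriv_congr_Ioi m e hr0, iteratedDeriv_const_mul_field, hr]
      ring

lemma SobClass.enorm_le_wordInv_replicate {α : ℝ} {m : ℕ} (hm : 2 * (m : ℝ) < α + 1) {u : ℝ → ℝ}
    (hu : SobClass α m u) {r : ℝ} (hr : 0 < r) :
    ‖u r‖ₑ ≤ wordInv α (List.replicate m true) (fun s => ‖_root_.iteratedDeriv m u s‖ₑ) r := by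
  induction m generalizing u r with
  | zero => simp [wordInv]
  | succ m ih =>
    refine (hu.1.enorm_le_tailInt (hu.tendsto hm) hr).trans ?_
    rw [List.replicate_succ]
    refine halfInv_mono α true (fun s hs => ?_) hr.le
    push_cast at hm
    rw [iteratedDeriv_succ']
    exact ih (by linarith) hu.2.2.2 hs

/-- The functions of the completion have all the derivatives of the original space. -/
lemma sobClass_of_mem_spaceD {α : ℝ} {m : ℕ} (hm : 1 ≤ m) (hα : 0 < α - 2 * m + 1) {u : ℝ → ℝ}
    (hu : u ∈ spaceD m α) : SobClass α m u := by
  obtain ⟨φ, hφ, hC, hlim⟩ := hu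
  have hm' : 2 * (m : ℝ) < α + 1 := by linarith
  have hW := fun n => sobClass_of_mem_preD hm hα (hφ n)
  have hg : ∀ n, MemLp (iteratedDeriv m (φ n)) 2 (radialMeasure α) := fun n => (hφ n).2.2.2
  have hcau : CauchySeq fun n => (hg n).toLp := by
    rw [EMetric.cauchySeq_iff]
    intro ε hε
    obtain ⟨N, hN⟩ := hC ε hε
    refine ⟨N, fun i hi j hj => ?_⟩
    rw [Lp.edist_toLp_toLp]
    refine lt_of_eq_of_lt (eLpNorm_congr_ae ?_) (hN i hi j hj)
    filter_upwards [iteratedDeriv_fun_sub_ae (hW i) (hW j)] with r hr using hr.symm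
  obtain ⟨g, hg'⟩ := cauchySeq_tendsto_of_complete hcau
  -- a measurable representative of the limit of the top order derivatives
  set γ : ℝ → ℝ := (Lp.aestronglyMeasurable g).mk g with hγ
  have hγm : Measurable γ := (Lp.aestronglyMeasurable g).stronglyMeasurable_mk.measurable
  have hγg : g =ᵐ[radialMeasure α] γ := (Lp.aestronglyMeasurable g).ae_eq_mk
  have hγL : MemLp γ 2 (radialMeasure α) := MemLp.ae_eq hγg (Lp.memLp g)
  have hdist : Tendsto (fun n => eLpNorm (fun r => iteratedDeriv m (φ n) r - γ r) 2
      (radialMeasure α)) atTop (𝓝 0) := by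
    have h1 := (tendsto_iff_edist_tendsto_0).1 hg'
    refine h1.congr fun n => ?_
    rw [Lp.edist_def]
    refine eLpNorm_congr_ae ?_
    filter_upwards [hγg, (hg n).coeFn_toLp] with r h2 h3
    simp [h2, h3]
  set P : ℝ → ℝ≥0∞ := fun r => ENNReal.ofReal (γ r) with hP
  set N : ℝ → ℝ≥0∞ := fun r => ENNReal.ofReal (-γ r) with hN
  have hE0 := (memLp_two_iff hγL.1).1 hγL
  have hPE : ∫⁻ r, P r ^ 2 ∂radialMeasure α ≠ ∞ := by
    refine ne_top_of_le_ne_top hE0 (lintegral_mono fun r => ?_)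
    gcongr
    exact Real.ofReal_le_enorm _
  have hNE : ∫⁻ r, N r ^ 2 ∂radialMeasure α ≠ ∞ := by
    refine ne_top_of_le_ne_top hE0 (lintegral_mono fun r => ?_)
    gcongr
    rw [← enorm_neg]
    exact Real.ofReal_le_enorm _
  have hPm : Measurable P := by fun_prop
  have hNm : Measurable N := by fun_prop
  set w := List.replicate m true with hw
  have hlen : w.length = m := by simp [hw]
  have hwl : 2 * (w.length : ℝ) < α + 1 := by rwa [hlen]
  set v : ℝ → ℝ := fun r => (-1) ^ m * ((wordInv α w P r).toReal - (wordInv α w N r).toReal)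
    with hv
  have hWP := sobClass_wordInv hPm hPE w hwl
  have hWN := sobClass_wordInv hNm hNE w hwl
  rw [hlen] at hWP hWN
  have hWv : SobClass α m v := (hWP.sub hWN).const_mul _
  have hvd : ∀ᵐ r ∂radialMeasure α, iteratedDeriv m v r = γ r := by
    filter_upwards [iteratedDeriv_fun_sub_ae hWP hWN, iteratedDeriv_wordInv_replicate hm' hPm hPE,
      iteratedDeriv_wordInv_replicate hm' hNm hNE] with r h1 h2 h3
    rw [hv, iteratedDeriv_const_mul_field, h1, h2, h3, ← mul_sub, ← mul_assoc, ← mul_pow]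
    simp only [hP, hN, mul_neg, mul_one, neg_neg, one_pow, one_mul]
    rcases le_total 0 (γ r) with h | h
    · rw [ENNReal.toReal_ofReal h, ENNReal.ofReal_of_nonpos (by linarith)]; simp
    · rw [ENNReal.toReal_ofReal (by linarith : 0 ≤ -γ r), ENNReal.ofReal_of_nonpos h]; simp
  refine hWv.congr fun r hr => ?_
  refine tendsto_nhds_unique (f := fun n => φ n r) ?_ (hlim r hr)
  obtain ⟨k, hk⟩ : ∃ k, m = k + 1 := ⟨m - 1, by omega⟩
  have hwk : w = true :: List.replicate k true := by rw [hw, hk, List.replicate_succ]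
  obtain ⟨C, hC, hpt⟩ := exists_pointwise_wordInv (α := α) true (List.replicate k true)
    (by rwa [← hwk])
  rw [← hwk] at hpt
  have hbound : ∀ n, ‖φ n r - v r‖ₑ ^ 2 ≤ C * ENNReal.ofReal (r ^ (-(α + 1 - 2 * (w.length : ℝ)))) *
      eLpNorm (fun r => iteratedDeriv m (φ n) r - γ r) 2 (radialMeasure α) ^ 2 := by
    intro n
    have h1 := ((hW n).sub hWv).enorm_le_wordInv_replicate hm' hr
    refine (pow_le_pow_left' h1 2).trans ((hpt _ ?_ r hr).trans (le_of_eq ?_))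
    · obtain ⟨j, rfl⟩ : ∃ j, m = j + 1 := ⟨m - 1, by omega⟩
      rw [iteratedDeriv_succ]
      exact (measurable_deriv _).enorm
    · rw [eLpNorm_two_sq]
      congr 1
      refine lintegral_congr_ae ?_
      filter_upwards [iteratedDeriv_fun_sub_ae (hW n) hWv, hvd] with s h2 h3
      rw [h2, h3]
  have h0 : Tendsto (fun n => ‖φ n r - v r‖ₑ ^ 2) atTop (𝓝 0) := by
    refine tendsto_of_tendsto_of_tendsto_of_le_of_le tendsto_const_nhds ?_ (fun _ => zero_le) hbound
    have h2 := ENNReal.Tendsto.const_mul (ENNReal.Tendsto.pow (n := 2) hdist)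
      (Or.inr (ENNReal.mul_ne_top hC (by simp) :
        C * ENNReal.ofReal (r ^ (-(α + 1 - 2 * (w.length : ℝ)))) ≠ ∞))
    simpa using h2
  rw [tendsto_iff_norm_sub_tendsto_zero]
  have h1 := (ENNReal.tendsto_toReal ENNReal.zero_ne_top).comp h0
  have h2 : Tendsto (fun n => ‖φ n r - v r‖ ^ 2) atTop (𝓝 0) := by
    refine h1.congr fun n => ?_
    simp
  have h3 := (Real.continuous_sqrt.tendsto 0).comp h2
  rw [Real.sqrt_zero] at h3
  exact h3.congr fun n => by simp [Real.sqrt_sq_eq_abs]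

/-! ### The Euler–Lagrange equation -/

instance (α : ℝ) : SigmaFinite (radialMeasure α) := by
  unfold radialMeasure
  exact SigmaFinite.withDensity_ofReal _

lemma eLpNorm_critExp {m : ℕ} {α q : ℝ} (hq : q = 2 * (α + 1) / (α - 2 * m + 1)) (hq0 : 0 < q)
    (u : ℝ → ℝ) :
    eLpNorm u (critExp m α) (radialMeasure α) = (∫⁻ r, ‖u r‖ₑ ^ q ∂radialMeasure α) ^ (1 / q) := by
  rw [critExp, ← hq, eLpNorm_eq_lintegral_rpow_enorm_toReal (by simpa using hq0) (by simp),
    ENNReal.toReal_ofReal hq0.le]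

lemma sobolevQuotient_eq {m : ℕ} {α q : ℝ} (hq : q = 2 * (α + 1) / (α - 2 * m + 1)) (hq0 : 0 < q)
    (u : ℝ → ℝ) :
    sobolevQuotient m α u = (∫⁻ r, ‖radialGrad m α u r‖ₑ ^ 2 ∂radialMeasure α) /
      (∫⁻ r, ‖u r‖ₑ ^ q ∂radialMeasure α) ^ (2 / q) := by
  rw [sobolevQuotient, eLpNorm_two_sq, eLpNorm_critExp hq hq0, ← ENNReal.rpow_two,
    ← ENNReal.rpow_mul, one_div_mul_eq_div]

/-- The Sobolev inequality in terms of `F = |∇_α^m u|`. -/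
lemma sobolevInf_mul_le {m : ℕ} (hm : 1 ≤ m) {α q : ℝ} (hα : 0 < α - 2 * m + 1)
    (hq : q = 2 * (α + 1) / (α - 2 * m + 1)) (hq0 : 0 < q) {F : ℝ → ℝ≥0∞} (hF : Measurable F)
    (hE : ∫⁻ r, F r ^ 2 ∂radialMeasure α ≠ ∞) :
    sobolevInf m α * (∫⁻ r, wordInv α (altWord true m) F r ^ q ∂radialMeasure α) ^ (2 / q) ≤
      ∫⁻ r, F r ^ 2 ∂radialMeasure α := by
  obtain ⟨k, rfl⟩ : ∃ k, m = k + 1 := ⟨m - 1, by omega⟩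
  set m := k + 1 with hmk
  set A := wordInv α (altWord true m) F with hA
  have hlen : (altWord true m).length = m := length_altWord _ _
  have hm' : 2 * (m : ℝ) < α + 1 := by linarith
  have hl : 2 * ((altWord true m).length : ℝ) < α + 1 := by rwa [hlen]
  have hfin : ∀ r, 0 < r → A r ≠ ∞ := fun r hr => wordInv_ne_top true _ hl hF hE hr
  by_cases h0 : ∃ r, 0 < r ∧ A r ≠ 0
  · obtain ⟨r₀, hr₀, hA0⟩ := h0
    have hW := sobClass_wordInv hF hE (altWord true m) hl
    rw [hlen] at hW
    set u : ℝ → ℝ := fun r => (A r).toReal with hu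
    have hmem : u ∈ spaceDNonzero m α :=
      ⟨mem_spaceD_of_mem_preD (hW.mem_preD hm hα), r₀, hr₀,
        ENNReal.toReal_ne_zero.2 ⟨hA0, hfin r₀ hr₀⟩⟩
    have h1 : sobolevInf m α ≤ sobolevQuotient m α u := iInf₂_le u hmem
    rw [sobolevQuotient_eq hq hq0] at h1
    have h2 : ∫⁻ r, ‖radialGrad m α u r‖ₑ ^ 2 ∂radialMeasure α = ∫⁻ r, F r ^ 2 ∂radialMeasure α := by
      refine lintegral_congr_ae ?_
      filter_upwards [abs_radialGrad_wordInv hm' hF hE,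
        ae_lt_top (hF.pow_const 2) hE] with r hr hr'
      rw [← Real.enorm_abs, hr, Real.enorm_of_nonneg ENNReal.toReal_nonneg, ENNReal.ofReal_toReal]
      rintro h
      simp [h] at hr'
    have h3 : ∫⁻ r, ‖u r‖ₑ ^ q ∂radialMeasure α = ∫⁻ r, A r ^ q ∂radialMeasure α := by
      refine lintegral_congr_ae (ae_radialMeasure_of_forall α fun r hr => ?_)
      simp only [hu]
      rw [Real.enorm_of_nonneg ENNReal.toReal_nonneg, ENNReal.ofReal_toReal (hfin r hr)]
    rw [h2, h3] at h1
    exact ENNReal.mul_le_of_le_div h1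
  · push Not at h0
    have : ∫⁻ r, A r ^ q ∂radialMeasure α = 0 := by
      rw [lintegral_congr_ae (g := fun _ => 0) (ae_radialMeasure_of_forall α fun r hr => ?_)]
      · simp
      · simp [h0 r hr, hq0]
    rw [this, ENNReal.zero_rpow_of_pos (by positivity), mul_zero]
    exact zero_le

/-- Every element of the space is dominated by the positive solution with the same `|∇_α^m u|`. -/
lemma exists_wordInv_majorant {m : ℕ} (hm : 1 ≤ m) {α : ℝ} (hα : 0 < α - 2 * m + 1) {u : ℝ → ℝ}
    (hu : u ∈ spaceD m α) : ∃ F : ℝ → ℝ≥0∞, Measurable F ∧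
      ∫⁻ r, F r ^ 2 ∂radialMeasure α = ∫⁻ r, ‖radialGrad m α u r‖ₑ ^ 2 ∂radialMeasure α ∧
      ∫⁻ r, F r ^ 2 ∂radialMeasure α ≠ ∞ ∧
      ∀ r, 0 < r → ‖u r‖ₑ ≤ wordInv α (altWord true m) F r := by
  obtain ⟨k, rfl⟩ : ∃ k, m = k + 1 := ⟨m - 1, by omega⟩
  have hW := sobClass_of_mem_spaceD hm hα hu
  have hL := hW.memLp_radialGrad
  have hae : (fun r => ‖radialGrad (k + 1) α u r‖ₑ) =ᵐ[radialMeasure α]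
      fun r => ‖hL.1.mk _ r‖ₑ := by
    filter_upwards [hL.1.ae_eq_mk] with r hr
    rw [← hr]
  have hE : ∫⁻ r, ‖hL.1.mk _ r‖ₑ ^ 2 ∂radialMeasure α =
      ∫⁻ r, ‖radialGrad (k + 1) α u r‖ₑ ^ 2 ∂radialMeasure α := by
    refine lintegral_congr_ae ?_
    filter_upwards [hae] with r hr
    rw [hr]
  refine ⟨fun r => ‖hL.1.mk _ r‖ₑ, hL.1.stronglyMeasurable_mk.measurable.enorm, hE, ?_,
    fun r hr => ?_⟩
  · rw [hE]
    exact (memLp_two_iff hL.1).1 hL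
  · refine (hW.enorm_le_wordInv (by linarith) hr).trans (le_of_eq ?_)
    exact wordInv_congr_ae α true _ hae hr

/-- The case of equality in the Cauchy–Schwarz inequality. -/
lemma ae_eq_of_cauchy_schwarz_eq {μ : Measure ℝ} {B F : ℝ → ℝ≥0∞} (hB : Measurable B)
    (hF : Measurable F) {κ E : ℝ≥0∞} (hκ : κ ≠ ∞) (hE : E ≠ ∞) (h1 : ∫⁻ r, F r ^ 2 ∂μ = E)
    (h2 : ∫⁻ r, B r * F r ∂μ = κ * E) (h3 : ∫⁻ r, B r ^ 2 ∂μ ≤ κ ^ 2 * E) :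
    B =ᵐ[μ] fun r => κ * F r := by
  have hfinE : κ ^ 2 * E ≠ ∞ := ENNReal.mul_ne_top (ENNReal.pow_ne_top hκ) hE
  set D : ℝ → ℝ≥0∞ := fun r => (B r - κ * F r) ^ 2 + (κ * F r - B r) ^ 2 with hD
  have hDm : Measurable D := by fun_prop
  have hBtop : ∀ᵐ r ∂μ, B r ^ 2 < ∞ := ae_lt_top (hB.pow_const 2) (ne_top_of_le_ne_top hfinE h3)
  have hFtop : ∀ᵐ r ∂μ, F r ^ 2 < ∞ := ae_lt_top (hF.pow_const 2) (by rwa [h1])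
  have hident : ∀ᵐ r ∂μ, B r ^ 2 + κ ^ 2 * F r ^ 2 = 2 * κ * (B r * F r) + D r := by
    filter_upwards [hBtop, hFtop] with r hb hf
    have key : ∀ a b : ℝ≥0∞, a ^ 2 + b ^ 2 = 2 * (a * b) + ((a - b) ^ 2 + (b - a) ^ 2) := by
      intro a b
      wlog hab : a ≤ b generalizing a b
      · have := this b a (le_of_not_ge hab)
        rw [add_comm (a ^ 2), this, mul_comm b a, add_comm ((b - a) ^ 2)]
      obtain ⟨d, rfl⟩ := exists_add_of_le hab
      rcases eq_or_ne a ∞ with rfl | ha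
      · simp
      rw [ENNReal.add_sub_cancel_left ha, tsub_eq_zero_of_le hab]
      ring
    rw [← mul_pow, key]
    simp only [hD]
    ring
  have hint : ∫⁻ r, B r ^ 2 ∂μ + κ ^ 2 * E = 2 * κ * (κ * E) + ∫⁻ r, D r ∂μ := by
    rw [← h2, ← h1, ← lintegral_const_mul _ (hF.pow_const 2), ← lintegral_add_left (hB.pow_const 2),
      ← lintegral_const_mul (2 * κ) (f := fun r => B r * F r) (hB.mul hF), ← lintegral_add_right _ hDm]
    exact lintegral_congr_ae hident
  have hD0 : ∫⁻ r, D r ∂μ = 0 := by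
    have h4 : 2 * κ * (κ * E) + ∫⁻ r, D r ∂μ ≤ 2 * κ * (κ * E) + 0 := by
      rw [← hint, add_zero]
      calc _ ≤ κ ^ 2 * E + κ ^ 2 * E := by gcongr
        _ = _ := by ring
    have hfin : 2 * κ * (κ * E) ≠ ∞ := by
      rw [show 2 * κ * (κ * E) = 2 * (κ ^ 2 * E) by ring]
      exact ENNReal.mul_ne_top (by simp) hfinE
    simpa using (ENNReal.add_le_add_iff_left hfin).1 h4
  filter_upwards [(lintegral_eq_zero_iff hDm).1 hD0] with r hr
  simp only [hD, Pi.zero_apply, add_eq_zero, pow_eq_zero_iff, ne_eq, OfNat.ofNat_ne_zero,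
    not_false_eq_true, tsub_eq_zero_iff_le] at hr
  exact le_antisymm hr.1 hr.2

/-- The dual of a bound for an alternating word from `L^2_α` to `L^q_α`. -/
lemma lintegral_sq_dual_le {α q q' : ℝ} (hqq : q.HolderConjugate q') {k : ℕ} {b : Bool}
    {S : ℝ≥0∞} (hS0 : S ≠ 0) (hS : S ≠ ∞)
    (h : ∀ G : ℝ → ℝ≥0∞, Measurable G → ∫⁻ r, G r ^ 2 ∂radialMeasure α ≠ ∞ →
      S * (∫⁻ r, wordInv α (altWord b k) G r ^ q ∂radialMeasure α) ^ (2 / q) ≤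
        ∫⁻ r, G r ^ 2 ∂radialMeasure α) {f : ℝ → ℝ≥0∞} (hf : Measurable f) :
    ∫⁻ r, wordInv α (altWord (Bool.not^[k] b) k) f r ^ 2 ∂radialMeasure α ≤
      S⁻¹ * (∫⁻ r, f r ^ q' ∂radialMeasure α) ^ (2 / q') := by
  set B := wordInv α (altWord (Bool.not^[k] b) k) f with hB
  have hBm : Measurable B := measurable_wordInv α _ hf
  -- it is enough to bound the integrals of the square integrable functions below `B`
  refine le_of_forall_lt fun L hL => ?_
  rw [lintegral_eq_nnreal] at hL
  simp_rw [lt_iSup_iff] at hL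
  obtain ⟨g₀, hg₀, hL⟩ := hL
  rw [← SimpleFunc.lintegral_eq_lintegral] at hL
  obtain ⟨g, hg1, hg2, hg3⟩ := SimpleFunc.exists_lt_lintegral_simpleFunc_of_lt_lintegral hL
  set G : ℝ → ℝ≥0∞ := fun r => (g r : ℝ≥0∞) ^ (1 / 2 : ℝ) with hG
  have hgm : Measurable fun r => (g r : ℝ≥0∞) := g.measurable.coe_nnreal_ennreal
  have hGm : Measurable G := hgm.pow_const _
  have hG2 : ∀ r, G r ^ 2 = g r := fun r => by
    rw [hG, ← ENNReal.rpow_two, ← ENNReal.rpow_mul]; norm_num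
  have hGB : ∀ r, G r ≤ B r := fun r => by
    have h1 : (g r : ℝ≥0∞) ≤ B r ^ (2 : ℝ) := by
      rw [ENNReal.rpow_two]
      exact (ENNReal.coe_le_coe.2 (hg1 r)).trans (hg₀ r)
    refine (ENNReal.rpow_le_rpow h1 (by norm_num : (0 : ℝ) ≤ 1 / 2)).trans (le_of_eq ?_)
    rw [← ENNReal.rpow_mul]; norm_num
  set Q := ∫⁻ r, G r ^ 2 ∂radialMeasure α with hQ
  have hQg : Q = ∫⁻ r, g r ∂radialMeasure α := lintegral_congr hG2
  rw [← hQg] at hg2 hg3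
  have h1 : Q ≤ (∫⁻ r, wordInv α (altWord b k) G r ^ q ∂radialMeasure α) ^ (1 / q) *
      (∫⁻ r, f r ^ q' ∂radialMeasure α) ^ (1 / q') := by
    calc Q ≤ ∫⁻ r, G r * B r ∂radialMeasure α := lintegral_mono fun r => by
          rw [sq]; gcongr; exact hGB r
      _ = ∫⁻ r, wordInv α (altWord b k) G r * f r ∂radialMeasure α :=
          (lintegral_altWord_mul α b k hGm hf).symm
      _ ≤ _ := ENNReal.lintegral_mul_le_Lp_mul_Lq _ hqq
          (measurable_wordInv α _ hGm).aemeasurable hf.aemeasurable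
  have h2 : S * Q ^ 2 ≤ Q * (∫⁻ r, f r ^ q' ∂radialMeasure α) ^ (2 / q') := by
    calc S * Q ^ 2 ≤ S * ((∫⁻ r, wordInv α (altWord b k) G r ^ q ∂radialMeasure α) ^ (1 / q) *
          (∫⁻ r, f r ^ q' ∂radialMeasure α) ^ (1 / q')) ^ 2 := by gcongr
      _ = (S * (∫⁻ r, wordInv α (altWord b k) G r ^ q ∂radialMeasure α) ^ (2 / q)) *
          (∫⁻ r, f r ^ q' ∂radialMeasure α) ^ (2 / q') := by
          rw [mul_pow, ← ENNReal.rpow_two, ← ENNReal.rpow_two, ← ENNReal.rpow_mul,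
            ← ENNReal.rpow_mul, one_div_mul_eq_div, one_div_mul_eq_div, mul_assoc]
      _ ≤ _ := by gcongr; exact h G hGm hg2.ne
  have hQ0 : Q ≠ 0 := (zero_le.trans_lt hg3).ne'
  refine hg3.trans_le ?_
  rw [sq, mul_left_comm, ENNReal.mul_le_mul_iff_right hQ0 hg2.ne] at h2
  rwa [mul_comm S⁻¹, ← div_eq_mul_inv, ENNReal.le_div_iff_mul_le (Or.inl hS0) (Or.inl hS), mul_comm]

/-- The Euler–Lagrange equation of a minimizer, in integrated form. It is obtained from the case of
equality in the dual inequality, so that no variation has to be computed. -/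
lemma exists_euler_lagrange {m : ℕ} (hm : 1 ≤ m) {α q : ℝ} (hα : 0 < α - 2 * m + 1)
    (hq : q = 2 * (α + 1) / (α - 2 * m + 1)) {z : ℝ → ℝ} (hz : IsSobolevMinimizer m α z) :
    ∃ (ψ : ℝ → ℝ≥0∞) (c : ℝ≥0∞), Measurable ψ ∧ c ≠ 0 ∧ c ≠ ∞ ∧
      (∀ r, 0 < r → ψ r = c * wordInv α (altWord true (2 * m)) (fun s => ψ s ^ (q - 1)) r) ∧
      (∫⁻ r, ψ r ^ q ∂radialMeasure α ≠ 0) ∧ (∫⁻ r, ψ r ^ q ∂radialMeasure α ≠ ∞) ∧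
      sobolevInf m α = c * (∫⁻ r, ψ r ^ q ∂radialMeasure α) ^ (1 - 2 / q) := by
  have hm1 : (1 : ℝ) ≤ m := by exact_mod_cast hm
  have hq2 : 2 < q := by
    rw [hq, lt_div_iff₀ hα]
    linarith
  have hq0 : 0 < q := by linarith
  obtain ⟨⟨hzD, r₀, hr₀, hz0⟩, hzS⟩ := hz
  obtain ⟨F, hF, hFE, hFfin, hFz⟩ := exists_wordInv_majorant hm hα hzD
  set E := ∫⁻ r, F r ^ 2 ∂radialMeasure α with hE
  set ψ := wordInv α (altWord true m) F with hψ
  have hψm : Measurable ψ := measurable_wordInv α _ hF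
  set N := ∫⁻ r, ψ r ^ q ∂radialMeasure α with hN
  set Nz := ∫⁻ r, ‖z r‖ₑ ^ q ∂radialMeasure α with hNz
  have hNzN : Nz ≤ N := by
    refine lintegral_mono_ae (ae_radialMeasure_of_forall α fun r hr => ?_)
    exact ENNReal.rpow_le_rpow (hFz r hr) hq0.le
  have hW := sobClass_of_mem_spaceD hm hα hzD
  obtain ⟨k, hk⟩ : ∃ k, m = k + 1 := ⟨m - 1, by omega⟩
  have hzcont : ContinuousOn z (Ioi 0) := by
    rw [hk] at hW
    exact hW.1.continuousOn
  have hNz0 : Nz ≠ 0 := by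
    intro h0
    have hzm : AEMeasurable (fun r => ‖z r‖ₑ ^ q) (radialMeasure α) := by
      have := ((hzcont.aestronglyMeasurable (μ := volume) measurableSet_Ioi).mono_ac
        (withDensity_absolutelyContinuous _ (fun r => ENNReal.ofReal (r ^ α)))).enorm
      exact this.pow_const q
    rw [hNz, lintegral_eq_zero_iff' hzm, EventuallyEq, ae_radialMeasure_iff] at h0
    have h1 : z =ᵐ[volume.restrict (Ioi 0)] fun _ => 0 := by
      filter_upwards [h0] with r hr
      simp only [Pi.zero_apply, ENNReal.rpow_eq_zero_iff, hq0, and_true, not_lt_of_gt hq0,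
        and_false, or_false, enorm_eq_zero] at hr
      exact hr
    have h2 := Measure.eqOn_open_of_ae_eq h1 isOpen_Ioi hzcont continuousOn_const
    exact hz0 (h2 hr₀)
  have hlen : (altWord true m).length = m := length_altWord _ _
  have hNfin : N ≠ ∞ := by
    obtain ⟨C, hC, h⟩ := exists_sobolev_wordInv (α := α) true (altWord false k)
      (by rw [List.length_cons, length_altWord, ← hk]; linarith)
    have h1 := h F hF
    rw [List.length_cons, length_altWord, ← hk,
      show α + 1 - 2 * (m : ℝ) = α - 2 * m + 1 by ring, ← hq] at h1
    have h2 : true :: altWord false k = altWord true m := by rw [hk]; rfl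
    rw [h2] at h1
    refine ne_top_of_le_ne_top (ENNReal.mul_ne_top hC (ENNReal.rpow_ne_top_of_nonneg ?_ hFfin)) h1
    exact div_nonneg (by linarith) hα.le
  have hN0 : N ≠ 0 := fun h => hNz0 (le_antisymm (h ▸ hNzN) zero_le)
  have hNzfin : Nz ≠ ∞ := ne_top_of_le_ne_top hNfin hNzN
  rw [sobolevQuotient_eq hq hq0, ← hFE, ← hNz] at hzS
  set S := sobolevInf m α with hS
  have hp0 : ∀ x : ℝ≥0∞, x ≠ 0 → x ≠ ∞ → ∀ p : ℝ, x ^ p ≠ 0 := fun x h h' p =>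
    (ENNReal.rpow_pos (pos_iff_ne_zero.2 h) h').ne'
  have hpt : ∀ x : ℝ≥0∞, x ≠ 0 → x ≠ ∞ → ∀ p : ℝ, x ^ p ≠ ∞ := fun x h h' p =>
    ENNReal.rpow_ne_top_of_ne_zero h h'
  have hSt : S ≠ ∞ := by
    rw [← hzS]
    exact ENNReal.div_ne_top hFfin (hp0 _ hNz0 hNzfin _)
  have hE0 : E ≠ 0 := by
    intro h0
    have h1 : F =ᵐ[radialMeasure α] fun _ => 0 := by
      filter_upwards [(lintegral_eq_zero_iff (hF.pow_const 2)).1 h0] with r hr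
      simpa using hr
    apply hN0
    have hz' : ∀ r, 0 < r → ψ r = 0 := by
      intro r hr
      have h2 := wordInv_congr_ae α true (altWord false k) h1 hr
      have h3 : true :: altWord false k = altWord true m := by rw [hk]; rfl
      rw [h3] at h2
      have h4 := wordInv_const_mul α (altWord true m) (fun _ => 0) (c := 0) (by simp)
      simp only [mul_zero, zero_mul] at h4
      rw [hψ, h2, h4]
    rw [hN, lintegral_congr_ae (g := fun _ => 0) (ae_radialMeasure_of_forall α fun r hr => by
      simp [hz' r hr, hq0])]
    simp
  have hS0 : S ≠ 0 := by
    rw [← hzS]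
    exact ENNReal.div_ne_zero.2 ⟨hE0, hpt _ hNz0 hNzfin _⟩
  have hSN : S * N ^ (2 / q) = E := by
    refine le_antisymm (sobolevInf_mul_le hm hα hq hq0 hF hFfin) ?_
    rw [← hzS]
    calc E = E / Nz ^ (2 / q) * Nz ^ (2 / q) :=
          (ENNReal.div_mul_cancel (hp0 _ hNz0 hNzfin _) (hpt _ hNz0 hNzfin _)).symm
      _ ≤ _ := by gcongr
  set q' := q / (q - 1) with hq'
  have hqq : q.HolderConjugate q' := Real.HolderConjugate.conjExponent (by linarith)
  set f : ℝ → ℝ≥0∞ := fun r => ψ r ^ (q - 1) with hf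
  have hfm : Measurable f := hψm.pow_const _
  set B := wordInv α (altWord (Bool.not^[m] true) m) f with hB
  have hBm : Measurable B := measurable_wordInv α _ hfm
  have hfq : ∫⁻ r, f r ^ q' ∂radialMeasure α = N := by
    refine lintegral_congr fun r => ?_
    rw [hf, ← ENNReal.rpow_mul, hq', mul_div_cancel₀ _ (by linarith)]
  set κ := S⁻¹ * N ^ (1 - 2 / q) with hκ
  have hκ0 : κ ≠ 0 := mul_ne_zero (ENNReal.inv_ne_zero.2 hSt) (hp0 _ hN0 hNfin _)
  have hκt : κ ≠ ∞ := ENNReal.mul_ne_top (ENNReal.inv_ne_top.2 hS0) (hpt _ hN0 hNfin _)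
  have hκE : κ * E = N := by
    rw [hκ, ← hSN, show S⁻¹ * N ^ (1 - 2 / q) * (S * N ^ (2 / q)) =
      (S⁻¹ * S) * (N ^ (1 - 2 / q) * N ^ (2 / q)) by ring, ENNReal.inv_mul_cancel hS0 hSt,
      ← ENNReal.rpow_add _ _ hN0 hNfin]
    simp
  have hBF : B =ᵐ[radialMeasure α] fun r => κ * F r := by
    refine ae_eq_of_cauchy_schwarz_eq hBm hF hκt hFfin hE.symm ?_ ?_
    · rw [hκE]
      calc ∫⁻ r, B r * F r ∂radialMeasure α = ∫⁻ r, F r * B r ∂radialMeasure α := by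
            simp only [mul_comm]
        _ = ∫⁻ r, ψ r * f r ∂radialMeasure α := (lintegral_altWord_mul α true m hF hfm).symm
        _ = N := by
          refine lintegral_congr fun r => ?_
          rw [hf]
          nth_rw 1 [← ENNReal.rpow_one (ψ r)]
          rw [← ENNReal.rpow_add_of_nonneg _ _ zero_le_one (by linarith)]
          ring_nf
    · have h1 := lintegral_sq_dual_le (k := m) (b := true) hqq hS0 hSt
        (fun G hG hG' => sobolevInf_mul_le hm hα hq hq0 hG hG') hfm
      refine h1.trans (le_of_eq ?_)
      rw [hfq, sq, mul_assoc, hκE, hκ, mul_assoc]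
      nth_rw 3 [← ENNReal.rpow_one N]
      rw [← ENNReal.rpow_add _ _ hN0 hNfin, hq']
      congr 2
      field_simp
      ring
  refine ⟨ψ, κ⁻¹, hψm, ENNReal.inv_ne_zero.2 hκt, ENNReal.inv_ne_top.2 hκ0, fun r hr => ?_,
    hN0, hNfin, ?_⟩
  · have h1 : altWord true (2 * m) = altWord true m ++ altWord (Bool.not^[m] true) m := by
      rw [two_mul, altWord_add]
    rw [h1, wordInv_append]
    have h2 := wordInv_congr_ae α true (altWord false k) hBF hr
    have h3 : true :: altWord false k = altWord true m := by rw [hk]; rfl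
    rw [h3, wordInv_const_mul α _ _ hκt] at h2
    rw [h2, ← mul_assoc, ENNReal.inv_mul_cancel hκ0 hκt, one_mul]
  · rw [hκ, ENNReal.mul_inv (Or.inr (hpt _ hN0 hNfin _)) (Or.inr (hp0 _ hN0 hNfin _)), inv_inv,
      mul_assoc, ENNReal.inv_mul_cancel (hp0 _ hN0 hNfin _) (hpt _ hN0 hNfin _), mul_one]

/-! ### Positive solutions and their powers of the Laplacian -/

/-- `r^α · avgInt α g` is nondecreasing, so that `avgInt α g` is controlled by its tail integral. -/
lemma avgInt_le_tailInt_avgInt {α : ℝ} (hα : 1 < α) (g : ℝ → ℝ≥0∞) {r : ℝ} (hr : 0 < r) :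
    avgInt α g r ≤ ENNReal.ofReal ((α - 1) / r) * tailInt (avgInt α g) r := by
  have h1 : ENNReal.ofReal (r / (α - 1)) * avgInt α g r ≤ tailInt (avgInt α g) r := by
    calc ENNReal.ofReal (r / (α - 1)) * avgInt α g r
        = ∫⁻ s in Ioi r, ENNReal.ofReal (s ^ (-α)) * (ENNReal.ofReal (r ^ α) * avgInt α g r) := by
          rw [lintegral_mul_const _ (by fun_prop), lintegral_Ioi_rpow (by linarith) hr, ← mul_assoc,
            ← ENNReal.ofReal_mul (div_nonneg (by positivity) (by linarith))]
          congr 2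
          rw [show -(-α + 1) = α - 1 by ring, div_mul_eq_mul_div, ← Real.rpow_add hr]
          ring_nf
          rw [Real.rpow_one]
          ring
      _ ≤ _ := by
          refine setLIntegral_mono' measurableSet_Ioi fun s hs => ?_
          have hs0 : 0 < s := hr.trans hs
          calc _ ≤ ENNReal.ofReal (s ^ (-α)) * (ENNReal.ofReal (s ^ α) * avgInt α g s) := by
                gcongr _ * ?_
                exact rpow_mul_avgInt_mono α g hr (le_of_lt hs)
            _ = _ := by
              rw [← mul_assoc, ofReal_rpow_mul_ofReal_rpow hs0]; simp
  calc avgInt α g r = ENNReal.ofReal ((α - 1) / r) * (ENNReal.ofReal (r / (α - 1)) *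
        avgInt α g r) := by
        rw [← mul_assoc, ← ENNReal.ofReal_mul (div_nonneg (by linarith) hr.le)]
        have : (α - 1) / r * (r / (α - 1)) = 1 := by
          have : α - 1 ≠ 0 := by linarith
          field_simp
        simp [this]
    _ ≤ _ := by gcongr

/-- A nonincreasing function is controlled by its average. -/
lemma le_avgInt_of_antitoneOn {α : ℝ} (hα : -1 < α) {g : ℝ → ℝ≥0∞} (hg : AntitoneOn g (Ioi 0))
    {r : ℝ} (hr : 0 < r) : g r ≤ ENNReal.ofReal ((α + 1) / r) * avgInt α g r := by
  have h1 : ENNReal.ofReal (r ^ (α + 1) / (α + 1)) * g r ≤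
      ∫⁻ s in Ioo 0 r, ENNReal.ofReal (s ^ α) * g s := by
    rw [← lintegral_Ioo_rpow hα hr, ← lintegral_mul_const _ (by fun_prop)]
    refine setLIntegral_mono' measurableSet_Ioo fun s hs => ?_
    gcongr
    exact hg hs.1 hr hs.2.le
  calc g r = ENNReal.ofReal ((α + 1) / r) * (ENNReal.ofReal (r ^ (-α)) *
        (ENNReal.ofReal (r ^ (α + 1) / (α + 1)) * g r)) := by
        rw [← mul_assoc, ← mul_assoc, ← ENNReal.ofReal_mul (div_nonneg (by linarith) hr.le),
          ← ENNReal.ofReal_mul (mul_nonneg (div_nonneg (by linarith) hr.le) (by positivity))]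
        have : (α + 1) / r * r ^ (-α) * (r ^ (α + 1) / (α + 1)) = 1 := by
          have h2 : r ^ (-α) * r ^ (α + 1) = r := by
            rw [← Real.rpow_add hr]; ring_nf; simp
          have : α + 1 ≠ 0 := by linarith
          calc _ = (α + 1) / (α + 1) * ((r ^ (-α) * r ^ (α + 1)) / r) := by ring
            _ = 1 := by rw [h2, div_self this, div_self hr.ne', one_mul]
        simp [this]
    _ ≤ _ := by rw [avgInt]; gcongr

lemma avgInt_ne_zero {α : ℝ} {g : ℝ → ℝ≥0∞} (hgm : Measurable g) {ε : ℝ} (hε : 0 < ε)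
    (hg : ∀ r, 0 < r → r < ε → g r ≠ 0) {r : ℝ} (hr : 0 < r) : avgInt α g r ≠ 0 := by
  refine mul_ne_zero (by simp [Real.rpow_pos_of_pos hr]) ?_
  have hm : Measurable fun s : ℝ => ENNReal.ofReal (s ^ α) * g s := by fun_prop
  rw [← pos_iff_ne_zero, setLIntegral_pos_iff hm]
  refine lt_of_lt_of_le ?_ (measure_mono (s := Ioo 0 (min ε r)) fun s hs => ⟨?_, hs.1,
    hs.2.trans_le (min_le_right _ _)⟩)
  · simp [hε, hr]
  · simp only [Function.mem_support]
    exact mul_ne_zero (by simp [Real.rpow_pos_of_pos hs.1])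
      (hg s hs.1 (hs.2.trans_le (min_le_left _ _)))

lemma tailInt_ne_zero {g : ℝ → ℝ≥0∞} (hgm : Measurable g) {R : ℝ}
    (hg : ∀ r, R < r → g r ≠ 0) (r : ℝ) : tailInt g r ≠ 0 := by
  rw [← pos_iff_ne_zero, tailInt, setLIntegral_pos_iff hgm]
  refine lt_of_lt_of_le ?_ (measure_mono (s := Ioi (max r R)) fun s hs =>
    ⟨?_, (le_max_left r R).trans_lt (mem_Ioi.1 hs)⟩)
  · simp
  · exact hg s ((le_max_right r R).trans_lt hs)

/-- If `g` does not vanish almost everywhere, its tail integral is positive near the origin. -/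
lemma exists_tailInt_ne_zero {g : ℝ → ℝ≥0∞} (hg : ∫⁻ r in Ioi (0 : ℝ), g r ≠ 0) :
    ∃ ε > 0, ∀ r, 0 < r → r < ε → tailInt g r ≠ 0 := by
  by_contra! h
  apply hg
  have hU : Ioi (0 : ℝ) = ⋃ k : ℕ, Ioi (1 / ((k : ℝ) + 1)) := by
    ext x
    simp only [mem_Ioi, mem_iUnion]
    exact ⟨fun hx => exists_nat_one_div_lt hx, fun ⟨k, hk⟩ => lt_trans (by positivity) hk⟩
  rw [hU, ← nonpos_iff_eq_zero]
  refine (lintegral_iUnion_le _ _).trans (le_of_eq ?_)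
  refine ENNReal.tsum_eq_zero.2 fun k => ?_
  obtain ⟨r, hr0, hr, hr'⟩ := h (1 / ((k : ℝ) + 1)) (by positivity)
  exact le_antisymm (hr' ▸ antitone_tailInt g hr.le) zero_le

/-- A positive radial solution of `(-Δ_α)^m f = c f^{q-1}`, together with the functions
`f j = (-Δ_α)^j f` and `g j = -(f j)'`, for `j ≤ m`, and with the estimates that all its solutions of
finite energy satisfy. -/
structure IsRadialChain (α : ℝ) (m : ℕ) (q c : ℝ) (f g : ℕ → ℝ → ℝ) : Prop where
  measurable_f : ∀ j, Measurable (f j)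
  measurable_g : ∀ j, Measurable (g j)
  f_pos : ∀ j ≤ m, ∀ r, 0 < r → 0 < f j r
  g_pos : ∀ j ≤ m, ∀ r, 0 < r → 0 < g j r
  hasDerivAt_f : ∀ j ≤ m, ∀ r, 0 < r → HasDerivAt (f j) (-g j r) r
  hasDerivAt_g : ∀ j < m, ∀ r, 0 < r → HasDerivAt (g j) (f (j + 1) r - α / r * g j r) r
  g_eq : ∀ j < m, ∀ r, 0 < r →
    ENNReal.ofReal (g j r) = avgInt α (fun s => ENNReal.ofReal (f (j + 1) s)) r
  top_f : ∀ r, 0 < r → f m r = c * f 0 r ^ (q - 1)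
  top_g : ∀ r, 0 < r → g m r = (q - 1) * c * f 0 r ^ (q - 2) * g 0 r
  f_le : ∀ j ≤ m, ∃ C, ∀ r, 0 < r → f j r ≤ C * r ^ (-(2 * j : ℝ)) * f 0 r
  g_le : ∀ j < m, ∀ r, 0 < r → g j r ≤ (α - 1) / r * f j r
  zero_le : ∃ C, ∀ r, 0 < r → f 0 r ≤ C * r ^ (-((α - 2 * m + 1) / 2))

/-- A solution of the integrated equation with finite energy is positive, differentiable and
decreasing, and so are its images under `(-Δ_α)^j` for `j ≤ m`. -/
lemma exists_isRadialChain {m : ℕ} (hm : 1 ≤ m) {α q : ℝ} (hα : 0 < α - 2 * m + 1)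
    (hq : q = 2 * (α + 1) / (α - 2 * m + 1)) {ψ : ℝ → ℝ≥0∞} {c : ℝ≥0∞} (hψm : Measurable ψ)
    (hc0 : c ≠ 0) (hc : c ≠ ∞)
    (hψ : ∀ r, 0 < r → ψ r = c * wordInv α (altWord true (2 * m)) (fun s => ψ s ^ (q - 1)) r)
    (hN0 : ∫⁻ r, ψ r ^ q ∂radialMeasure α ≠ 0) (hN : ∫⁻ r, ψ r ^ q ∂radialMeasure α ≠ ∞) :
    ∃ f g : ℕ → ℝ → ℝ, IsRadialChain α m q c.toReal f g ∧
      ∀ r, 0 < r → ψ r = ENNReal.ofReal (f 0 r) := by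
  have hm1 : (1 : ℝ) ≤ m := by exact_mod_cast hm
  have hα1 : 1 < α := by linarith
  have hq2 : 2 < q := by
    rw [hq, lt_div_iff₀ hα]
    linarith
  have hq0 : 0 < q := by linarith
  set X : ℝ → ℝ≥0∞ := fun s => c * ψ s ^ (q - 1) with hX
  have hXm : Measurable X := (hψm.pow_const _).const_mul c
  set F : ℕ → ℝ → ℝ≥0∞ := fun j => wordInv α (altWord true (2 * (m - j))) X with hF
  have hFm : ∀ j, Measurable (F j) := fun j => measurable_wordInv α _ hXm
  have hF0 : ∀ r, 0 < r → ψ r = F 0 r := fun r hr => by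
    rw [hψ r hr, hF, hX]
    simp only [wordInv_const_mul α _ _ hc, Nat.sub_zero]
  have hFtop : F m = X := by simp [hF, altWord, wordInv]
  have hstep : ∀ j < m, F j = tailInt (avgInt α (F (j + 1))) := by
    intro j hj
    have h1 : 2 * (m - j) = 2 * (m - (j + 1)) + 2 := by omega
    simp only [hF, h1]
    rfl
  have hanti0 : ∀ j < m, Antitone (F j) := fun j hj => by
    rw [hstep j hj]; exact antitone_tailInt _
  have hanti : ∀ j ≤ m, AntitoneOn (F j) (Ioi 0) := by
    intro j hj
    rcases hj.lt_or_eq with h | rfl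
    · exact (hanti0 j h).antitoneOn _
    · rw [hFtop]
      intro r hr s hs hrs
      simp only [hX]
      rw [hF0 r hr, hF0 s hs]
      gcongr
      · linarith
      · exact hanti0 0 (by omega) hrs
  -- the decay given by monotonicity and finite energy
  have hbound : ∃ C : ℝ≥0∞, C ≠ ∞ ∧ ∀ r, 0 < r →
      F 0 r ≤ C * ENNReal.ofReal (r ^ (-((α - 2 * m + 1) / 2))) := by
    set N := ∫⁻ r, ψ r ^ q ∂radialMeasure α with hNdef
    refine ⟨(ENNReal.ofReal (α + 1) * N) ^ (1 / q), ENNReal.rpow_ne_top_of_nonneg (by positivity)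
      (ENNReal.mul_ne_top (by simp) hN), fun r hr => ?_⟩
    have h1 : ENNReal.ofReal (r ^ (α + 1) / (α + 1)) * F 0 r ^ q ≤ N := by
      rw [hNdef, lintegral_radialMeasure, ← lintegral_Ioo_rpow (by linarith) hr,
        ← lintegral_mul_const _ (by fun_prop)]
      refine le_trans (setLIntegral_mono' measurableSet_Ioo fun s hs => ?_)
        (lintegral_mono_set (Ioo_subset_Ioi_self : Ioo 0 r ⊆ Ioi (0 : ℝ)))
      rw [hF0 s hs.1]
      gcongr
      exact hanti0 0 (by omega) hs.2.le
    have h2 : F 0 r ^ q ≤ ENNReal.ofReal (α + 1) * N * ENNReal.ofReal (r ^ (-(α + 1))) := by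
      calc F 0 r ^ q = ENNReal.ofReal ((α + 1) * r ^ (-(α + 1))) *
            (ENNReal.ofReal (r ^ (α + 1) / (α + 1)) * F 0 r ^ q) := by
            rw [← mul_assoc, ← ENNReal.ofReal_mul (mul_nonneg (by linarith) (by positivity))]
            have : (α + 1) * r ^ (-(α + 1)) * (r ^ (α + 1) / (α + 1)) = 1 := by
              have h3 : r ^ (-(α + 1)) * r ^ (α + 1) = 1 := by
                rw [← Real.rpow_add hr]; simp
              have : α + 1 ≠ 0 := by linarith
              calc _ = (α + 1) / (α + 1) * (r ^ (-(α + 1)) * r ^ (α + 1)) := by ring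
                _ = 1 := by rw [h3, div_self this, one_mul]
            rw [this, ENNReal.ofReal_one, one_mul]
        _ ≤ ENNReal.ofReal ((α + 1) * r ^ (-(α + 1))) * N := by gcongr
        _ = _ := by rw [ENNReal.ofReal_mul (by linarith)]; ring
    have h3 := ENNReal.rpow_le_rpow h2 (by positivity : (0 : ℝ) ≤ 1 / q)
    rw [← ENNReal.rpow_mul, mul_one_div_cancel hq0.ne', ENNReal.rpow_one,
      ENNReal.mul_rpow_of_nonneg _ _ (by positivity), ENNReal.ofReal_rpow_of_pos (by positivity),
      ← Real.rpow_mul hr.le] at h3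
    refine h3.trans (le_of_eq ?_)
    congr 3
    rw [hq]
    have : α + 1 ≠ 0 := by linarith
    field_simp
  have hGF : ∀ j < m, ∀ r, 0 < r →
      avgInt α (F (j + 1)) r ≤ ENNReal.ofReal ((α - 1) / r) * F j r := fun j hj r hr => by
    rw [hstep j hj]; exact avgInt_le_tailInt_avgInt hα1 _ hr
  have hFF : ∀ j < m, ∀ r, 0 < r →
      F (j + 1) r ≤ ENNReal.ofReal ((α + 1) * (α - 1)) * ENNReal.ofReal (r ^ (-2 : ℝ)) * F j r := by
    intro j hj r hr
    refine (le_avgInt_of_antitoneOn (α := α) (by linarith) (hanti (j + 1) hj) hr).trans ?_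
    calc _ ≤ ENNReal.ofReal ((α + 1) / r) * (ENNReal.ofReal ((α - 1) / r) * F j r) :=
          mul_le_mul_right (hGF j hj r hr) _
      _ = _ := by
        rw [← mul_assoc, ← ENNReal.ofReal_mul (div_nonneg (by linarith) hr.le),
          ← ENNReal.ofReal_mul (mul_nonneg (by linarith) (by linarith)), Real.rpow_neg hr.le]
        congr 2
        simp only [Real.rpow_ofNat]
        field_simp
  have hFb : ∀ j ≤ m, ∃ C : ℝ≥0∞, C ≠ ∞ ∧ ∀ r, 0 < r →
      F j r ≤ C * ENNReal.ofReal (r ^ (-(2 * j : ℝ))) * F 0 r := by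
    intro j
    induction j with
    | zero => exact fun _ => ⟨1, by simp, fun r hr => by simp⟩
    | succ j ih =>
      intro hj
      obtain ⟨C, hC, h⟩ := ih (by omega)
      refine ⟨ENNReal.ofReal ((α + 1) * (α - 1)) * C, ENNReal.mul_ne_top (by simp) hC,
        fun r hr => (hFF j hj r hr).trans ?_⟩
      calc _ ≤ ENNReal.ofReal ((α + 1) * (α - 1)) * ENNReal.ofReal (r ^ (-2 : ℝ)) *
            (C * ENNReal.ofReal (r ^ (-(2 * j : ℝ))) * F 0 r) := by gcongr; exact h r hr
        _ = ENNReal.ofReal ((α + 1) * (α - 1)) * C * (ENNReal.ofReal (r ^ (-2 : ℝ)) *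
            ENNReal.ofReal (r ^ (-(2 * j : ℝ)))) * F 0 r := by ring
        _ = _ := by
          rw [ofReal_rpow_mul_ofReal_rpow hr]
          push_cast
          ring_nf
  have hF0fin : ∀ r, 0 < r → F 0 r ≠ ∞ := fun r hr => by
    obtain ⟨C, hC, h⟩ := hbound
    exact ne_top_of_le_ne_top (ENNReal.mul_ne_top hC (by simp)) (h r hr)
  have hFfin : ∀ j ≤ m, ∀ r, 0 < r → F j r ≠ ∞ := fun j hj r hr => by
    obtain ⟨C, hC, h⟩ := hFb j hj
    exact ne_top_of_le_ne_top (ENNReal.mul_ne_top (ENNReal.mul_ne_top hC (by simp))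
      (hF0fin r hr)) (h r hr)
  have hGfin : ∀ j < m, ∀ r, 0 < r → avgInt α (F (j + 1)) r ≠ ∞ := fun j hj r hr =>
    ne_top_of_le_ne_top (ENNReal.mul_ne_top (by simp) (hFfin j hj.le r hr)) (hGF j hj r hr)
  -- `F 0` is nonincreasing and not zero, so `F m` is positive near the origin, and each application of
  -- `tailInt ∘ avgInt α` makes it positive everywhere
  have hFpos : ∀ j ≤ m, ∀ r, 0 < r → F j r ≠ 0 := by
    have hstepback : ∀ j < m, (∃ ε > 0, ∀ r, 0 < r → r < ε → F (j + 1) r ≠ 0) →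
        ∀ r, F j r ≠ 0 := by
      rintro j hj ⟨ε, hε, h⟩ r
      rw [hstep j hj]
      exact tailInt_ne_zero (measurable_avgInt α _) (R := 0)
        (fun s hs => avgInt_ne_zero (hFm _) hε h hs) r
    have h0 : ∃ r₀, 0 < r₀ ∧ F 0 r₀ ≠ 0 := by
      by_contra! h
      apply hN0
      rw [lintegral_congr_ae (g := fun _ => 0) (ae_radialMeasure_of_forall α fun r hr => by
        rw [hF0 r hr, h r hr, ENNReal.zero_rpow_of_pos hq0])]
      simp
    obtain ⟨r₀, hr₀, h0⟩ := h0
    have htop : ∀ r, 0 < r → r < r₀ → F m r ≠ 0 := by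
      intro r hr hr'
      rw [hFtop]
      refine mul_ne_zero hc0 ?_
      have h1 : ψ r ≠ 0 := by
        rw [hF0 r hr]
        exact fun h => h0 (le_antisymm (h ▸ hanti0 0 (by omega) hr'.le) zero_le)
      simp [h1, (by linarith : ¬ q < 1)]
    have hlt : ∀ i, ∀ j < m, m = j + i + 1 → ∀ r, F j r ≠ 0 := by
      intro i
      induction i with
      | zero =>
        intro j hj hji
        refine hstepback j hj ⟨r₀, hr₀, ?_⟩
        rwa [show j + 1 = m by omega]
      | succ i ih =>
        intro j hj hji
        exact hstepback j hj ⟨1, one_pos, fun r _ _ => ih (j + 1) (by omega) (by omega) r⟩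
    intro j hj r hr
    rcases hj.lt_or_eq with h | h
    · exact hlt (m - j - 1) j h (by omega) r
    · rw [h, hFtop]
      refine mul_ne_zero hc0 ?_
      have h1 : ψ r ≠ 0 := by
        rw [hF0 r hr]
        exact hlt (m - 1) 0 (by omega) (by omega) r
      simp [h1, (by linarith : ¬ q < 1)]
  have hGpos : ∀ j < m, ∀ r, 0 < r → avgInt α (F (j + 1)) r ≠ 0 := fun j hj r hr =>
    avgInt_ne_zero (hFm _) one_pos (fun s hs _ => hFpos (j + 1) hj s hs) hr
  -- `F m` is not a tail integral: its derivative is computed from `F m = c (F 0)^{q-1}`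
  set f : ℕ → ℝ → ℝ := fun j r => (F j r).toReal with hf
  set g₀ : ℕ → ℝ → ℝ := fun j r => (avgInt α (F (j + 1)) r).toReal with hg₀
  set g : ℕ → ℝ → ℝ := fun j => if j < m then g₀ j else
    fun r => (q - 1) * c.toReal * f 0 r ^ (q - 2) * g₀ 0 r with hg
  have hgj : ∀ j < m, g j = g₀ j := fun j hj => by simp [hg, hj]
  have hgtop : g m = fun r => (q - 1) * c.toReal * f 0 r ^ (q - 2) * g₀ 0 r := by simp [hg]
  have hcpos : 0 < c.toReal := ENNReal.toReal_pos hc0 hc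
  have hfpos : ∀ j ≤ m, ∀ r, 0 < r → 0 < f j r := fun j hj r hr =>
    ENNReal.toReal_pos (hFpos j hj r hr) (hFfin j hj r hr)
  have hg₀pos : ∀ j < m, ∀ r, 0 < r → 0 < g₀ j r := fun j hj r hr =>
    ENNReal.toReal_pos (hGpos j hj r hr) (hGfin j hj r hr)
  have hof : ∀ j ≤ m, ∀ r, 0 < r → ENNReal.ofReal (f j r) = F j r := fun j hj r hr =>
    ENNReal.ofReal_toReal (hFfin j hj r hr)
  have hog : ∀ j < m, ∀ r, 0 < r → ENNReal.ofReal (g₀ j r) = avgInt α (F (j + 1)) r :=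
    fun j hj r hr => ENNReal.ofReal_toReal (hGfin j hj r hr)
  have hgAC : ∀ j < m, LocallyAC (g₀ j) := fun j hj => (hasDerivAt_avgInt (hFm _) (hGfin j hj)).1
  have htail : ∀ j < m, ∀ r, 0 < r → tailInt (avgInt α (F (j + 1))) r ≠ ∞ := fun j hj r hr => by
    rw [← hstep j hj]; exact hFfin j hj.le r hr
  have hdf : ∀ j < m, ∀ r, 0 < r → HasDerivAt (f j) (-g₀ j r) r := by
    intro j hj r hr
    have h1 := hasDerivAt_tailInt (measurable_avgInt α _) (htail j hj)
    rw [← hstep j hj] at h1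
    exact h1.1.hasDerivAt_of_continuousOn (hgAC j hj).continuousOn.neg h1.2 hr
  have hftop : ∀ r, 0 < r → f m r = c.toReal * f 0 r ^ (q - 1) := by
    intro r hr
    simp only [hf, hFtop, hX]
    rw [ENNReal.toReal_mul, ← ENNReal.toReal_rpow, hF0 r hr]
  have hdftop : ∀ r, 0 < r → HasDerivAt (f m) (-g m r) r := by
    intro r hr
    have h1 := ((hdf 0 (by omega) r hr).rpow_const (p := q - 1)
      (Or.inl (hfpos 0 (by omega) r hr).ne')).const_mul c.toReal
    refine (h1.congr_of_eventuallyEq ?_).congr_deriv ?_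
    · filter_upwards [Ioi_mem_nhds hr] with s hs using hftop s hs
    · rw [hgtop, show q - 1 - 1 = q - 2 by ring]
      ring
  have hdf' : ∀ j ≤ m, ∀ r, 0 < r → HasDerivAt (f j) (-g j r) r := by
    intro j hj r hr
    rcases hj.lt_or_eq with h | rfl
    · rw [hgj j h]; exact hdf j h r hr
    · exact hdftop r hr
  have hfcont : ∀ j ≤ m, ContinuousOn (f j) (Ioi 0) := fun j hj r hr =>
    (hdf' j hj r hr).continuousAt.continuousWithinAt
  have hfm : ∀ j, Measurable (f j) := fun j => (hFm j).ennreal_toReal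
  have hg₀m : ∀ j, Measurable (g₀ j) := fun j => (measurable_avgInt α _).ennreal_toReal
  have hgm : ∀ j, Measurable (g j) := by
    intro j
    by_cases h : j < m
    · rw [hgj j h]; exact hg₀m j
    · simp only [hg, h, if_false]
      exact ((hfm 0).pow_const _ |>.const_mul _).mul (hg₀m 0)
  refine ⟨f, g, ⟨hfm, hgm, hfpos, ?_, hdf', ?_, ?_, hftop, ?_, ?_, ?_, ?_⟩, fun r hr => ?_⟩
  · intro j hj r hr
    rcases hj.lt_or_eq with h | rfl
    · rw [hgj j h]; exact hg₀pos j h r hr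
    · rw [hgtop]
      have h1 := hfpos 0 (by omega) r hr
      have h2 := hg₀pos 0 (by omega) r hr
      have h3 : 0 < q - 1 := by linarith
      positivity
  · intro j hj r hr
    rw [hgj j hj]
    have h1 := hasDerivAt_avgInt (hFm _) (hGfin j hj)
    refine h1.1.hasDerivAt_of_continuousOn ?_ h1.2 hr
    exact (hfcont (j + 1) hj).sub ((continuousOn_const.div continuousOn_id
      fun r hr => ne_of_gt hr).mul h1.1.continuousOn)
  · intro j hj r hr
    rw [hgj j hj, hog j hj r hr]
    refine (halfInv_mono α false (fun s hs => (hof (j + 1) hj s hs).ge) hr.le).antisymm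
      (halfInv_mono α false (fun s hs => (hof (j + 1) hj s hs).le) hr.le)
  · intro r hr
    rw [hgtop, hgj 0 (by omega)]
  · intro j hj
    obtain ⟨C, hC, h⟩ := hFb j hj
    refine ⟨C.toReal, fun r hr => ?_⟩
    have h1 := ENNReal.toReal_mono (ENNReal.mul_ne_top (ENNReal.mul_ne_top hC (by simp))
      (hF0fin r hr)) (h r hr)
    rwa [ENNReal.toReal_mul, ENNReal.toReal_mul, ENNReal.toReal_ofReal (by positivity)] at h1
  · intro j hj r hr
    rw [hgj j hj]
    have h1 := ENNReal.toReal_mono (ENNReal.mul_ne_top (by simp) (hFfin j hj.le r hr))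
      (hGF j hj r hr)
    rwa [ENNReal.toReal_mul, ENNReal.toReal_ofReal (div_nonneg (by linarith) hr.le)] at h1
  · obtain ⟨C, hC, h⟩ := hbound
    refine ⟨C.toReal, fun r hr => ?_⟩
    have h1 := ENNReal.toReal_mono (ENNReal.mul_ne_top hC (by simp)) (h r hr)
    rwa [ENNReal.toReal_mul, ENNReal.toReal_ofReal (by positivity)] at h1
  · rw [hF0 r hr, hof 0 (by omega) r hr]

/-! ### The linearized equation in the first angular sector -/

lemma ofReal_integral_le_lintegral {μ : Measure ℝ} {φ : ℝ → ℝ} (h : Integrable φ μ) :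
    ENNReal.ofReal (∫ r, φ r ∂μ) ≤ ∫⁻ r, ENNReal.ofReal (φ r) ∂μ := by
  rw [integral_eq_lintegral_pos_part_sub_lintegral_neg_part h]
  exact (ENNReal.ofReal_le_ofReal (sub_le_self _ ENNReal.toReal_nonneg)).trans
    ENNReal.ofReal_toReal_le

lemma ofReal_le_tailInt {κ φ : ℝ → ℝ} (hφ : ContinuousOn φ (Ioi 0))
    (hκ : ∀ r, 0 < r → HasDerivAt κ (-φ r) r) (h0 : Tendsto κ atTop (𝓝 0)) {r : ℝ} (hr : 0 < r) :
    ENNReal.ofReal (κ r) ≤ tailInt (fun s => ENNReal.ofReal (φ s)) r := by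
  have ht : Tendsto (fun R => ENNReal.ofReal (κ r - κ R)) atTop (𝓝 (ENNReal.ofReal (κ r))) := by
    have := (ENNReal.continuous_ofReal.tendsto _).comp (h0.const_sub (κ r))
    rwa [sub_zero] at this
  refine le_of_tendsto ht ?_
  filter_upwards [eventually_ge_atTop r] with R hR
  have hsub : uIcc r R ⊆ Ioi 0 := by
    rw [uIcc_of_le hR]; exact fun s hs => hr.trans_le hs.1
  have hint : IntervalIntegrable φ volume r R := (hφ.mono hsub).intervalIntegrable
  have h1 : ∫ s in r..R, -φ s = κ R - κ r :=
    intervalIntegral.integral_eq_sub_of_hasDerivAt (fun s hs => hκ s (hsub hs)) hint.neg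
  rw [intervalIntegral.integral_neg] at h1
  rw [show κ r - κ R = ∫ s in r..R, φ s by linarith, intervalIntegral.integral_of_le hR]
  exact (ofReal_integral_le_lintegral hint.1).trans (lintegral_mono_set Ioc_subset_Ioi_self)

lemma ofReal_le_avgInt {α : ℝ} {φ κ : ℝ → ℝ} (hκ : ContinuousOn κ (Ioi 0))
    (hφ : ∀ r, 0 < r → HasDerivAt φ (κ r - α / r * φ r) r)
    (h0 : Tendsto (fun r => r ^ α * φ r) (𝓝[>] 0) (𝓝 0)) {r : ℝ} (hr : 0 < r) :
    ENNReal.ofReal (φ r) ≤ avgInt α (fun s => ENNReal.ofReal (κ s)) r := by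
  have hd : ∀ s, 0 < s → HasDerivAt (fun s => s ^ α * φ s) (s ^ α * κ s) s := by
    intro s hs
    refine ((Real.hasDerivAt_rpow_const (p := α) (Or.inl hs.ne')).fun_mul (hφ s hs)).congr_deriv ?_
    rw [Real.rpow_sub_one hs.ne']
    field_simp
    ring
  have h1 : ENNReal.ofReal (r ^ α * φ r) ≤
      ∫⁻ s in Ioo 0 r, ENNReal.ofReal (s ^ α) * ENNReal.ofReal (κ s) := by
    have ht : Tendsto (fun ε => ENNReal.ofReal (r ^ α * φ r - ε ^ α * φ ε)) (𝓝[>] 0)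
        (𝓝 (ENNReal.ofReal (r ^ α * φ r))) := by
      have := (ENNReal.continuous_ofReal.tendsto _).comp (h0.const_sub (r ^ α * φ r))
      rwa [sub_zero] at this
    refine le_of_tendsto ht ?_
    filter_upwards [Ioo_mem_nhdsGT hr] with ε hε
    have hsub : uIcc ε r ⊆ Ioi 0 := by
      rw [uIcc_of_le hε.2.le]; exact fun s hs => hε.1.trans_le hs.1
    have hint : IntervalIntegrable (fun s => s ^ α * κ s) volume ε r :=
      (((locallyAC_rpow α).continuousOn.mul hκ).mono hsub).intervalIntegrable
    have h2 := intervalIntegral.integral_eq_sub_of_hasDerivAt (fun s hs => hd s (hsub hs)) hint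
    rw [← h2, intervalIntegral.integral_of_le hε.2.le, integral_Ioc_eq_integral_Ioo]
    refine (ofReal_integral_le_lintegral (hint.1.mono_set Ioo_subset_Ioc_self)).trans ?_
    refine le_trans (le_of_eq ?_) (lintegral_mono_set (Ioo_subset_Ioo_left hε.1.le))
    refine setLIntegral_congr_fun measurableSet_Ioo fun s hs => ?_
    rw [ENNReal.ofReal_mul (Real.rpow_nonneg (hε.1.trans hs.1).le _)]
  calc ENNReal.ofReal (φ r) = ENNReal.ofReal (r ^ (-α)) * ENNReal.ofReal (r ^ α * φ r) := by
        rw [← ENNReal.ofReal_mul (by positivity), ← mul_assoc, ← Real.rpow_add hr]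
        simp
    _ ≤ _ := by rw [avgInt]; gcongr

lemma tailInt_le_ofReal {f g : ℝ → ℝ} (hg : ∀ r, 0 < r → 0 ≤ g r)
    (hf : ∀ r, 0 < r → HasDerivAt f (-g r) r) (h0 : Tendsto f atTop (𝓝 0)) {r : ℝ} (hr : 0 < r) :
    tailInt (fun s => ENNReal.ofReal (g s)) r ≤ ENNReal.ofReal (f r) := by
  have hd : ∀ s ∈ Ici r, HasDerivAt (fun s => -f s) (g s) s := fun s hs => by
    simpa using (hf s (hr.trans_le hs)).fun_neg
  have hp : ∀ s ∈ Ioi r, 0 ≤ g s := fun s hs => hg s (hr.trans hs)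
  have ht : Tendsto (fun s => -f s) atTop (𝓝 0) := by simpa using h0.neg
  have h1 := integrableOn_Ioi_deriv_of_nonneg' hd hp ht
  have h2 := integral_Ioi_of_hasDerivAt_of_nonneg' hd hp ht
  rw [tailInt, ← ofReal_integral_eq_lintegral_ofReal h1
    ((ae_restrict_iff' measurableSet_Ioi).2 (Eventually.of_forall hp)), h2]
  simp

/-- The operator of the equation in the first angular sector improves positivity. -/
lemma wordInv_altWord_false_ne_zero {α : ℝ} {g : ℝ → ℝ≥0∞} (hgm : Measurable g)
    (hg : ∫⁻ r in Ioi (0 : ℝ), g r ≠ 0) (k : ℕ) {r : ℝ} (hr : 0 < r) :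
    wordInv α (altWord false (2 * (k + 1))) g r ≠ 0 := by
  induction k generalizing r with
  | zero =>
    obtain ⟨ε, hε, h⟩ := exists_tailInt_ne_zero hg
    exact avgInt_ne_zero (measurable_tailInt g) hε h hr
  | succ k ih =>
    have : altWord false (2 * (k + 1 + 1)) = false :: true :: altWord false (2 * (k + 1)) := rfl
    rw [this]
    refine avgInt_ne_zero (measurable_tailInt _) one_pos (fun s hs _ => ?_) hr
    exact tailInt_ne_zero (measurable_wordInv α _ hgm) (R := 0) (fun t ht => ih ht) s

lemma altWord_false_succ (j : ℕ) :
    altWord false (2 * (j + 1)) = altWord false (2 * j) ++ [false, true] := by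
  have h : Bool.not^[2 * j] false = false := by
    have := not_iterate_not_iterate false j
    rwa [← Function.iterate_add_apply, ← two_mul] at this
  rw [show 2 * (j + 1) = 2 * j + 2 by ring, altWord_add, h]
  rfl

namespace IsRadialChain

/-- The functions `(-Δ_1)^j h`, where `h = -(r² f' + (α + 1 - 2m) r f)` comes from the inversion of
the translations, and `Δ_1 = Δ_α - α / r²` is the operator in the first angular sector. For `j = 0`, where `g (j - 1)` has no
meaning, its coefficient vanishes. -/
def confH (α : ℝ) (m : ℕ) (f g : ℕ → ℝ → ℝ) (j : ℕ) (r : ℝ) : ℝ :=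
  r ^ 2 * g j r - (α + 1 - 2 * m + 4 * j) * (r * f j r) + 4 * j * (m - j) * g (j - 1) r

/-- The function `r^{-α} (r^α confH)'`. -/
def confK (α : ℝ) (m : ℕ) (f g : ℕ → ℝ → ℝ) (j : ℕ) (r : ℝ) : ℝ :=
  2 * (r * g j r) + r ^ 2 * f (j + 1) r -
    (α + 1 - 2 * m + 4 * j) * ((1 + α) * f j r - r * g j r) + 4 * j * (m - j) * f j r

variable {α q c : ℝ} {m : ℕ} {f g : ℕ → ℝ → ℝ}

lemma hasDerivAt_confH (hc : IsRadialChain α m q c f g) {j : ℕ} (hj : j < m) {r : ℝ} (hr : 0 < r) :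
    HasDerivAt (confH α m f g j) (confK α m f g j r - α / r * confH α m f g j r) r := by
  have hf := hc.hasDerivAt_f j hj.le r hr
  have hg := hc.hasDerivAt_g j hj r hr
  have hg' : HasDerivAt (fun r => (4 * j * (m - j) : ℝ) * g (j - 1) r)
      ((4 * j * (m - j) : ℝ) * (f j r - α / r * g (j - 1) r)) r := by
    rcases Nat.eq_zero_or_pos j with rfl | hj0
    · simpa using hasDerivAt_const r (0 : ℝ)
    · have := hc.hasDerivAt_g (j - 1) (by omega) r hr
      rw [show j - 1 + 1 = j by omega] at this
      exact this.const_mul _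
  have h1 := (((hasDerivAt_pow 2 r).fun_mul hg).fun_sub
    (((hasDerivAt_id r).fun_mul hf).const_mul (α + 1 - 2 * m + 4 * j))).fun_add hg'
  refine h1.congr_deriv ?_
  simp only [confK, confH, id]
  field_simp
  push_cast
  ring

lemma hasDerivAt_confK (hc : IsRadialChain α m q c f g) {j : ℕ} (hj : j < m) {r : ℝ} (hr : 0 < r) :
    HasDerivAt (confK α m f g j) (-confH α m f g (j + 1) r) r := by
  have hf := hc.hasDerivAt_f j hj.le r hr
  have hf' := hc.hasDerivAt_f (j + 1) hj r hr
  have hg := hc.hasDerivAt_g j hj r hr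
  have hrg := (hasDerivAt_id r).fun_mul hg
  have h1 := (((hrg.const_mul 2).fun_add ((hasDerivAt_pow 2 r).fun_mul hf')).fun_sub
    (((hf.const_mul (1 + α)).fun_sub hrg).const_mul (α + 1 - 2 * m + 4 * j))).fun_add
    (hf.const_mul (4 * j * (m - j) : ℝ))
  refine h1.congr_deriv ?_
  simp only [confH, id, Nat.add_sub_cancel]
  field_simp
  push_cast
  ring

lemma confH_top (hc : IsRadialChain α m q c f g) (hα : 0 < α - 2 * m + 1)
    (hq : q = 2 * (α + 1) / (α - 2 * m + 1)) {r : ℝ} (hr : 0 < r) :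
    confH α m f g m r = (q - 1) * c * f 0 r ^ (q - 2) * confH α m f g 0 r := by
  have h0 := hc.f_pos 0 (by omega) r hr
  have h1 : f 0 r ^ (q - 1) = f 0 r ^ (q - 2) * f 0 r := by
    rw [show q - 1 = (q - 2) + 1 by ring, Real.rpow_add_one h0.ne']
  have h2 : α + 1 - 2 * (m : ℝ) + 4 * m = (q - 1) * (α + 1 - 2 * m) := by
    rw [hq]
    field_simp
    ring
  simp only [confH, hc.top_f r hr, hc.top_g r hr, h1, h2]
  push_cast
  ring

lemma exists_f_le (hc : IsRadialChain α m q c f g) {j : ℕ} (hj : j ≤ m) :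
    ∃ C : ℝ, ∀ r, 0 < r → |f j r| ≤ C * r ^ (-(2 * j + (α - 2 * m + 1) / 2)) := by
  obtain ⟨C, hC⟩ := hc.f_le j hj
  obtain ⟨C', hC'⟩ := hc.zero_le
  refine ⟨|C| * C', fun r hr => ?_⟩
  rw [abs_of_pos (hc.f_pos j hj r hr)]
  have h0 := hc.f_pos 0 (by omega) r hr
  calc f j r ≤ C * r ^ (-(2 * j : ℝ)) * f 0 r := hC r hr
    _ ≤ |C| * r ^ (-(2 * j : ℝ)) * f 0 r := by gcongr; exact le_abs_self C
    _ ≤ |C| * r ^ (-(2 * j : ℝ)) * (C' * r ^ (-((α - 2 * m + 1) / 2))) := by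
        gcongr; exact hC' r hr
    _ = _ := by
        rw [neg_add, Real.rpow_add hr]
        ring

lemma exists_g_le (hc : IsRadialChain α m q c f g) (hα : 1 < α) {j : ℕ} (hj : j < m) :
    ∃ C : ℝ, ∀ r, 0 < r → |g j r| ≤ C * r ^ (-(2 * j + 1 + (α - 2 * m + 1) / 2)) := by
  obtain ⟨C, hC⟩ := hc.exists_f_le hj.le
  refine ⟨(α - 1) * C, fun r hr => ?_⟩
  rw [abs_of_pos (hc.g_pos j hj.le r hr)]
  calc g j r ≤ (α - 1) / r * f j r := hc.g_le j hj r hr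
    _ ≤ (α - 1) / r * (C * r ^ (-(2 * j + (α - 2 * m + 1) / 2))) := by
        have : 0 ≤ (α - 1) / r := div_nonneg (by linarith) hr.le
        gcongr
        exact (le_abs_self _).trans (hC r hr)
    _ = _ := by
        rw [show -(2 * (j : ℝ) + 1 + (α - 2 * m + 1) / 2) =
          -(2 * j + (α - 2 * m + 1) / 2) - 1 by ring, Real.rpow_sub_one hr.ne']
        ring

end IsRadialChain

lemma tendsto_rpow_mul_atTop_zero {p p' C : ℝ} (hp : p + p' < 0) {f : ℝ → ℝ}
    (hf : ∀ r, 0 < r → |f r| ≤ C * r ^ p') :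
    Tendsto (fun r => r ^ p * f r) atTop (𝓝 0) := by
  refine squeeze_zero_norm' (a := fun r => C * r ^ (-(-(p + p')))) ?_ ?_
  · filter_upwards [eventually_gt_atTop 0] with r hr
    rw [Real.norm_eq_abs, abs_mul, abs_of_pos (Real.rpow_pos_of_pos hr _), neg_neg,
      Real.rpow_add hr]
    calc _ ≤ r ^ p * (C * r ^ p') := by gcongr; exact hf r hr
      _ = _ := by ring
  · simpa using (tendsto_rpow_neg_atTop (y := -(p + p')) (by linarith)).const_mul C

namespace IsRadialChain

variable {α q c : ℝ} {m : ℕ} {f g : ℕ → ℝ → ℝ}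

lemma tendsto_f_atTop (hc : IsRadialChain α m q c f g) {j : ℕ} (hj : j ≤ m) {p : ℝ}
    (hp : p < 2 * j + (α - 2 * m + 1) / 2) : Tendsto (fun r => r ^ p * f j r) atTop (𝓝 0) := by
  obtain ⟨C, hC⟩ := hc.exists_f_le hj
  exact tendsto_rpow_mul_atTop_zero (by linarith) hC

lemma tendsto_g_atTop (hc : IsRadialChain α m q c f g) (hα : 1 < α) {j : ℕ} (hj : j < m) {p : ℝ}
    (hp : p < 2 * j + 1 + (α - 2 * m + 1) / 2) :
    Tendsto (fun r => r ^ p * g j r) atTop (𝓝 0) := by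
  obtain ⟨C, hC⟩ := hc.exists_g_le hα hj
  exact tendsto_rpow_mul_atTop_zero (by linarith) hC

lemma tendsto_f_zero (hc : IsRadialChain α m q c f g) {j : ℕ} (hj : j ≤ m) {p : ℝ}
    (hp : 2 * j + (α - 2 * m + 1) / 2 < p) : Tendsto (fun r => r ^ p * f j r) (𝓝[>] 0) (𝓝 0) := by
  obtain ⟨C, hC⟩ := hc.exists_f_le hj
  exact tendsto_rpow_mul_nhdsGT_zero (by linarith) hC

lemma tendsto_g_zero (hc : IsRadialChain α m q c f g) (hα : 1 < α) {j : ℕ} (hj : j < m) {p : ℝ}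
    (hp : 2 * j + 1 + (α - 2 * m + 1) / 2 < p) :
    Tendsto (fun r => r ^ p * g j r) (𝓝[>] 0) (𝓝 0) := by
  obtain ⟨C, hC⟩ := hc.exists_g_le hα hj
  exact tendsto_rpow_mul_nhdsGT_zero (by linarith) hC

lemma tendsto_confK_atTop (hc : IsRadialChain α m q c f g) (hα : 0 < α - 2 * m + 1) (hα1 : 1 < α)
    {j : ℕ} (hj : j < m) : Tendsto (fun r => confK α m f g j r) atTop (𝓝 0) := by
  have hj0 : (0 : ℝ) ≤ j := by positivity
  have h1 := hc.tendsto_g_atTop hα1 hj (p := 1) (by linarith)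
  have h2 := hc.tendsto_f_atTop (j := j + 1) hj (p := 2) (by push_cast; linarith)
  have h3 := hc.tendsto_f_atTop hj.le (p := 0) (by linarith)
  simp only [Real.rpow_one, Real.rpow_two, Real.rpow_zero, one_mul] at h1 h2 h3
  have := (((h1.const_mul 2).add h2).sub (((h3.const_mul (1 + α)).sub h1).const_mul
    (α + 1 - 2 * m + 4 * j))).add (h3.const_mul (4 * j * (m - j) : ℝ))
  simpa [confK] using this

lemma tendsto_confH_zero (hc : IsRadialChain α m q c f g) (hα : 0 < α - 2 * m + 1) (hα1 : 1 < α)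
    {j : ℕ} (hj : j < m) : Tendsto (fun r => r ^ α * confH α m f g j r) (𝓝[>] 0) (𝓝 0) := by
  have hj1 : (j : ℝ) + 1 ≤ m := by exact_mod_cast hj
  have h1 := hc.tendsto_g_zero hα1 hj (p := α + 2) (by linarith)
  have h2 := hc.tendsto_f_zero hj.le (p := α + 1) (by linarith)
  have h3 : Tendsto (fun r => (4 * j * (m - j) : ℝ) * (r ^ α * g (j - 1) r)) (𝓝[>] 0) (𝓝 0) := by
    rcases Nat.eq_zero_or_pos j with rfl | hj0
    · simp
    · have h4 : ((j - 1 : ℕ) : ℝ) = j - 1 := by push_cast [hj0]; ring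
      have := hc.tendsto_g_zero hα1 (j := j - 1) (by omega) (p := α) (by rw [h4]; linarith)
      simpa using this.const_mul (4 * j * (m - j) : ℝ)
  have h := (h1.sub (h2.const_mul (α + 1 - 2 * m + 4 * j))).add h3
  simp only [mul_zero, sub_zero, add_zero] at h
  refine h.congr' ?_
  filter_upwards [self_mem_nhdsWithin] with r hr
  have hr : 0 < r := hr
  rw [confH, Real.rpow_add hr, Real.rpow_add hr, Real.rpow_one, Real.rpow_two]
  ring

lemma avgInt_tailInt_le (hc : IsRadialChain α m q c f g) (hα : 0 < α - 2 * m + 1) {j : ℕ}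
    (hj : j < m) {r : ℝ} (hr : 0 < r) :
    avgInt α (tailInt fun s => ENNReal.ofReal (g (j + 1) s)) r ≤ ENNReal.ofReal (g j r) := by
  rw [hc.g_eq j hj r hr]
  refine halfInv_mono α false (fun s hs => ?_) hr.le
  refine tailInt_le_ofReal (fun t ht => (hc.g_pos (j + 1) hj t ht).le)
    (hc.hasDerivAt_f (j + 1) hj) ?_ hs
  simpa using hc.tendsto_f_atTop (j := j + 1) hj (p := 0) (by push_cast; linarith)

/-- `-f'` is a supersolution of the linearized equation in the first angular sector. -/
lemma wordInv_g_le (hc : IsRadialChain α m q c f g) (hα : 0 < α - 2 * m + 1) {j : ℕ} (hj : j ≤ m)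
    {r : ℝ} (hr : 0 < r) :
    wordInv α (altWord false (2 * j)) (fun s => ENNReal.ofReal (g j s)) r ≤
      ENNReal.ofReal (g 0 r) := by
  induction j with
  | zero => exact le_rfl
  | succ j ih =>
    refine le_trans ?_ (ih (by omega))
    rw [altWord_false_succ, wordInv_append]
    exact wordInv_mono α _ (fun s hs => hc.avgInt_tailInt_le hα hj hs) hr

/-- The positive part of `± h - l (-f')` is a subsolution of the linearized equation in the first
angular sector. -/
lemma ofReal_le_wordInv (hc : IsRadialChain α m q c f g) (hm : 1 ≤ m) (hα : 0 < α - 2 * m + 1) (hα1 : 1 < α)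
    (s l : ℝ) {j : ℕ} (hj : j ≤ m) {r : ℝ} (hr : 0 < r) :
    ENNReal.ofReal (s * confH α m f g 0 r - l * g 0 r) ≤ wordInv α (altWord false (2 * j))
      (fun t => ENNReal.ofReal (s * confH α m f g j t - l * g j t)) r := by
  have hcontf : ∀ j ≤ m, ContinuousOn (f j) (Ioi 0) := fun j hj r hr =>
    (hc.hasDerivAt_f j hj r hr).continuousAt.continuousWithinAt
  have hcontg : ∀ j < m, ContinuousOn (g j) (Ioi 0) := fun j hj r hr =>
    (hc.hasDerivAt_g j hj r hr).continuousAt.continuousWithinAt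
  have hcontgm : ∀ j ≤ m, ContinuousOn (g j) (Ioi 0) := by
    intro j hj
    rcases hj.lt_or_eq with h | rfl
    · exact hcontg j h
    · have h0 : ContinuousOn (fun r => (q - 1) * c * f 0 r ^ (q - 2) * g 0 r) (Ioi 0) :=
        (continuousOn_const.mul ((hcontf 0 (by omega)).rpow_const fun r hr =>
          Or.inl (hc.f_pos 0 (by omega) r hr).ne')).mul (hcontg 0 (by omega))
      exact h0.congr fun r hr => hc.top_g r hr
  have hcontH : ∀ j ≤ m, ContinuousOn (confH α m f g j) (Ioi 0) := fun j hj =>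
    (((continuousOn_id.pow 2).mul (hcontgm j hj)).sub (continuousOn_const.mul
      (continuousOn_id.mul (hcontf j hj)))).add (continuousOn_const.mul (hcontgm (j - 1) (by omega)))
  induction j with
  | zero => exact le_rfl
  | succ j ih =>
    refine (ih (by omega)).trans ?_
    rw [altWord_false_succ, wordInv_append]
    refine wordInv_mono α _ (fun t ht => ?_) hr
    have hj' : j < m := hj
    have hK : ∀ t, 0 < t → HasDerivAt (fun t => s * confK α m f g j t - l * f (j + 1) t)
        (-(s * confH α m f g (j + 1) t - l * g (j + 1) t)) t := fun t ht =>
      (((hc.hasDerivAt_confK hj' ht).const_mul s).fun_sub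
        ((hc.hasDerivAt_f (j + 1) hj t ht).const_mul l)).congr_deriv (by ring)
    have hH : ∀ t, 0 < t → HasDerivAt (fun t => s * confH α m f g j t - l * g j t)
        ((s * confK α m f g j t - l * f (j + 1) t) -
          α / t * (s * confH α m f g j t - l * g j t)) t := fun t ht =>
      (((hc.hasDerivAt_confH hj' ht).const_mul s).fun_sub
        ((hc.hasDerivAt_g j hj' t ht).const_mul l)).congr_deriv (by ring)
    have hj1 : (j : ℝ) + 1 ≤ m := by exact_mod_cast hj
    have hH0 : Tendsto (fun t => t ^ α * (s * confH α m f g j t - l * g j t)) (𝓝[>] 0) (𝓝 0) := by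
      have h1 := ((hc.tendsto_confH_zero hα hα1 hj').const_mul s).sub
        ((hc.tendsto_g_zero hα1 hj' (p := α) (by linarith)).const_mul l)
      simp only [mul_zero, sub_zero] at h1
      exact h1.congr fun t => by ring
    refine (ofReal_le_avgInt (fun t ht => (hK t ht).continuousAt.continuousWithinAt) hH hH0
      ht).trans ?_
    refine halfInv_mono α false (fun t ht => ?_) ht.le
    refine ofReal_le_tailInt ?_ hK ?_ ht
    · exact (continuousOn_const.mul (hcontH (j + 1) hj)).sub
        (continuousOn_const.mul (hcontgm (j + 1) hj))
    · have h1 := hc.tendsto_f_atTop (j := j + 1) hj (p := 0) (by push_cast; linarith)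
      simp only [Real.rpow_zero, one_mul] at h1
      simpa using ((hc.tendsto_confK_atTop hα hα1 hj').const_mul s).sub (h1.const_mul l)

end IsRadialChain

/-! ### Classification of the solutions -/

namespace IsRadialChain

variable {α q c : ℝ} {m : ℕ} {f g : ℕ → ℝ → ℝ}

lemma c_pos (hc : IsRadialChain α m q c f g) : 0 < c := by
  have h := hc.f_pos m le_rfl 1 one_pos
  rw [hc.top_f 1 one_pos] at h
  exact pos_of_mul_pos_left h (Real.rpow_nonneg (hc.f_pos 0 (by omega) 1 one_pos).le _)

lemma measurable_confH (hc : IsRadialChain α m q c f g) (j : ℕ) : Measurable (confH α m f g j) := by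
  have h1 := hc.measurable_f j
  have h2 := hc.measurable_g j
  have h3 := hc.measurable_g (j - 1)
  unfold confH
  fun_prop

lemma confH_zero (α : ℝ) (m : ℕ) (f g : ℕ → ℝ → ℝ) (r : ℝ) :
    confH α m f g 0 r = r ^ 2 * g 0 r - (α - 2 * m + 1) * (r * f 0 r) := by
  simp only [confH]
  push_cast
  ring

lemma continuousOn_confH_zero (hc : IsRadialChain α m q c f g) (hm : 1 ≤ m) :
    ContinuousOn (confH α m f g 0) (Ioi 0) := fun _ hr =>
  (hc.hasDerivAt_confH hm hr).continuousAt.continuousWithinAt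

lemma continuousOn_g_zero (hc : IsRadialChain α m q c f g) (hm : 1 ≤ m) :
    ContinuousOn (g 0) (Ioi 0) := fun r hr =>
  (hc.hasDerivAt_g 0 hm r hr).continuousAt.continuousWithinAt

/-- The energy of the linearized equation is controlled by that of the solution. -/
lemma exists_mul_le (hc : IsRadialChain α m q c f g) (hm : 1 ≤ m) (hα : 0 < α - 2 * m + 1)
    (hα1 : 1 < α) (hq1 : 1 < q) (s : ℝ) {l : ℝ} (hl : 0 ≤ l) : ∃ C : ℝ, ∀ r, 0 < r →
      g m r * (s * confH α m f g 0 r - l * g 0 r) ≤ C * f 0 r ^ q := by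
  have hc0 := hc.c_pos
  refine ⟨(q - 1) * c * (α - 1) * (|s| * ((α - 1) + (α - 2 * m + 1))), fun r hr => ?_⟩
  have hf := hc.f_pos 0 (by omega) r hr
  have hg := hc.g_pos 0 (by omega) r hr
  have hgm := hc.g_pos m le_rfl r hr
  have hgf := hc.g_le 0 hm r hr
  have hg1 : r * g 0 r ≤ (α - 1) * f 0 r := by
    rw [div_mul_eq_mul_div, le_div_iff₀ hr] at hgf
    linarith
  have h1 : |confH α m f g 0 r| ≤ r * (((α - 1) + (α - 2 * m + 1)) * f 0 r) := by
    rw [confH_zero, abs_le]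
    have h2 : r * (r * g 0 r) ≤ r * ((α - 1) * f 0 r) := by gcongr
    have h3 : 0 ≤ r ^ 2 * g 0 r := by positivity
    have h4 : 0 ≤ (α - 2 * m + 1) * (r * f 0 r) := by positivity
    have h5 : 0 ≤ r * ((α - 1) * f 0 r) :=
      mul_nonneg hr.le (mul_nonneg (by linarith) hf.le)
    constructor <;> nlinarith
  have h2 : s * confH α m f g 0 r - l * g 0 r ≤
      |s| * (r * (((α - 1) + (α - 2 * m + 1)) * f 0 r)) := by
    calc _ ≤ s * confH α m f g 0 r := sub_le_self _ (by positivity)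
      _ ≤ |s| * |confH α m f g 0 r| := by rw [← abs_mul]; exact le_abs_self _
      _ ≤ _ := by gcongr
  have hq1' : 0 < q - 1 := by linarith
  have hα' : 0 < α - 1 := by linarith
  calc _ ≤ g m r * (|s| * (r * (((α - 1) + (α - 2 * m + 1)) * f 0 r))) := by gcongr
    _ = (q - 1) * c * f 0 r ^ (q - 2) * (r * g 0 r) *
        (|s| * (((α - 1) + (α - 2 * m + 1)) * f 0 r)) := by rw [hc.top_g r hr]; ring
    _ ≤ (q - 1) * c * f 0 r ^ (q - 2) * ((α - 1) * f 0 r) *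
        (|s| * (((α - 1) + (α - 2 * m + 1)) * f 0 r)) := by
        have : 0 ≤ |s| * (((α - 1) + (α - 2 * m + 1)) * f 0 r) := by positivity
        gcongr
    _ = _ := by
        rw [show f 0 r ^ q = f 0 r ^ (q - 2) * f 0 r ^ 2 by
          rw [← Real.rpow_two, ← Real.rpow_add hf]; ring_nf]
        ring

/-- Strong maximum principle: a combination `± h - l (-f')` that is positive somewhere is nowhere
negative. Its positive part `p` satisfies `p ≤ T (w p)`, where `T` inverts the operator in the first
angular sector, and testing with the positive supersolution `-f'` gives equality. -/
lemma nonneg_of_pos (hc : IsRadialChain α m q c f g) (hm : 1 ≤ m) (hα : 0 < α - 2 * m + 1)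
    (hα1 : 1 < α) (hq : q = 2 * (α + 1) / (α - 2 * m + 1)) (hq1 : 1 < q)
    (hN : ∫⁻ r, ENNReal.ofReal (f 0 r) ^ q ∂radialMeasure α ≠ ∞) (s : ℝ) {l : ℝ} (hl : 0 ≤ l)
    {r₁ r₂ : ℝ} (hr₁ : 0 < r₁) (hr₂ : 0 < r₂)
    (h₁ : 0 < s * confH α m f g 0 r₁ - l * g 0 r₁) :
    0 ≤ s * confH α m f g 0 r₂ - l * g 0 r₂ := by
  set φ : ℕ → ℝ → ℝ := fun j r => s * confH α m f g j r - l * g j r with hφ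
  have hφm : ∀ j, Measurable (φ j) := fun j =>
    ((hc.measurable_confH j).const_mul s).sub ((hc.measurable_g j).const_mul l)
  set P : ℕ → ℝ → ℝ≥0∞ := fun j r => ENNReal.ofReal (φ j r) with hP
  have hPm : ∀ j, Measurable (P j) := fun j => (hφm j).ennreal_ofReal
  set G : ℕ → ℝ → ℝ≥0∞ := fun j r => ENNReal.ofReal (g j r) with hG
  have hGm : ∀ j, Measurable (G j) := fun j => (hc.measurable_g j).ennreal_ofReal
  set T := wordInv α (altWord false (2 * m)) (P m) with hT
  have hTm : Measurable T := measurable_wordInv α _ (hPm m)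
  have hc0 := hc.c_pos
  have hW : ∀ r, 0 < r → 0 < (q - 1) * c * f 0 r ^ (q - 2) := fun r hr =>
    mul_pos (mul_pos (by linarith) hc0) (Real.rpow_pos_of_pos (hc.f_pos 0 (by omega) r hr) _)
  have htop : ∀ r, 0 < r → φ m r = (q - 1) * c * f 0 r ^ (q - 2) * φ 0 r := fun r hr => by
    simp only [hφ, hc.confH_top hα hq hr, hc.top_g r hr]
    ring
  have hcont : ContinuousOn (φ 0) (Ioi 0) :=
    (continuousOn_const.mul (hc.continuousOn_confH_zero hm)).sub
      (continuousOn_const.mul (hc.continuousOn_g_zero hm))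
  have hle : ∀ r, 0 < r → P 0 r ≤ T r := fun r hr => hc.ofReal_le_wordInv hm hα hα1 s l le_rfl hr
  have hGP : ∫⁻ r, G 0 r * P m r ∂radialMeasure α = ∫⁻ r, G m r * P 0 r ∂radialMeasure α := by
    refine lintegral_congr_ae (ae_radialMeasure_of_forall α fun r hr => ?_)
    simp only [hP, hG]
    rw [htop r hr, hc.top_g r hr, ENNReal.ofReal_mul (hW r hr).le, ENNReal.ofReal_mul (hW r hr).le]
    ring
  have hadj : ∫⁻ r, G m r * T r ∂radialMeasure α ≤ ∫⁻ r, G m r * P 0 r ∂radialMeasure α := by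
    have h := lintegral_altWord_mul α false (2 * m) (hGm m) (hPm m)
    have hb : Bool.not^[2 * m] false = false := by
      have := not_iterate_not_iterate false m
      rwa [← Function.iterate_add_apply, ← two_mul] at this
    rw [hb] at h
    rw [← h, ← hGP]
    refine lintegral_mono_ae (ae_radialMeasure_of_forall α fun r hr => ?_)
    exact mul_le_mul_left (hc.wordInv_g_le hα le_rfl hr) _
  have hfin : ∫⁻ r, G m r * P 0 r ∂radialMeasure α ≠ ∞ := by
    obtain ⟨C, hC⟩ := hc.exists_mul_le hm hα hα1 hq1 s hl
    refine ne_top_of_le_ne_top (b := ∫⁻ r, ENNReal.ofReal |C| *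
      ENNReal.ofReal (f 0 r) ^ q ∂radialMeasure α) ?_ ?_
    · rw [lintegral_const_mul' _ _ (by simp)]
      exact ENNReal.mul_ne_top (by simp) hN
    · refine lintegral_mono_ae (ae_radialMeasure_of_forall α fun r hr => ?_)
      have hf := hc.f_pos 0 (by omega) r hr
      simp only [hP, hG]
      rw [← ENNReal.ofReal_mul (hc.g_pos m le_rfl r hr).le, ENNReal.ofReal_rpow_of_pos hf,
        ← ENNReal.ofReal_mul (abs_nonneg C)]
      refine ENNReal.ofReal_le_ofReal ((hC r hr).trans ?_)
      gcongr
      exact le_abs_self C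
  have hae := ae_eq_of_ae_le_of_lintegral_le (μ := radialMeasure α)
    (f := fun r => G m r * P 0 r) (g := fun r => G m r * T r)
    (ae_radialMeasure_of_forall α fun r hr => mul_le_mul_right (hle r hr) _) hfin
    ((hGm m).mul hTm).aemeasurable hadj
  have hPm0 : ∫⁻ r in Ioi (0 : ℝ), P m r ≠ 0 := by
    rw [← pos_iff_ne_zero, setLIntegral_pos_iff (hPm m)]
    have hopen : IsOpen (Ioi 0 ∩ φ 0 ⁻¹' Ioi 0) := hcont.isOpen_inter_preimage isOpen_Ioi isOpen_Ioi
    refine (hopen.measure_pos volume ⟨r₁, hr₁, h₁⟩).trans_le (measure_mono fun r hr => ⟨?_, hr.1⟩)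
    have h2 : 0 < φ m r := by rw [htop r hr.1]; exact mul_pos (hW r hr.1) hr.2
    simpa [hP] using h2
  have hT0 : ∀ r, 0 < r → T r ≠ 0 := fun r hr => by
    have := wordInv_altWord_false_ne_zero (α := α) (hPm m) hPm0 (m - 1) hr
    rwa [show m - 1 + 1 = m by omega] at this
  by_contra! hneg
  have hopen : IsOpen (Ioi 0 ∩ φ 0 ⁻¹' Iio 0) := hcont.isOpen_inter_preimage isOpen_Ioi isOpen_Iio
  have hpos := hopen.measure_pos volume ⟨r₂, hr₂, hneg⟩
  refine hpos.ne' (measure_mono_null (t := {r | ¬ (r ∈ Ioi (0 : ℝ) →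
    G m r * P 0 r = G m r * T r)}) (fun r hr => ?_)
    (ae_iff.1 ((ae_restrict_iff' measurableSet_Ioi).1 ((ae_radialMeasure_iff α).1 hae))))
  simp only [mem_ofPred_eq, not_forall]
  refine ⟨hr.1, fun h => ?_⟩
  have h0 : P 0 r = 0 := ENNReal.ofReal_of_nonpos (le_of_lt hr.2)
  rw [h0, mul_zero, eq_comm, mul_eq_zero] at h
  rcases h with h | h
  · exact absurd (ENNReal.ofReal_eq_zero.1 h) (not_le.2 (hc.g_pos m le_rfl r hr.1))
  · exact hT0 r hr.1 h

/-- The function coming from the inversion of the translations is a multiple of `-f'`. -/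
lemma exists_confH_eq (hc : IsRadialChain α m q c f g) (hm : 1 ≤ m) (hα : 0 < α - 2 * m + 1)
    (hα1 : 1 < α) (hq : q = 2 * (α + 1) / (α - 2 * m + 1)) (hq1 : 1 < q)
    (hN : ∫⁻ r, ENNReal.ofReal (f 0 r) ^ q ∂radialMeasure α ≠ ∞) :
    ∃ κ : ℝ, ∀ r, 0 < r → confH α m f g 0 r = κ * g 0 r := by
  have hg : ∀ r, 0 < r → 0 < g 0 r := hc.g_pos 0 (by omega)
  have key : ∀ r₁ r₂, 0 < r₁ → 0 < r₂ →
      ¬ confH α m f g 0 r₁ / g 0 r₁ < confH α m f g 0 r₂ / g 0 r₂ := by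
    intro r₁ r₂ hr₁ hr₂ h
    -- for `l` between two values of the quotient, `h - l (-f')` would take both signs
    obtain ⟨l, hl1, hl2⟩ := exists_between h
    rw [div_lt_iff₀ (hg r₁ hr₁)] at hl1
    rw [lt_div_iff₀ (hg r₂ hr₂)] at hl2
    rcases le_total 0 l with hl | hl
    · have := hc.nonneg_of_pos hm hα hα1 hq hq1 hN 1 hl hr₂ hr₁ (by linarith)
      linarith
    · have := hc.nonneg_of_pos hm hα hα1 hq hq1 hN (-1) (neg_nonneg.2 hl) hr₁ hr₂ (by linarith)
      linarith
  refine ⟨confH α m f g 0 1 / g 0 1, fun r hr => ?_⟩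
  rw [← le_antisymm (not_lt.1 (key 1 r one_pos hr)) (not_lt.1 (key r 1 hr one_pos)),
    div_mul_cancel₀ _ (hg r hr).ne']

/-- The positive radial solutions of finite energy are the bubbles. -/
lemma exists_eq_bubble (hc : IsRadialChain α m q c f g) (hm : 1 ≤ m) (hα : 0 < α - 2 * m + 1)
    (hα1 : 1 < α) (hq : q = 2 * (α + 1) / (α - 2 * m + 1)) (hq1 : 1 < q)
    (hN : ∫⁻ r, ENNReal.ofReal (f 0 r) ^ q ∂radialMeasure α ≠ ∞) :
    ∃ L C : ℝ, 0 < L ∧ 0 < C ∧ (∀ r, 0 < r → confH α m f g 0 r + L * g 0 r = 0) ∧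
      ∀ r, 0 < r → f 0 r = C * (r ^ 2 + L) ^ (-((α - 2 * m + 1) / 2)) := by
  obtain ⟨κ, hκ⟩ := hc.exists_confH_eq hm hα hα1 hq hq1 hN
  have hg : ∀ r, 0 < r → 0 < g 0 r := hc.g_pos 0 (by omega)
  have hf : ∀ r, 0 < r → 0 < f 0 r := hc.f_pos 0 (by omega)
  set a := α - 2 * m + 1 with ha
  have hode : ∀ r, 0 < r → (r ^ 2 + -κ) * g 0 r = a * (r * f 0 r) := fun r hr => by
    have := hκ r hr
    rw [confH_zero] at this
    linarith
  have hL : 0 ≤ -κ := by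
    by_contra! h
    have h1 := hode (√κ) (Real.sqrt_pos.2 (by linarith))
    have h2 : 0 < √κ := Real.sqrt_pos.2 (by linarith)
    rw [Real.sq_sqrt (by linarith), add_neg_cancel, zero_mul] at h1
    have := mul_pos hα (mul_pos h2 (hf _ h2))
    linarith
  have hpos : ∀ r, 0 < r → 0 < r ^ 2 + -κ := fun r hr => by positivity
  obtain ⟨C, hC⟩ : ∃ C, ∀ r ∈ Ioi (0 : ℝ), f 0 r * (r ^ 2 + -κ) ^ (a / 2) = C := by
    have hd : ∀ r ∈ Ioi (0 : ℝ), HasDerivAt (fun r => f 0 r * (r ^ 2 + -κ) ^ (a / 2)) 0 r := by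
      intro r hr
      have h1 := ((hasDerivAt_pow 2 r).add_const (-κ)).rpow_const (p := a / 2)
        (Or.inl (hpos r hr).ne')
      refine ((hc.hasDerivAt_f 0 (by omega) r hr).fun_mul h1).congr_deriv ?_
      have h2 : (r ^ 2 + -κ) ^ (a / 2) = (r ^ 2 + -κ) * (r ^ 2 + -κ) ^ (a / 2 - 1) := by
        rw [Real.rpow_sub_one (hpos r hr).ne', mul_div_cancel₀ _ (hpos r hr).ne']
      rw [h2]
      have h3 := hode r hr
      push_cast
      linear_combination (-(r ^ 2 + -κ) ^ (a / 2 - 1)) * h3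
    exact isOpen_Ioi.exists_is_const_of_deriv_eq_zero isPreconnected_Ioi
      (fun r hr => (hd r hr).differentiableAt.differentiableWithinAt) fun r hr => (hd r hr).deriv
  have hfC : ∀ r, 0 < r → f 0 r = C * (r ^ 2 + -κ) ^ (-(a / 2)) := fun r hr => by
    rw [← hC r hr, mul_assoc, ← Real.rpow_add (hpos r hr)]
    simp
  have hC0 : 0 < C := by
    rw [← hC 1 (mem_Ioi.2 one_pos)]
    exact mul_pos (hf 1 one_pos) (Real.rpow_pos_of_pos (hpos 1 one_pos) _)
  refine ⟨-κ, C, lt_of_le_of_ne hL fun h => ?_, hC0, fun r hr => by rw [hκ r hr]; ring, hfC⟩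
  -- for `κ = 0` the solution would be `C r^{-a}`, which grows faster than `r^{-a / 2}` at the origin
  obtain ⟨C', hC'⟩ := hc.zero_le
  have hle : ∀ r, 0 < r → C ≤ C' * r ^ (a / 2) := by
    intro r hr
    have h1 := hC' r hr
    rw [hfC r hr, ← h, add_zero, ← Real.rpow_natCast_mul hr.le] at h1
    calc C = C * r ^ (((2 : ℕ) : ℝ) * -(a / 2)) * r ^ a := by
          rw [mul_assoc, ← Real.rpow_add hr]
          push_cast
          rw [show 2 * -(a / 2) + a = 0 by ring, Real.rpow_zero, mul_one]
      _ ≤ C' * r ^ (-(a / 2)) * r ^ a := by gcongr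
      _ = _ := by
          rw [mul_assoc, ← Real.rpow_add hr]
          ring_nf
  have ht : Tendsto (fun r : ℝ => C' * r ^ (a / 2)) (𝓝[>] 0) (𝓝 0) := by
    have h1 : Tendsto (fun r : ℝ => r ^ (a / 2)) (𝓝[>] 0) (𝓝 (0 ^ (a / 2))) :=
      ((Real.continuousAt_rpow_const 0 (a / 2) (Or.inr (by positivity))).tendsto).mono_left
        nhdsWithin_le_nhds
    rw [Real.zero_rpow (by positivity)] at h1
    simpa using h1.const_mul C'
  refine absurd (ge_of_tendsto ht ?_) (not_le.2 hC0)
  filter_upwards [self_mem_nhdsWithin] with r hr using hle r hr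

end IsRadialChain

/-! ### The multiplier and the energy of a bubble -/

namespace IsRadialChain

variable {α q c : ℝ} {m : ℕ} {f g : ℕ → ℝ → ℝ}

/-- The identity `h = L f'` is preserved by the operator in the first angular sector. -/
lemma confH_add_eq_zero (hc : IsRadialChain α m q c f g) {L : ℝ}
    (hL : ∀ r, 0 < r → confH α m f g 0 r + L * g 0 r = 0) {j : ℕ} (hj : j < m) :
    (∀ r, 0 < r → confH α m f g j r + L * g j r = 0) ∧
      ∀ r, 0 < r → confK α m f g j r + L * f (j + 1) r = 0 := by
  have step : ∀ j < m, (∀ r, 0 < r → confH α m f g j r + L * g j r = 0) →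
      ∀ r, 0 < r → confK α m f g j r + L * f (j + 1) r = 0 := by
    intro j hj h r hr
    have h1 := (hc.hasDerivAt_confH hj hr).fun_add ((hc.hasDerivAt_g j hj r hr).const_mul L)
    have h2 : HasDerivAt (fun r => confH α m f g j r + L * g j r) 0 r :=
      (hasDerivAt_const r (0 : ℝ)).congr_of_eventuallyEq (by
        filter_upwards [Ioi_mem_nhds hr] with s hs using h s hs)
    linear_combination h1.unique h2 + α / r * h r hr
  suffices h : ∀ r, 0 < r → confH α m f g j r + L * g j r = 0 from ⟨h, step j hj h⟩
  induction j with
  | zero => exact hL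
  | succ j ih =>
    intro r hr
    have h := step j (by omega) (ih (by omega))
    have h1 := (hc.hasDerivAt_confK (j := j) (by omega) hr).fun_add
      ((hc.hasDerivAt_f (j + 1) (by omega) r hr).const_mul L)
    have h2 : HasDerivAt (fun r => confK α m f g j r + L * f (j + 1) r) 0 r :=
      (hasDerivAt_const r (0 : ℝ)).congr_of_eventuallyEq (by
        filter_upwards [Ioi_mem_nhds hr] with s hs using h s hs)
    linear_combination -h1.unique h2

/-- The limits at the origin of the powers of the operator applied to a bubble. -/
lemma tendsto_bubble_zero (hc : IsRadialChain α m q c f g) {L ℓ : ℝ}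
    (hL0 : 0 < L) (hL : ∀ r, 0 < r → confH α m f g 0 r + L * g 0 r = 0)
    (h0 : Tendsto (f 0) (𝓝[>] 0) (𝓝 ℓ)) {j : ℕ} (hj : j ≤ m) :
    Tendsto (f j) (𝓝[>] 0)
      (𝓝 ((∏ i ∈ Finset.range j, (α + 1 + 2 * i) * (α - 2 * m + 1 + 2 * i)) / L ^ j * ℓ)) := by
  induction j with
  | zero => simpa using h0
  | succ j ih =>
    have hj' : j < m := hj
    have ih := ih hj'.le
    set ℓj := (∏ i ∈ Finset.range j, (α + 1 + 2 * i) * (α - 2 * m + 1 + 2 * i)) / L ^ j * ℓ with hℓj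
    obtain ⟨hH, hK⟩ := hc.confH_add_eq_zero hL hj'
    have hid : Tendsto (fun r : ℝ => r) (𝓝[>] 0) (𝓝 0) := tendsto_id.mono_left nhdsWithin_le_nhds
    have hjm : (0 : ℝ) ≤ m - j := sub_nonneg.2 (by exact_mod_cast hj'.le)
    -- the term with `g (j - 1)` has a favourable sign, which gives `L r g_j ≤ (a + 4j) r² f_j`
    have hrg : Tendsto (fun r => r * g j r) (𝓝[>] 0) (𝓝 0) := by
      have hup : Tendsto (fun r => (α + 1 - 2 * m + 4 * j) / L * (r ^ 2 * f j r)) (𝓝[>] 0) (𝓝 0) := by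
        simpa using ((hid.pow 2).mul ih).const_mul ((α + 1 - 2 * m + 4 * j) / L)
      refine tendsto_of_tendsto_of_tendsto_of_le_of_le' tendsto_const_nhds hup ?_ ?_
      · filter_upwards [self_mem_nhdsWithin] with r hr
        exact mul_nonneg (le_of_lt hr) (hc.g_pos j hj'.le r hr).le
      · filter_upwards [self_mem_nhdsWithin] with r hr
        have hr : 0 < r := hr
        have h1 := hH r hr
        have hg := hc.g_pos j hj'.le r hr
        have hg' := hc.g_pos (j - 1) (by omega) r hr
        have h2 : 0 ≤ r * (4 * j * (m - j) * g (j - 1) r) := by positivity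
        have h3 : 0 ≤ r ^ 2 * (r * g j r) := by positivity
        rw [div_mul_eq_mul_div, le_div_iff₀ hL0]
        simp only [confH] at h1
        nlinarith
    have hlim : Tendsto (fun r => ((α + 1 + 2 * j) * (α - 2 * m + 1 + 2 * j) * f j r -
        (α + 1 - 2 * m + 4 * j + 2) * (r * g j r)) / (r ^ 2 + L)) (𝓝[>] 0)
        (𝓝 (((α + 1 + 2 * j) * (α - 2 * m + 1 + 2 * j) * ℓj -
          (α + 1 - 2 * m + 4 * j + 2) * 0) / (0 ^ 2 + L))) :=
      ((ih.const_mul _).sub (hrg.const_mul _)).div ((hid.pow 2).add_const L) (by positivity)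
    have heq : ((α + 1 + 2 * j) * (α - 2 * m + 1 + 2 * j) * ℓj -
          (α + 1 - 2 * m + 4 * j + 2) * 0) / (0 ^ 2 + L) =
        (∏ i ∈ Finset.range (j + 1), (α + 1 + 2 * i) * (α - 2 * m + 1 + 2 * i)) / L ^ (j + 1) * ℓ := by
      rw [Finset.prod_range_succ, hℓj]
      field_simp
      ring
    rw [heq] at hlim
    refine hlim.congr' ?_
    filter_upwards [self_mem_nhdsWithin] with r hr
    have h1 := hK r hr
    have hr : 0 < r := hr
    rw [div_eq_iff (by positivity)]
    simp only [confK] at h1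
    linear_combination -h1

/-- The multiplier of the equation solved by a bubble. -/
lemma c_mul_rpow_eq (hc : IsRadialChain α m q c f g) (hα : 0 < α - 2 * m + 1)
    (hq : q = 2 * (α + 1) / (α - 2 * m + 1)) {L C : ℝ}
    (hL0 : 0 < L) (hC : 0 < C) (hL : ∀ r, 0 < r → confH α m f g 0 r + L * g 0 r = 0)
    (hf : ∀ r, 0 < r → f 0 r = C * (r ^ 2 + L) ^ (-((α - 2 * m + 1) / 2))) :
    c * C ^ (q - 2) =
      (∏ i ∈ Finset.range m, (α + 1 + 2 * i) * (α - 2 * m + 1 + 2 * i)) * L ^ (m : ℝ) := by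
  set ℓ := C * L ^ (-((α - 2 * m + 1) / 2)) with hℓ
  have hℓ0 : 0 < ℓ := by positivity
  have h0 : Tendsto (f 0) (𝓝[>] 0) (𝓝 ℓ) := by
    have h1 : Tendsto (fun r : ℝ => r ^ 2 + L) (𝓝[>] 0) (𝓝 L) := by
      have hid : Tendsto (fun r : ℝ => r) (𝓝[>] 0) (𝓝 0) := tendsto_id.mono_left nhdsWithin_le_nhds
      simpa using (hid.pow 2).add_const L
    refine ((h1.rpow_const (Or.inl hL0.ne')).const_mul C).congr' ?_
    filter_upwards [self_mem_nhdsWithin] with r hr using (hf r hr).symm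
  have h1 := hc.tendsto_bubble_zero hL0 hL h0 le_rfl
  have h2 : Tendsto (f m) (𝓝[>] 0) (𝓝 (c * ℓ ^ (q - 1))) := by
    refine ((h0.rpow_const (Or.inl hℓ0.ne')).const_mul c).congr' ?_
    filter_upwards [self_mem_nhdsWithin] with r hr using (hc.top_f r hr).symm
  have h3 := tendsto_nhds_unique h2 h1
  have h4 : c * ℓ ^ (q - 2) =
      (∏ i ∈ Finset.range m, (α + 1 + 2 * i) * (α - 2 * m + 1 + 2 * i)) / L ^ m := by
    rw [show q - 1 = (q - 2) + 1 by ring, Real.rpow_add_one hℓ0.ne', ← mul_assoc] at h3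
    exact mul_right_cancel₀ hℓ0.ne' h3
  have h5 : ℓ ^ (q - 2) = C ^ (q - 2) * L ^ (-(2 * m : ℝ)) := by
    rw [hℓ, Real.mul_rpow hC.le (by positivity), ← Real.rpow_mul hL0.le]
    congr 2
    rw [hq]
    field_simp
    ring
  rw [h5, ← Real.rpow_natCast] at h4
  have h6 : L ^ (-(2 * m : ℝ)) * L ^ (m : ℝ) * L ^ (m : ℝ) = 1 := by
    rw [← Real.rpow_add hL0, ← Real.rpow_add hL0]
    ring_nf
    simp
  have h7 : 0 < L ^ (m : ℝ) := by positivity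
  rw [eq_div_iff h7.ne'] at h4
  rw [← h4]
  linear_combination (-(c * C ^ (q - 2))) * h6

end IsRadialChain

lemma prodP_eq (m : ℕ) (α : ℝ) :
    prodP m α = ∏ i ∈ Finset.range m, (α + 1 + 2 * i) * (α - 2 * m + 1 + 2 * i) := by
  have h : ∀ k : ℕ, ∏ h ∈ Finset.Ico (-(m : ℤ)) (-(m : ℤ) + k), (α + 1 + 2 * (h : ℝ)) =
      ∏ i ∈ Finset.range k, (α - 2 * m + 1 + 2 * i) := by
    intro k
    induction k with
    | zero => simp
    | succ k ih =>
      rw [Finset.prod_range_succ, ← ih]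
      push_cast
      rw [← add_assoc, ← Finset.insert_Ico_right_eq_Ico_add_one (by omega),
        Finset.prod_insert (by simp)]
      push_cast
      ring
  have h2 := h (m + m)
  rw [show -(m : ℤ) + ((m + m : ℕ) : ℤ) = m by push_cast; ring, Finset.prod_range_add] at h2
  rw [prodP, h2, Finset.prod_mul_distrib, mul_comm]
  congr 1
  refine Finset.prod_congr rfl fun i _ => ?_
  push_cast
  ring

/-- The integral of a bubble: write `(r² + L)^{-n}` as a Laplace transform and exchange the
integrals. -/
lemma lintegral_bubble {n L : ℝ} (hn : 0 < n) (hL : 0 < L) :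
    ∫⁻ r in Ioi (0 : ℝ), ENNReal.ofReal (r ^ (n - 1)) * ENNReal.ofReal ((r ^ 2 + L) ^ (-n)) =
      ENNReal.ofReal (L ^ (-(n / 2)) * (Real.Gamma (n / 2) ^ 2 / (2 * Real.Gamma n))) := by
  have hG := Real.Gamma_pos_of_pos hn
  have hG2 := Real.Gamma_pos_of_pos (half_pos hn)
  -- the Gamma integrals as lower integrals
  have gam : ∀ {s b : ℝ}, 0 < s → 0 < b → ∫⁻ t in Ioi (0 : ℝ),
      ENNReal.ofReal (t ^ (s - 1) * Real.exp (-b * t ^ (1 : ℝ))) =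
        ENNReal.ofReal (b ^ (-s) * Real.Gamma s) := by
    intro s b hs hb
    rw [← ofReal_integral_eq_lintegral_ofReal (integrableOn_rpow_mul_exp_neg_mul_rpow
      (by linarith) one_pos hb) ((ae_restrict_iff' measurableSet_Ioi).2
        (Eventually.of_forall fun t ht => by have : 0 < t := ht; simp only [Pi.zero_apply]; positivity)),
      integral_rpow_mul_exp_neg_mul_rpow one_pos (by linarith) hb]
    simp
  have gam2 : ∀ {b : ℝ}, 0 < b → ∫⁻ t in Ioi (0 : ℝ),
      ENNReal.ofReal (t ^ (n - 1) * Real.exp (-b * t ^ (2 : ℝ))) =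
        ENNReal.ofReal (b ^ (-(n / 2)) * (Real.Gamma (n / 2) / 2)) := by
    intro b hb
    rw [← ofReal_integral_eq_lintegral_ofReal (integrableOn_rpow_mul_exp_neg_mul_rpow
      (by linarith) two_pos hb) ((ae_restrict_iff' measurableSet_Ioi).2
        (Eventually.of_forall fun t ht => by have : 0 < t := ht; simp only [Pi.zero_apply]; positivity)),
      integral_rpow_mul_exp_neg_mul_rpow two_pos (by linarith) hb]
    rw [show n - 1 + 1 = n by ring, neg_div]
    congr 1
    ring
  have hpos : ∀ r : ℝ, 0 < r ^ 2 + L := fun r => by positivity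
  have h1 : ENNReal.ofReal (Real.Gamma n) * ∫⁻ r in Ioi (0 : ℝ), ENNReal.ofReal (r ^ (n - 1)) *
        ENNReal.ofReal ((r ^ 2 + L) ^ (-n)) =
      ∫⁻ r in Ioi (0 : ℝ), ∫⁻ t in Ioi (0 : ℝ), ENNReal.ofReal (r ^ (n - 1)) *
        ENNReal.ofReal (t ^ (n - 1) * Real.exp (-(r ^ 2 + L) * t ^ (1 : ℝ))) := by
    rw [← lintegral_const_mul' _ _ (by simp)]
    refine lintegral_congr fun r => ?_
    rw [lintegral_const_mul' _ _ (by simp), gam hn (hpos r),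
      ENNReal.ofReal_mul (Real.rpow_nonneg (hpos r).le _)]
    ring
  have h2 : ∫⁻ r in Ioi (0 : ℝ), ∫⁻ t in Ioi (0 : ℝ), ENNReal.ofReal (r ^ (n - 1)) *
        ENNReal.ofReal (t ^ (n - 1) * Real.exp (-(r ^ 2 + L) * t ^ (1 : ℝ))) =
      ∫⁻ t in Ioi (0 : ℝ), ENNReal.ofReal (Real.Gamma (n / 2) / 2) *
        ENNReal.ofReal (t ^ (n / 2 - 1) * Real.exp (-L * t ^ (1 : ℝ))) := by
    rw [lintegral_lintegral_swap (by unfold Function.uncurry; fun_prop)]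
    refine setLIntegral_congr_fun measurableSet_Ioi fun t ht => ?_
    have ht : 0 < t := ht
    calc ∫⁻ r in Ioi (0 : ℝ), ENNReal.ofReal (r ^ (n - 1)) *
          ENNReal.ofReal (t ^ (n - 1) * Real.exp (-(r ^ 2 + L) * t ^ (1 : ℝ)))
        = ∫⁻ r in Ioi (0 : ℝ), ENNReal.ofReal (t ^ (n - 1) * Real.exp (-L * t ^ (1 : ℝ))) *
          ENNReal.ofReal (r ^ (n - 1) * Real.exp (-t * r ^ (2 : ℝ))) := by
          refine setLIntegral_congr_fun measurableSet_Ioi fun r hr => ?_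
          have hr : 0 < r := hr
          rw [← ENNReal.ofReal_mul (by positivity), ← ENNReal.ofReal_mul (by positivity)]
          congr 1
          rw [show -(r ^ 2 + L) * t ^ (1 : ℝ) = -L * t ^ (1 : ℝ) + -t * r ^ (2 : ℝ) by
            rw [Real.rpow_one, Real.rpow_two]; ring, Real.exp_add]
          ring
      _ = _ := by
          rw [lintegral_const_mul' _ _ (by simp), gam2 ht, ← ENNReal.ofReal_mul (by positivity),
            ← ENNReal.ofReal_mul (by positivity)]
          congr 1
          rw [show n / 2 - 1 = (n - 1) + -(n / 2) by ring, Real.rpow_add ht]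
          ring
  rw [h2, lintegral_const_mul' _ _ (by simp), gam (half_pos hn) hL,
    ← ENNReal.ofReal_mul (by positivity)] at h1
  calc _ = ENNReal.ofReal (Real.Gamma n)⁻¹ * (ENNReal.ofReal (Real.Gamma n) *
        ∫⁻ r in Ioi (0 : ℝ), ENNReal.ofReal (r ^ (n - 1)) *
          ENNReal.ofReal ((r ^ 2 + L) ^ (-n))) := by
        rw [← mul_assoc, ← ENNReal.ofReal_mul (by positivity), inv_mul_cancel₀ hG.ne']
        simp
    _ = _ := by
        rw [h1, ← ENNReal.ofReal_mul (by positivity)]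
        congr 1
        field_simp

/-! ### The best constant -/

/-- The value of the infimum, computed at the bubbles. -/
lemma sobolevInf_eq_of_isSobolevMinimizer {m : ℕ} (hm : 1 ≤ m) {α : ℝ} (hα : 0 < α - 2 * m + 1)
    {z : ℝ → ℝ} (hz : IsSobolevMinimizer m α z) :
    sobolevInf m α = ENNReal.ofReal (prodP m α *
      (Real.Gamma ((α + 1) / 2) ^ 2 / (2 * Real.Gamma (α + 1))) ^ (2 * m / (α + 1))) := by
  have hm1 : (1 : ℝ) ≤ m := by exact_mod_cast hm
  have hα1 : 1 < α := by linarith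
  obtain ⟨q, hq⟩ : ∃ q, q = 2 * (α + 1) / (α - 2 * m + 1) := ⟨_, rfl⟩
  have hq2 : 2 < q := by
    rw [hq, lt_div_iff₀ hα]
    linarith
  obtain ⟨ψ, c, hψm, hc0, hc, hψ, hN0, hN, hS⟩ := exists_euler_lagrange hm hα hq hz
  obtain ⟨f, g, hch, hψf⟩ := exists_isRadialChain hm hα hq hψm hc0 hc hψ hN0 hN
  have hN' : ∫⁻ r, ψ r ^ q ∂radialMeasure α =
      ∫⁻ r, ENNReal.ofReal (f 0 r) ^ q ∂radialMeasure α :=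
    lintegral_congr_ae (ae_radialMeasure_of_forall α fun r hr => by simp only [hψf r hr])
  obtain ⟨L, C, hL, hC, hH, hf⟩ :=
    hch.exists_eq_bubble hm hα hα1 hq (by linarith) (by rwa [← hN'])
  have hmul := hch.c_mul_rpow_eq hα hq hL hC hH hf
  rw [← prodP_eq] at hmul
  have hn : 0 < α + 1 := by linarith
  set B := Real.Gamma ((α + 1) / 2) ^ 2 / (2 * Real.Gamma (α + 1)) with hB
  have hB0 : 0 < B := by
    have h1 := Real.Gamma_pos_of_pos hn
    have h2 := Real.Gamma_pos_of_pos (half_pos hn)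
    positivity
  have hnorm : ∫⁻ r, ψ r ^ q ∂radialMeasure α =
      ENNReal.ofReal (C ^ q * (L ^ (-((α + 1) / 2)) * B)) := by
    rw [hN', lintegral_radialMeasure, ENNReal.ofReal_mul (by positivity), ← lintegral_bubble hn hL,
      ← lintegral_const_mul' _ _ (by simp)]
    refine setLIntegral_congr_fun measurableSet_Ioi fun r hr => ?_
    have h1 : 0 < r ^ 2 + L := by positivity
    have h2 : 0 < f 0 r := hch.f_pos 0 (by omega) r hr
    rw [ENNReal.ofReal_rpow_of_pos h2, hf r hr, Real.mul_rpow hC.le (by positivity),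
      ← Real.rpow_mul h1.le, ENNReal.ofReal_mul (by positivity), add_sub_cancel_right,
      show -((α - 2 * m + 1) / 2) * q = -(α + 1) by rw [hq]; field_simp]
    ring
  have hexp : 1 - 2 / q = 2 * m / (α + 1) := by
    rw [hq]
    field_simp
    ring
  have hpow : (C ^ q * (L ^ (-((α + 1) / 2)) * B)) ^ (2 * m / (α + 1)) =
      C ^ (q - 2) * (L ^ (-(m : ℝ)) * B ^ (2 * m / (α + 1))) := by
    rw [Real.mul_rpow (by positivity) (by positivity), Real.mul_rpow (by positivity) hB0.le,
      ← Real.rpow_mul hC.le, ← Real.rpow_mul hL.le, ← hexp]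
    congr 2
    · field_simp
    · rw [hexp]
      congr 2
      field_simp
  rw [hS, hnorm, hexp, ENNReal.ofReal_rpow_of_pos (by positivity), hpow]
  rw [← ENNReal.ofReal_toReal hc, ← ENNReal.ofReal_mul ENNReal.toReal_nonneg]
  congr 1
  rw [← mul_assoc, hmul, Real.rpow_neg hL.le]
  field_simp

lemma prodP_pos {m : ℕ} {α : ℝ} (hα : 0 < α - 2 * m + 1) : 0 < prodP m α := by
  have hm : (0 : ℝ) ≤ m := by positivity
  rw [prodP_eq]
  refine Finset.prod_pos fun i _ => ?_
  have hi : (0 : ℝ) ≤ i := by positivity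
  exact mul_pos (by linarith) (by linarith)

lemma bestConstValue_eq {m : ℕ} {α : ℝ} (hα : 0 < α - 2 * m + 1) :
    (prodP m α * (Real.Gamma ((α + 1) / 2) ^ 2 / (2 * Real.Gamma (α + 1))) ^ (2 * m / (α + 1))) ^
      (-(1 / 2) : ℝ) = bestConstValue m α := by
  have hm : (0 : ℝ) ≤ m := by positivity
  have hn : 0 < α + 1 := by linarith
  have h1 := Real.Gamma_pos_of_pos hn
  have h2 := Real.Gamma_pos_of_pos (half_pos hn)
  rw [Real.mul_rpow (prodP_pos hα).le (by positivity), bestConstValue,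
    ← Real.rpow_mul (by positivity),
    show 2 * m / (α + 1) * (-(1 / 2) : ℝ) = -(m / (α + 1)) by field_simp,
    Real.rpow_neg (x := _ / _) (by positivity), ← Real.inv_rpow (x := _ / _) (by positivity), inv_div,
    sq]

lemma isLeast_embeddingConst {m : ℕ} {α : ℝ} {z : ℝ → ℝ} (hz : IsSobolevMinimizer m α z) {σ : ℝ}
    (hσ : 0 < σ) (hS : sobolevInf m α = ENNReal.ofReal σ) :
    IsLeast {C : ℝ | IsEmbeddingConst m α C} (σ ^ (-(1 / 2) : ℝ)) := by
  set K := σ ^ (-(1 / 2) : ℝ) with hK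
  have hK0 : 0 < K := Real.rpow_pos_of_pos hσ _
  have hKσ : K ^ 2 * σ = 1 := by
    rw [hK, ← Real.rpow_natCast, ← Real.rpow_mul hσ.le]
    norm_num
    rw [Real.rpow_neg_one, inv_mul_cancel₀ hσ.ne']
  have hS0 : sobolevInf m α ≠ 0 := by rw [hS]; simpa using hσ
  have hStop : sobolevInf m α ≠ ∞ := by rw [hS]; simp
  refine ⟨⟨hK0.le, fun u hu => ?_⟩, fun C hC => ?_⟩
  · set A := eLpNorm (radialGrad m α u) 2 (radialMeasure α) with hA
    set B := eLpNorm u (critExp m α) (radialMeasure α) with hB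
    by_cases h0 : ∃ r : ℝ, 0 < r ∧ u r ≠ 0
    · have hle : sobolevInf m α ≤ A ^ 2 / B ^ 2 := iInf₂_le u ⟨hu, h0⟩
      rcases eq_or_ne B 0 with hB0 | hB0
      · simp [hB0]
      rcases eq_or_ne B ∞ with hBt | hBt
      · rw [hBt] at hle
        simp [hS0] at hle
      rw [ENNReal.le_div_iff_mul_le (Or.inl (by simpa using hB0))
        (Or.inl (ENNReal.pow_ne_top hBt)), hS] at hle
      have h1 : B ^ 2 ≤ (ENNReal.ofReal K * A) ^ 2 := by
        calc B ^ 2 = ENNReal.ofReal K ^ 2 * (ENNReal.ofReal σ * B ^ 2) := by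
              rw [← mul_assoc, ← ENNReal.ofReal_pow hK0.le, ← ENNReal.ofReal_mul (by positivity),
                hKσ]
              simp
          _ ≤ ENNReal.ofReal K ^ 2 * A ^ 2 := by gcongr
          _ = _ := by ring
      exact (ENNReal.pow_right_strictMono two_ne_zero).le_iff_le.1 h1
    · push Not at h0
      have hu0 : u =ᵐ[radialMeasure α] 0 := ae_radialMeasure_of_forall α h0
      rw [hB, eLpNorm_congr_ae hu0]
      simp
  · have hq := hz.2
    have hle := hC.2 z hz.1.1
    rw [sobolevQuotient] at hq
    set A := eLpNorm (radialGrad m α z) 2 (radialMeasure α) with hA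
    set B := eLpNorm z (critExp m α) (radialMeasure α) with hB
    have hB0 : B ≠ 0 := by
      intro h
      rcases eq_or_ne A 0 with h' | h'
      · simp [h, h', hS0.symm] at hq
      · rw [h, zero_pow two_ne_zero, ENNReal.div_zero (by simpa using h')] at hq
        exact hStop hq.symm
    have hBt : B ≠ ∞ := by
      intro h
      simp [h, hS0.symm] at hq
    have hB20 : B ^ 2 ≠ 0 := by simpa using hB0
    have hB2t : B ^ 2 ≠ ∞ := ENNReal.pow_ne_top hBt
    have hA2 : A ^ 2 = ENNReal.ofReal σ * B ^ 2 := by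
      rw [← hS, ← hq, ENNReal.div_mul_cancel hB20 hB2t]
    have h1 : 1 * B ^ 2 ≤ ENNReal.ofReal (C ^ 2 * σ) * B ^ 2 := by
      calc 1 * B ^ 2 ≤ (ENNReal.ofReal C * A) ^ 2 := by rw [one_mul]; gcongr
        _ = _ := by
          rw [mul_pow, hA2, ← mul_assoc, ← ENNReal.ofReal_pow hC.1,
            ← ENNReal.ofReal_mul (by positivity)]
    have h2 : 1 ≤ C ^ 2 * σ :=
      ENNReal.one_le_ofReal.1 ((ENNReal.mul_le_mul_iff_left hB20 hB2t).1 h1)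
    rw [← hKσ] at h2
    exact (pow_le_pow_iff_left₀ hK0.le hC.1 two_ne_zero).1 (le_of_mul_le_mul_right h2 hσ)

theorem theorem1p3 (m : ℕ) (hm : 1 ≤ m) (α : ℝ) (hα : 0 < α - 2 * m + 1)
    (hmin : ∃ z : ℝ → ℝ, IsSobolevMinimizer m α z ∧ IsNonsingularAtZero m (2 * m - 1) z ∧
      ∀ i ≤ 2 * m - 1, Odd i → Tendsto (iteratedDeriv i z) (𝓝[>] 0) (𝓝 0)) :
    sobolevInf m α ^ (-(1 / 2) : ℝ) = ENNReal.ofReal (bestConstValue m α) ∧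
      IsLeast {C : ℝ | IsEmbeddingConst m α C} (bestConstValue m α) := by
  obtain ⟨z, hz, -⟩ := hmin
  have hS := sobolevInf_eq_of_isSobolevMinimizer hm hα hz
  have hn : 0 < α + 1 := by
    have : (0 : ℝ) ≤ m := by positivity
    linarith
  have hσ : 0 < prodP m α *
      (Real.Gamma ((α + 1) / 2) ^ 2 / (2 * Real.Gamma (α + 1))) ^ (2 * m / (α + 1)) := by
    have h1 := Real.Gamma_pos_of_pos hn
    have h2 := Real.Gamma_pos_of_pos (half_pos hn)
    have h3 := prodP_pos hα
    positivity
  rw [← bestConstValue_eq hα]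
  refine ⟨?_, isLeast_embeddingConst hz hσ hS⟩
  rw [hS, ENNReal.ofReal_rpow_of_pos hσ]
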